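/- Let $E/F$ be a separable quadratic extension of non-archimedean local fields (ramified or unramified, of any residual characteristic), with non-trivial automorphism $x\mapsto x^c$, rings of integers $\mathfrak o\subset\mathfrak r$, residue cardinalities $q_F,q_E$, normalized absolute value $|\cdot|_E$, and $\varpi_E$ a uniformizer of $E$. Let $\delta\in E^\times$ satisfy $\delta^c=-\delta$ and $|\delta|_E=\max_{x\in\mathfrak r}|x-x^c|_E$ (that is, $\delta$ generates the different of $E/F$; such $\delta$ exists). Put $$T'=\begin{pmatrix}0&\delta\\-\delta&0\end{pmatrix},\quad T=\begin{pmatrix}0&0&\delta\\0&1&0\\-\delta&0&0\end{pmatrix},\quad \iota\begin{pmatrix}a&b\\c&d\end{pmatrix}=\begin{pmatrix}a&0&b\\0&1&0\\c&0&d\end{pmatrix},$$ $H=\{h\in \mathrm{GL}_2(E): {}^th^cT'h=T'\}$, $G=\{g\in \mathrm{GL}_3(E): {}^tg^cTg=T\}$, so that $\iota:H\to G$ is an embedding. Let $(\mathcal K',\mathcal K)$ be the pair of special maximal compact subgroups $H\cap \mathrm{GL}_2(\mathfrak r)$, $G\cap\mathrm{GL}_3(\mathfrak r)$, or its conjugate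 $(h_0\mathcal K'h_0^{-1},\iota(h_0)\mathcal K\iota(h_0)^{-1})$ by some $h_0\in H$. Let $dh$ be the Haar measure on $H$ giving $\mathcal K'$ volume $1$. Let $\chi,\rho$ be unramified characters of $E^\times$, and put $\beta=\chi(\varpi_E)$, $\gamma=\rho(\varpi_E)$. Assume $\max(|\beta|,|\beta|^{-1})\cdot\max(|\gamma|,|\gamma|^{-1})<q_E^{1/2}$ (for example, $\chi$ and $\rho$ unitary). Let $\sigma=I'(\rho)$ be the space of smooth functions $f'$ on $H$ with $$f'\left(\begin{pmatrix}\alpha&0\\0&(\alpha^c)^{-1}\end{pmatrix}\begin{pmatrix}1&b\\0&1\end{pmatrix}h\right)=\rho(\alpha)|\alpha|_E^{1/2}f'(h)\qquad(\alpha\in E^\times,\ b\in F),$$ and $\pi=I(\chi)$ the space of smooth functions $f$ on $G$ with $f(\mathrm{diag}(\alpha,g_0,(\alpha^c)^{-1})\,u\,g)=\chi(\alpha)|\alpha|_Ef(g)$ for $\alpha\in E^\times$, $g_0\in E^\times$ with $g_0g_0^c=1$, and $u\in G$ upper triangular unipotent; the groups act by right translation. Let $f_\chi\in I(\chi)$ and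 $f'_\rho\in I'(\rho)$ be the spherical vectors, equal to $1$ on $\mathcal K$ and on $\mathcal K'$ respectively, and likewise for $\chi^{-1},\rho^{-1}$. Let $\langle\,,\rangle$ on $I(\chi)\times I(\chi^{-1})$ and $\langle\,,\rangle'$ on $I'(\rho)\times I'(\rho^{-1})$ be invariant bilinear pairings with $\langle f_\chi,f_{\chi^{-1}}\rangle=\langle f'_\rho,f'_{\rho^{-1}}\rangle'=1$. Then $$J(f_\chi,f'_\rho)=\int_H\langle\pi(\iota(h))f_\chi,f_{\chi^{-1}}\rangle\,\langle\sigma(h)f'_\rho,f'_{\rho^{-1}}\rangle'\,dh$$ converges absolutely and $$J(f_\chi,f'_\rho)=\mathscr L(\pi\times\sigma):=\frac{L(\frac12,\pi\times\sigma)}{L(1,\pi,\mathrm{Ad})\,L(1,\sigma,\mathrm{Ad})}\prod_{i=1}^3L(i,\epsilon_{E/F}^i).$$ Here $\epsilon_{E/F}$ is the quadratic character of $F^\times$ with kernel the norms from $E^\times$, $\chi_0=\chi|_{F^\times}$, $L(s,\psi)$ is the usual $L$-factor of a character of $E^\times$ or $F^\times$ (equal to $(1-\psi(\varpi)q^{-s})^{-1}$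 if $\psi$ is unramified and to $1$ otherwise), $\zeta_E(s)$ and $\zeta_F(s)$ are the $L$-factors of the trivial characters, and $$L(s,\pi\times\sigma)=L(s,\chi\rho)L(s,\chi\rho^{-1})L(s,\chi^{-1}\rho)L(s,\chi^{-1}\rho^{-1})L(s,\rho)L(s,\rho^{-1}),$$ $$L(s,\sigma,\mathrm{Ad})=\zeta_F(s)L(s,\epsilon_{E/F})L(s,\rho|_{F^\times})L(s,\rho^{-1}|_{F^\times}),$$ $$L(s,\pi,\mathrm{Ad})=\zeta_E(s)L(s,\epsilon_{E/F})L(s,\chi)L(s,\chi^{-1})L(s,\epsilon_{E/F}\chi_0)L(s,\epsilon_{E/F}\chi_0^{-1}).$$ -/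

import Mathlib

open scoped ValuativeRel Topology
open MeasureTheory ValuativeRel

noncomputable section

namespace LocalU3U2

/-! ### Local fields and local `L`-factors -/

section LocalField

variable (K : Type*) [Field K] [ValuativeRel K] [TopologicalSpace K] [IsNonarchimedeanLocalField K]

/-- The cardinality of the residue field. -/
def resCard : ℕ := Nat.card 𝓀[K]

theorem exists_unif : ∃ x : Kˣ, ∃ h : valuation K (x : K) ≤ 1,
    Irreducible (⟨(x : K), h⟩ : 𝒪[K]) := by
  obtain ⟨p, hp⟩ := IsDiscreteValuationRing.exists_irreducible 𝒪[K]
  have h0 : (p : K) ≠ 0 := fun h => hp.ne_zero (Subtype.ext h)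
  exact ⟨Units.mk0 (p : K) h0, p.2, hp⟩

/-- A generator of the maximal ideal of the ring of integers. -/
def unif : Kˣ := (exists_unif K).choose

variable {K}

/-- A character of `Kˣ` is unramified if it is trivial on the units of the ring of integers. -/
def IsUnram (ψ : Kˣ → ℂ) : Prop := ∀ u : Kˣ, valuation K (u : K) = 1 → ψ u = 1

/-- The normalized absolute value: a generator of the maximal ideal is sent to `1 / resCard K`. -/
def absv (x : K) : ℝ :=
  (WithZeroMulInt.toNNReal (e := (resCard K : NNReal))
    (Nat.cast_ne_zero.mpr (Nat.card_pos (α := 𝓀[K])).ne')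
    (IsNonarchimedeanLocalField.valueGroupWithZeroIsoInt K (valuation K x)) : ℝ)

open Classical in
/-- The `L`-factor `L(s, ψ)` of a character `ψ` of `Kˣ`. -/
def charL (ψ : Kˣ → ℂ) (s : ℂ) : ℂ :=
  if IsUnram ψ then (1 - ψ (unif K) * (resCard K : ℂ) ^ (-s))⁻¹ else 1

end LocalField

/-! ### Unitary groups -/

section Unitary

variable {F E : Type*} [Field F] [Field E] [Algebra F E]

/-- The unitary group `{g ∈ GL_n(E) | ᵗ(gᶜ) T g = T}` of the form `(u, v) = ᵗ(uᶜ) T v`. -/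
def unitaryGp {n : Type*} [Fintype n] [DecidableEq n] (c : E ≃ₐ[F] E) (T : Matrix n n E) :
    Subgroup (GL n E) where
  carrier := {g | ((g : Matrix n n E).map c).transpose * T * (g : Matrix n n E) = T}
  one_mem' := by simp [Matrix.map_one]
  mul_mem' := by
    intro a b ha hb
    simp only [Set.mem_ofPred_eq] at ha hb ⊢
    have hm : ((a * b : GL n E) : Matrix n n E).map c
        = (a : Matrix n n E).map c * (b : Matrix n n E).map c := by
      simp [Matrix.map_mul]
    rw [hm, Matrix.transpose_mul, Units.val_mul]
    calc _ = ((b : Matrix n n E).map c).transpose *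
          (((a : Matrix n n E).map c).transpose * T * (a : Matrix n n E)) *
            (b : Matrix n n E) := by simp only [Matrix.mul_assoc]
      _ = T := by rw [ha, hb]
  inv_mem' := by
    intro a ha
    simp only [Set.mem_ofPred_eq] at ha ⊢
    have h1 : (a : Matrix n n E) * ((a⁻¹ : GL n E) : Matrix n n E) = 1 := by
      rw [← Units.val_mul]; simp
    have h2 : (((a⁻¹ : GL n E) : Matrix n n E).map c).transpose
        * ((a : Matrix n n E).map c).transpose = 1 := by
      rw [← Matrix.transpose_mul, ← Matrix.map_mul, h1]; simp [Matrix.map_one]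
    calc _ = (((a⁻¹ : GL n E) : Matrix n n E).map c).transpose *
          (((a : Matrix n n E).map c).transpose * T * (a : Matrix n n E)) *
            ((a⁻¹ : GL n E) : Matrix n n E) := by rw [ha]
      _ = ((((a⁻¹ : GL n E) : Matrix n n E).map c).transpose *
          ((a : Matrix n n E).map c).transpose) * T *
            ((a : Matrix n n E) * ((a⁻¹ : GL n E) : Matrix n n E)) := by
          simp only [Matrix.mul_assoc]
      _ = T := by rw [h1, h2]; simp

/-- The split form in two variables (Hermitian as soon as `δᶜ = -δ`). -/
def form2 (δ : E) : Matrix (Fin 2) (Fin 2) E := !![0, δ; -δ, 0]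

/-- The orthogonal sum of the split plane and a line spanned by a vector of length `1`. -/
def form3 (δ : E) : Matrix (Fin 3) (Fin 3) E := !![0, 0, δ; 0, 1, 0; -δ, 0, 0]

/-- The group `H`, a quasi-split unitary group in two variables. -/
abbrev U2 (c : E ≃ₐ[F] E) (δ : E) : Subgroup (GL (Fin 2) E) := unitaryGp c (form2 δ)

/-- The group `G`, a quasi-split unitary group in three variables. -/
abbrev U3 (c : E ≃ₐ[F] E) (δ : E) : Subgroup (GL (Fin 3) E) := unitaryGp c (form3 δ)

/-- The map `[a, b; c, d] ↦ [a, 0, b; 0, 1, 0; c, 0, d]` on matrices. -/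
def iotaMat : Matrix (Fin 2) (Fin 2) E →* Matrix (Fin 3) (Fin 3) E where
  toFun h := !![h 0 0, 0, h 0 1; 0, 1, 0; h 1 0, 0, h 1 1]
  map_one' := by
    ext i j; fin_cases i <;> fin_cases j <;> simp
  map_mul' a b := by
    ext i j; fin_cases i <;> fin_cases j <;> simp [Matrix.mul_apply, Fin.sum_univ_succ]

/-- The embedding `ι : H → G`. -/
def iota (c : E ≃ₐ[F] E) (δ : E) : U2 c δ →* U3 c δ :=
  ((Units.map iotaMat).comp (U2 c δ).subtype).codRestrict (U3 c δ) (by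
    rintro ⟨h, hh⟩
    change ((h : Matrix (Fin 2) (Fin 2) E).map c).transpose * form2 δ
      * (h : Matrix (Fin 2) (Fin 2) E) = form2 δ at hh
    change ((iotaMat (h : Matrix (Fin 2) (Fin 2) E)).map c).transpose * form3 δ
      * iotaMat (h : Matrix (Fin 2) (Fin 2) E) = form3 δ
    have h00 := congrFun (congrFun hh 0) 0
    have h01 := congrFun (congrFun hh 0) 1
    have h10 := congrFun (congrFun hh 1) 0
    have h11 := congrFun (congrFun hh 1) 1
    simp [form2, Matrix.mul_apply, Fin.sum_univ_succ] at h00 h01 h10 h11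
    ext i j
    fin_cases i <;> fin_cases j <;>
      simp [iotaMat, form3, Matrix.mul_apply, Fin.sum_univ_succ, h00, h01, h10, h11])

end Unitary

/-! ### Smooth induced representations and their pairings -/

section Induced

variable {Γ : Type*} [Group Γ] [TopologicalSpace Γ]

/-- Functions that are right invariant under a neighbourhood of `1` and satisfy
`f (b g) = z f (g)` whenever `R b z` holds. -/
def inducedSpace (R : Γ → ℂ → Prop) : Submodule ℂ (Γ → ℂ) where
  carrier := {f | (∀ b z, R b z → ∀ g, f (b * g) = z * f g) ∧
    ∃ U ∈ 𝓝 (1 : Γ), ∀ u ∈ U, ∀ g, f (g * u) = f g}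
  zero_mem' := ⟨fun _ _ _ _ => by simp, Set.univ, Filter.univ_mem, fun _ _ _ => rfl⟩
  add_mem' := by
    rintro f f' ⟨h1, U, hU, h2⟩ ⟨h1', U', hU', h2'⟩
    refine ⟨fun b z hb g => ?_, U ∩ U', Filter.inter_mem hU hU', fun u hu g => ?_⟩
    · simp [h1 b z hb, h1' b z hb, mul_add]
    · simp [h2 u hu.1, h2' u hu.2]
  smul_mem' := by
    rintro a f ⟨h1, U, hU, h2⟩
    refine ⟨fun b z hb g => ?_, U, hU, fun u hu g => ?_⟩
    · simp [h1 b z hb, mul_left_comm]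
    · simp [h2 u hu]

variable [IsTopologicalGroup Γ]

/-- The representation of `Γ` on `inducedSpace R` by right translation. -/
def rightRep (R : Γ → ℂ → Prop) : Representation ℂ Γ (inducedSpace R) where
  toFun x :=
    { toFun := fun f => ⟨fun g => f.1 (g * x), by
        obtain ⟨f, h1, U, hU, h2⟩ := f
        refine ⟨fun b z hb g => ?_, (fun u => x⁻¹ * u * x) ⁻¹' U, ?_, fun u hu g => ?_⟩
        · simpa [mul_assoc] using h1 b z hb (g * x)
        · have hc : Continuous fun u : Γ => x⁻¹ * u * x := by fun_prop
          exact hc.continuousAt.preimage_mem_nhds (by simpa using hU)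
        · have := h2 _ hu (g * x)
          simpa [mul_assoc] using this⟩
      map_add' := fun _ _ => rfl
      map_smul' := fun _ _ => rfl }
  map_one' := by ext f g; simp
  map_mul' x y := by ext f g; simp [mul_assoc]

/-- Invariance of a bilinear pairing between two such representations. -/
def IsInvariantPairing {R R' : Γ → ℂ → Prop}
    (B : inducedSpace R →ₗ[ℂ] inducedSpace R' →ₗ[ℂ] ℂ) : Prop :=
  ∀ x f f', B (rightRep R x f) (rightRep R' x f') = B f f'

/-- The matrix coefficient `g ↦ ⟨π(g) f, f'⟩`. -/
def matCoeff {R R' : Γ → ℂ → Prop} (B : inducedSpace R →ₗ[ℂ] inducedSpace R' →ₗ[ℂ] ℂ)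
    (f : inducedSpace R) (f' : inducedSpace R') (g : Γ) : ℂ := B (rightRep R g f) f'

end Induced

/-! ### Principal series, compact subgroups and `L`-values -/

section Main

variable {F E : Type*} [Field F] [ValuativeRel F] [TopologicalSpace F]
  [IsNonarchimedeanLocalField F] [Field E] [ValuativeRel E] [TopologicalSpace E]
  [IsNonarchimedeanLocalField E] [Algebra F E]

/-- `δ` is an element of trace zero that generates the different of `E/F`: its absolute value is
the largest one among the elements `x - xᶜ` with `x` integral. -/
def IsDifferentGen (c : E ≃ₐ[F] E) (δ : E) : Prop :=
  c δ = -δ ∧ IsGreatest ((fun x : E => valuation E (x - c x)) '' {x | valuation E x ≤ 1})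
    (valuation E δ)

/-- `b = m'(α) u(y)` with `m'(α) = diag(α, (αᶜ)⁻¹)`, `u(y) = [1, y; 0, 1]`, `y ∈ F`,
and `z = ρ(α) |α|_E ^ (1/2)`. -/
def borelRel2 (c : E ≃ₐ[F] E) (δ : E) (ρ : Eˣ →* ℂˣ) (b : U2 c δ) (z : ℂ) : Prop :=
  ∃ (α : Eˣ) (y : F),
    ((b : GL (Fin 2) E) : Matrix (Fin 2) (Fin 2) E)
        = !![(α : E), 0; 0, (c (α : E))⁻¹] * !![1, algebraMap F E y; 0, 1] ∧
      z = (ρ α : ℂ) * (Real.sqrt (absv (α : E)) : ℂ)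

/-- `b = m'(α, g₀) u` with `m'(α, g₀) = diag(α, g₀, (αᶜ)⁻¹) ∈ G`, `u ∈ G` upper triangular
unipotent, and `z = χ(α) |α|_E`. -/
def borelRel3 (c : E ≃ₐ[F] E) (δ : E) (χ : Eˣ →* ℂˣ) (b : U3 c δ) (z : ℂ) : Prop :=
  ∃ (α g₀ : Eˣ) (m u : U3 c δ),
    ((m : GL (Fin 3) E) : Matrix (Fin 3) (Fin 3) E)
        = Matrix.diagonal ![(α : E), (g₀ : E), (c (α : E))⁻¹] ∧
      (∀ i j, j ≤ i → ((u : GL (Fin 3) E) : Matrix (Fin 3) (Fin 3) E) i j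
        = (1 : Matrix (Fin 3) (Fin 3) E) i j) ∧
      b = m * u ∧ z = (χ α : ℂ) * (absv (α : E) : ℂ)

/-- The space of the principal series `σ = I'(ρ)` of `H`. -/
abbrev PS2 (c : E ≃ₐ[F] E) (δ : E) (ρ : Eˣ →* ℂˣ) : Submodule ℂ (U2 c δ → ℂ) :=
  inducedSpace (borelRel2 c δ ρ)

/-- The space of the principal series `π = I(χ)` of `G`. -/
abbrev PS3 (c : E ≃ₐ[F] E) (δ : E) (χ : Eˣ →* ℂˣ) : Submodule ℂ (U3 c δ → ℂ) :=
  inducedSpace (borelRel3 c δ χ)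

/-- The points of a subgroup of `GL_n(E)` that lie in `GL_n` of the ring of integers. -/
def integralPts {n : Type*} [Fintype n] [DecidableEq n] (U : Subgroup (GL n E)) : Subgroup U :=
  (Matrix.GeneralLinearGroup.map (n := n) (algebraMap 𝒪[E] E)).range.subgroupOf U

/-- Compatible special maximal compact subgroups of `H` and `G`: simultaneous `H`-conjugates of
the integral points (hyperspecial when `E/F` is unramified). -/
def IsSpecialPair (c : E ≃ₐ[F] E) (δ : E) (K' : Subgroup (U2 c δ)) (K : Subgroup (U3 c δ)) : Prop :=
  ∃ h₀ : U2 c δ, K' = (integralPts (U2 c δ)).map (MulAut.conj h₀).toMonoidHom ∧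
    K = (integralPts (U3 c δ)).map (MulAut.conj (iota c δ h₀)).toMonoidHom

variable (F E) in
open Classical in
/-- The quadratic character of `Fˣ` attached to `E/F`: `1` on norms and `-1` elsewhere. -/
def quadChar (x : Fˣ) : ℂ := if ∃ y : E, Algebra.norm F y = (x : F) then 1 else -1

variable (F) in
/-- The restriction of a character of `Eˣ` to `Fˣ`. -/
def resChar (χ : Eˣ →* ℂˣ) (x : Fˣ) : ℂ := (χ (Units.map (algebraMap F E).toMonoidHom x) : ℂ)

/-- `L(s, π × σ)` for `π = I(χ)` and `σ = I'(ρ)`. -/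
def prodL (χ ρ : Eˣ →* ℂˣ) (s : ℂ) : ℂ :=
  charL (fun x => ((χ * ρ) x : ℂ)) s * charL (fun x => ((χ * ρ⁻¹) x : ℂ)) s *
  charL (fun x => ((χ⁻¹ * ρ) x : ℂ)) s * charL (fun x => ((χ⁻¹ * ρ⁻¹) x : ℂ)) s *
  charL (fun x => (ρ x : ℂ)) s * charL (fun x => (ρ⁻¹ x : ℂ)) s

variable (F) in
/-- `L(s, σ, Ad)` for `σ = I'(ρ)`. -/
def adL2 (ρ : Eˣ →* ℂˣ) (s : ℂ) : ℂ :=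
  charL (fun _ : Fˣ => 1) s * charL (quadChar F E) s *
  charL (resChar F ρ) s * charL (resChar F ρ⁻¹) s

variable (F) in
/-- `L(s, π, Ad)` for `π = I(χ)`. -/
def adL3 (χ : Eˣ →* ℂˣ) (s : ℂ) : ℂ :=
  charL (fun _ : Eˣ => 1) s * charL (quadChar F E) s *
  charL (fun x => (χ x : ℂ)) s * charL (fun x => (χ⁻¹ x : ℂ)) s *
  charL (fun x => quadChar F E x * resChar F χ x) s *
  charL (fun x => quadChar F E x * resChar F χ⁻¹ x) s

variable (F) in
/-- The normalized ratio
`L(1/2, π × σ) / (L(1, π, Ad) L(1, σ, Ad)) * ∏_{i = 1}^{3} L(i, ε_{E/F}^i)`. -/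
def scrL (χ ρ : Eˣ →* ℂˣ) : ℂ :=
  prodL χ ρ (1 / 2) / (adL3 F χ 1 * adL2 F ρ 1) *
    ∏ i ∈ Finset.Icc (1 : ℕ) 3, charL (fun x : Fˣ => quadChar F E x ^ i) (i : ℂ)

end Main

end LocalU3U2

end

/-!
The integral is computed by writing all three ingredients as explicit sequences indexed by the
Cartan decomposition `H = ⨆ 𝒦' m(n) 𝒦'`, `n ≥ 0`, with `m(n) = diag(ϖ⁻ⁿ, (ϖᶜ)ⁿ)`
(`exists_cartan`). After transport by the conjugating element `h₀`, both matrix coefficients are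
constant on the double coset of `m(n)`, and `ι` sends it into the double coset of `ι(m(n))`.

*Spherical functions.* Both groups act on the bottom rows of their elements, which are isotropic
vectors; a spherical vector of a principal series is a function of the valuation of the bottom row.
The structure `RowModel` records what is used of this action, so that the two groups are handled
together. An invariant pairing turns the matrix coefficient into a `𝒦`-invariant functional `ℓ`
applied to the translate of the spherical vector by `m(n)`. Successive translates differ by
restrictions of the spherical vector to sets of elements whose bottom row has first entry divisible
by `ϖᵏ`, and translating by integral unipotent elements relates the values of `ℓ` on these
restrictions (`RowModel.card_mul_mass`). The numbers
`T.card` and `T₁.card` of representatives that occur are `q_E ^ 2` and `q_F` for `G`, and `q_E` and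
`halfIndex F δ` for `H`. The outcome is a linear recurrence of order two for the spherical function,
together with its first two values (`RowModel.exists_spherical`). No explicit formula for the
pairing is needed.

*Volumes.* The double coset of `m(n + 1)` has volume `(q_E + halfIndex F δ) q_E ^ n`
(`measure_shell`): it is cut into strips according to the valuation of one row, and a strip is a
disjoint union of translates of a narrower one.

*Summation.* The generating series of a product of two sequences with recurrences of order two is a
rational function (`tsum_rec_mul`), by solving a linear system of size four; the same growth
estimates give absolute convergence. What remains is an identity of rational functions, one when
`δ` is a unit (the unramified case) and one when it is not.

*Arithmetic input.* The counts and `L`-factors depend on ramification. All facts on `E/F` are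
derived from the generator `δ` of the different: if `δ` is a unit then `q_E = q_F ^ 2`, a uniformizer
of `F` is a uniformizer of `E`, and the quadratic character is unramified with value `-1` at a
uniformizer; otherwise `q_E = q_F`, a uniformizer of `F` has the valuation of `ϖ ^ 2`, and some unit
is not a norm (`exists_quadChar_eq_neg_one`, including residual characteristic two).
-/

open scoped ValuativeRel Topology
open MeasureTheory ValuativeRel

noncomputable section

namespace LocalU3U2

set_option linter.unusedSectionVars false

/-! ### Valuations of a local field -/

section Basics

variable (K : Type*) [Field K] [ValuativeRel K] [TopologicalSpace K] [IsNonarchimedeanLocalField K]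

/-- The valuation of a uniformizer; it generates the value group. -/
def unifVal : ValueGroupWithZero K := valuation K (unif K : K)

theorem unif_irreducible : ∃ h : valuation K (unif K : K) ≤ 1,
    Irreducible (⟨(unif K : K), h⟩ : 𝒪[K]) := (exists_unif K).choose_spec

theorem unifVal_ne_zero : unifVal K ≠ 0 := by
  simp [unifVal]

theorem unifVal_pos : 0 < unifVal K := zero_lt_iff.mpr (unifVal_ne_zero K)

variable {K}

theorem isUnit_integer_iff (x : 𝒪[K]) : IsUnit x ↔ valuation K (x : K) = 1 :=
  (Valuation.integer.integers (valuation K)).isUnit_iff_valuation_eq_one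

theorem mem_maximalIdeal_iff (x : 𝒪[K]) : x ∈ 𝓂[K] ↔ valuation K (x : K) < 1 := by
  rw [IsLocalRing.mem_maximalIdeal, mem_nonunits_iff, isUnit_integer_iff]
  exact ⟨fun h => lt_of_le_of_ne x.2 h, fun h => h.ne⟩

theorem val_lt_one_iff (x : K) : valuation K x < 1 ↔ valuation K x ≤ unifVal K := by
  obtain ⟨h1, hirr⟩ := unif_irreducible K
  have hmax := hirr.maximalIdeal_eq
  constructor
  · intro h
    have hx : (⟨x, h.le⟩ : 𝒪[K]) ∈ 𝓂[K] := (mem_maximalIdeal_iff _).mpr h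
    rw [hmax, Ideal.mem_span_singleton] at hx
    obtain ⟨y, hy⟩ := hx
    have : x = (unif K : K) * (y : K) := congrArg Subtype.val hy
    rw [this, map_mul]
    exact mul_le_of_le_one_right' y.2
  · intro h
    refine h.trans_lt ?_
    have := (mem_maximalIdeal_iff (⟨(unif K : K), h1⟩ : 𝒪[K])).mp
      (by rw [hmax]; exact Ideal.mem_span_singleton_self _)
    exact this

variable (K) in
theorem unifVal_lt_one : unifVal K < 1 := (val_lt_one_iff (unif K : K)).mpr le_rfl

theorem val_zpow_unif (n : ℤ) : valuation K ((unif K : K) ^ n) = unifVal K ^ n :=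
  map_zpow₀ _ _ _

theorem exists_val_eq_pow {x : K} (hx : x ≠ 0) (h : valuation K x ≤ 1) :
    ∃ n : ℕ, valuation K x = unifVal K ^ n := by
  obtain ⟨h1, hirr⟩ := unif_irreducible K
  have hx' : (⟨x, h⟩ : 𝒪[K]) ≠ 0 := fun h => hx (congrArg Subtype.val h)
  obtain ⟨n, u, hu⟩ := IsDiscreteValuationRing.associated_pow_irreducible hx' hirr
  refine ⟨n, ?_⟩
  have h2 : x * ((u : 𝒪[K]) : K) = (unif K : K) ^ n := congrArg Subtype.val hu
  have h3 := (isUnit_integer_iff (u : 𝒪[K])).mp u.isUnit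
  have h4 := congrArg (valuation K) h2
  rw [map_mul, h3, mul_one, map_pow] at h4
  exact h4

theorem exists_val_eq_zpow {x : K} (hx : x ≠ 0) : ∃ n : ℤ, valuation K x = unifVal K ^ n := by
  rcases le_total (valuation K x) 1 with h | h
  · obtain ⟨n, hn⟩ := exists_val_eq_pow hx h
    exact ⟨n, by simpa using hn⟩
  · have h' : valuation K x⁻¹ ≤ 1 := by
      rw [map_inv₀]; exact inv_le_one_of_one_le₀ h
    obtain ⟨n, hn⟩ := exists_val_eq_pow (inv_ne_zero hx) h'
    refine ⟨-n, ?_⟩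
    rw [map_inv₀] at hn
    rw [zpow_neg, zpow_natCast, ← hn, inv_inv]

theorem unifVal_zpow_le_iff (m n : ℤ) : unifVal K ^ m ≤ unifVal K ^ n ↔ n ≤ m :=
  zpow_le_zpow_iff_right_of_lt_one₀ (unifVal_pos K) (unifVal_lt_one K)

theorem unifVal_zpow_lt_iff (m n : ℤ) : unifVal K ^ m < unifVal K ^ n ↔ n < m :=
  zpow_lt_zpow_iff_right_of_lt_one₀ (unifVal_pos K) (unifVal_lt_one K)

theorem unifVal_zpow_inj (m n : ℤ) : unifVal K ^ m = unifVal K ^ n ↔ m = n := by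
  rw [le_antisymm_iff, unifVal_zpow_le_iff, unifVal_zpow_le_iff]; omega

/-- The value group is discrete. -/
theorem val_lt_zpow_iff (x : K) (n : ℤ) :
    valuation K x < unifVal K ^ n ↔ valuation K x ≤ unifVal K ^ (n + 1) := by
  by_cases hx : x = 0
  · subst hx
    simp [zero_lt_iff, zpow_ne_zero _ (unifVal_ne_zero K)]
  obtain ⟨m, hm⟩ := exists_val_eq_zpow hx
  rw [hm, unifVal_zpow_lt_iff, unifVal_zpow_le_iff]; omega

variable (K) in
theorem resCard_gt_one : 1 < resCard K := Finite.one_lt_card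

/-- The normalization of the value group that enters the definition of `absv`. -/
theorem unifVal_iso : IsNonarchimedeanLocalField.valueGroupWithZeroIsoInt K (unifVal K)
    = WithZero.exp (-1) := by
  set e := IsNonarchimedeanLocalField.valueGroupWithZeroIsoInt K
  apply le_antisymm
  · have h : e (unifVal K) < 1 := by
      rw [← map_one e]; exact e.strictMono (unifVal_lt_one K)
    have h0 : e (unifVal K) ≠ 0 := by
      rw [ne_eq, map_eq_zero]; exact unifVal_ne_zero K
    obtain ⟨n, hn⟩ : ∃ n : ℤ, e (unifVal K) = WithZero.exp n :=
      ⟨WithZero.log (e (unifVal K)), (WithZero.exp_log h0).symm⟩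
    rw [hn] at h ⊢
    rw [← WithZero.exp_zero, WithZero.exp_lt_exp] at h
    rw [WithZero.exp_le_exp]; omega
  · obtain ⟨x, hx⟩ := valuation_surjective (e.symm (WithZero.exp (-1)))
    have h1 : valuation K x < 1 := by
      rw [hx, ← map_one e.symm]
      apply e.symm.strictMono
      rw [← WithZero.exp_zero, WithZero.exp_lt_exp]; omega
    have h2 := (val_lt_one_iff x).mp h1
    rw [hx] at h2
    have h3 := (OrderIsoClass.map_le_map_iff e).mpr h2
    simpa using h3

theorem absv_eq_zpow {x : K} {n : ℤ} (h : valuation K x = unifVal K ^ n) :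
    absv x = (resCard K : ℝ) ^ (-n) := by
  have h1 : IsNonarchimedeanLocalField.valueGroupWithZeroIsoInt K (valuation K x)
      = WithZero.exp (-n) := by
    rw [h, map_zpow₀, unifVal_iso, ← WithZero.exp_zsmul]; simp
  unfold absv
  rw [h1, WithZeroMulInt.toNNReal_neg_apply _ WithZero.exp_ne_zero]
  have h2 : WithZero.unzero (WithZero.exp_ne_zero (a := -n)) = Multiplicative.ofAdd (-n) := rfl
  rw [h2]
  simp

theorem isUnram_apply {ψ : Kˣ →* ℂˣ} (hψ : IsUnram fun x => (ψ x : ℂ)) {x : Kˣ} {n : ℤ}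
    (hx : valuation K (x : K) = unifVal K ^ n) : (ψ x : ℂ) = (ψ (unif K) : ℂ) ^ n := by
  have h : valuation K ((x * (unif K) ^ (-n) : Kˣ) : K) = 1 := by
    rw [Units.val_mul, Units.val_zpow_eq_zpow_val, map_mul, hx, val_zpow_unif,
      ← zpow_add₀ (unifVal_ne_zero K)]
    simp
  have h2 : ψ (x * (unif K) ^ (-n)) = 1 := Units.ext (hψ _ h)
  rw [map_mul, map_zpow, zpow_neg, mul_inv_eq_one] at h2
  rw [h2, Units.val_zpow_eq_zpow_val]

/-- A complete set of representatives of the residue field. -/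
theorem exists_residue_reps : ∃ C : Finset K, C.card = resCard K ∧
    (∀ a ∈ C, valuation K a ≤ 1) ∧
    ∀ t : K, valuation K t ≤ 1 → ∃! a, a ∈ C ∧ valuation K (t + a) < 1 := by
  classical
  have hs := IsLocalRing.residue_surjective (R := 𝒪[K])
  let r : 𝓀[K] → 𝒪[K] := Function.surjInv hs
  have hr : ∀ u, IsLocalRing.residue 𝒪[K] (r u) = u := Function.surjInv_eq hs
  let g : 𝓀[K] → K := fun u => ((r u : 𝒪[K]) : K)
  have hinj : Function.Injective g := by
    intro u w h
    rw [← hr u, ← hr w]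
    exact congrArg _ (Subtype.ext h)
  have := Fintype.ofFinite 𝓀[K]
  refine ⟨Finset.univ.image g, ?_, ?_, ?_⟩
  · rw [Finset.card_image_of_injective _ hinj, Finset.card_univ, resCard, Nat.card_eq_fintype_card]
  · intro a ha
    obtain ⟨u, -, rfl⟩ := Finset.mem_image.mp ha
    exact (r u).2
  · intro t ht
    have key : ∀ u, valuation K (t + g u) < 1 ↔
        IsLocalRing.residue 𝒪[K] (⟨t, ht⟩ : 𝒪[K]) + u = 0 := by
      intro u
      have : t + g u = (((⟨t, ht⟩ : 𝒪[K]) + r u : 𝒪[K]) : K) := rfl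
      rw [this, ← mem_maximalIdeal_iff, ← IsLocalRing.residue_eq_zero_iff, map_add, hr]
    refine ⟨g (-IsLocalRing.residue 𝒪[K] (⟨t, ht⟩ : 𝒪[K])),
      ⟨Finset.mem_image_of_mem _ (Finset.mem_univ _), (key _).mpr (by simp)⟩, ?_⟩
    rintro a ⟨ha, hta⟩
    obtain ⟨u, -, rfl⟩ := Finset.mem_image.mp ha
    rw [key] at hta
    rw [eq_neg_of_add_eq_zero_right hta]

/-- Hensel's lemma for `X² + b X + d`: an approximate root that is not a double root modulo the
maximal ideal lifts to a root. -/
theorem exists_root_of_hensel (b d x₀ : K) (hb : valuation K b ≤ 1) (hd : valuation K d ≤ 1)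
    (hx : valuation K x₀ ≤ 1) (h : valuation K (x₀ ^ 2 + b * x₀ + d) < 1)
    (h' : valuation K (2 * x₀ + b) = 1) : ∃ x : K, valuation K (x - x₀) < 1 ∧
      x ^ 2 + b * x + d = 0 := by
  let := IsTopologicalAddGroup.rightUniformSpace K
  have := isUniformAddGroup_of_addCommGroup (G := K)
  let b' : 𝒪[K] := ⟨b, hb⟩
  let d' : 𝒪[K] := ⟨d, hd⟩
  let x' : 𝒪[K] := ⟨x₀, hx⟩
  let P : Polynomial 𝒪[K] := Polynomial.X ^ 2 + Polynomial.C b' * Polynomial.X + Polynomial.C d'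
  have hP : P.Monic := by
    have : P = Polynomial.X ^ 2 + (Polynomial.C b' * Polynomial.X + Polynomial.C d') :=
      add_assoc _ _ _
    rw [this]
    refine Polynomial.monic_X_pow_add (n := 2) ?_
    compute_degree!
  have he : ∀ y, P.eval y = y ^ 2 + b' * y + d' := by intro y; simp [P]
  have hde : (Polynomial.derivative P).eval x' = 2 * x' + b' := by
    simp only [P, Polynomial.derivative_add, Polynomial.derivative_X_pow, Polynomial.derivative_mul,
      Polynomial.derivative_C, Polynomial.derivative_X]
    simp
  obtain ⟨a, ha, hax⟩ := HenselianRing.is_henselian (I := 𝓂[K]) P hP x'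
    (by rw [he, mem_maximalIdeal_iff]; exact h)
    (by
      rw [hde]
      exact ((isUnit_integer_iff (2 * x' + b')).mpr h').map _)
  refine ⟨a, (mem_maximalIdeal_iff _).mp hax, ?_⟩
  have := (he a).symm.trans ha
  exact congrArg Subtype.val this

end Basics

/-! ### Quadratic extensions of local fields -/

section Quadratic

variable {F E : Type*} [Field F] [ValuativeRel F] [TopologicalSpace F]
  [IsNonarchimedeanLocalField F] [Field E] [ValuativeRel E] [TopologicalSpace E]
  [IsNonarchimedeanLocalField E] [Algebra F E]

theorem val_map_le_iff [ValuativeExtension F E] (a b : F) :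
    valuation E (algebraMap F E a) ≤ valuation E (algebraMap F E b)
      ↔ valuation F a ≤ valuation F b := by
  rw [← Valuation.Compatible.vle_iff_le (v := valuation E),
    ← Valuation.Compatible.vle_iff_le (v := valuation F), ValuativeExtension.vle_iff_vle]

theorem val_map_lt_iff [ValuativeExtension F E] (a b : F) :
    valuation E (algebraMap F E a) < valuation E (algebraMap F E b)
      ↔ valuation F a < valuation F b := by
  rw [← not_le, val_map_le_iff, not_le]

theorem val_map_le_one_iff [ValuativeExtension F E] (a : F) :
    valuation E (algebraMap F E a) ≤ 1 ↔ valuation F a ≤ 1 := by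
  simpa using val_map_le_iff (E := E) a 1

theorem val_map_lt_one_iff [ValuativeExtension F E] (a : F) :
    valuation E (algebraMap F E a) < 1 ↔ valuation F a < 1 := by
  simpa using val_map_lt_iff (E := E) a 1

theorem val_map_eq_one_iff [ValuativeExtension F E] (a : F) :
    valuation E (algebraMap F E a) = 1 ↔ valuation F a = 1 := by
  rw [le_antisymm_iff, le_antisymm_iff, val_map_le_one_iff, ← not_lt (a := valuation E _),
    val_map_lt_one_iff, not_lt]

theorem card_aut (hquad : Module.finrank F E = 2) (c : E ≃ₐ[F] E) (hc : c ≠ AlgEquiv.refl) :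
    Nat.card (E ≃ₐ[F] E) = 2 := by
  have : FiniteDimensional F E := Module.finite_of_finrank_pos (by omega)
  apply le_antisymm
  · rw [← hquad, Nat.card_eq_fintype_card]; exact AlgEquiv.card_le
  · rw [Nat.succ_le_iff, Finite.one_lt_card_iff_nontrivial]
    exact ⟨c, 1, hc⟩

theorem conj_conj (hquad : Module.finrank F E = 2) {c : E ≃ₐ[F] E} (hc : c ≠ AlgEquiv.refl)
    (x : E) : c (c x) = x := by
  have h : c ^ 2 = 1 := by
    rw [← card_aut hquad c hc]; exact pow_card_eq_one'
  have := congrArg (fun s : E ≃ₐ[F] E => s x) h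
  simpa [pow_two] using this

theorem exists_of_fixed (hquad : Module.finrank F E = 2) {c : E ≃ₐ[F] E} (hc : c ≠ AlgEquiv.refl)
    {x : E} (hx : c x = x) : ∃ a : F, algebraMap F E a = x := by
  have := IntermediateField.isSimpleOrder_of_finrank_prime F E (by rw [hquad]; exact Nat.prime_two)
  let L : IntermediateField F E := IntermediateField.fixedField (Subgroup.zpowers c)
  have hxL : ∀ y, y ∈ L ↔ c y = y := by
    intro y
    rw [IntermediateField.mem_fixedField_iff]
    refine ⟨fun h => h c (Subgroup.mem_zpowers c), fun h f hf => ?_⟩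
    have : Subgroup.zpowers c ≤ MulAction.stabilizer (E ≃ₐ[F] E) y := by
      rw [Subgroup.zpowers_le]; exact h
    exact this hf
  rcases eq_bot_or_eq_top L with h | h
  · have := (hxL x).mpr hx
    rw [h, IntermediateField.mem_bot] at this
    exact this
  · exact absurd (AlgEquiv.ext fun y => (hxL y).mp (by rw [h]; trivial)) hc

theorem algebraMap_norm_eq (hquad : Module.finrank F E = 2) {c : E ≃ₐ[F] E}
    (hc : c ≠ AlgEquiv.refl) (x : E) : algebraMap F E (Algebra.norm F x) = x * c x := by
  classical
  have : FiniteDimensional F E := Module.finite_of_finrank_pos (by omega)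
  have : IsGalois F E := IsGalois.of_card_aut_eq_finrank F E (by rw [card_aut hquad c hc, hquad])
  have hne : (1 : E ≃ₐ[F] E) ≠ c := fun h => hc h.symm
  have hu : (Finset.univ : Finset (E ≃ₐ[F] E)) = {1, c} := by
    symm
    apply Finset.eq_of_subset_of_card_le (Finset.subset_univ _)
    rw [Finset.card_pair hne, Finset.card_univ, ← Nat.card_eq_fintype_card, card_aut hquad c hc]
  rw [Algebra.norm_eq_prod_automorphisms, hu, Finset.prod_pair hne]
  rfl

/-- The valuation of `E` is invariant under conjugation: otherwise some `y` has norm `1` and a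
trace `T` of valuation greater than `1`, and Hensel's lemma splits `Z² - Z + T⁻²` over `F`. -/
theorem val_conj [ValuativeExtension F E] (hquad : Module.finrank F E = 2) {c : E ≃ₐ[F] E}
    (hc : c ≠ AlgEquiv.refl) (x : E) : valuation E (c x) = valuation E x := by
  have key : ∀ y : E, y ≠ 0 → c y = y⁻¹ → ¬ valuation E y < 1 := by
    intro y hy0 hy hlt
    have hcy : 1 < valuation E (c y) := by
      rw [hy, map_inv₀]
      exact (one_lt_inv₀ (zero_lt_iff.mpr (by simpa using hy0))).mpr hlt
    obtain ⟨T, hT⟩ := exists_of_fixed hquad hc (x := y + c y)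
      (by rw [map_add, conj_conj hquad hc, add_comm])
    have hvT : valuation E (algebraMap F E T) = valuation E (c y) := by
      rw [hT, add_comm]; exact Valuation.map_add_eq_of_lt_left _ (hlt.trans hcy)
    have hT1 : 1 < valuation F T := by
      rw [← not_le, ← val_map_le_one_iff (E := E), hvT, not_le]; exact hcy
    have hT0 : T ≠ 0 := by rintro rfl; simp at hT1
    have hTE : algebraMap F E T ≠ 0 := by simpa using hT0
    have hTi : valuation F (T⁻¹ ^ 2) < 1 := by
      rw [map_pow, map_inv₀]
      exact pow_lt_one₀ zero_le (inv_lt_one_of_one_lt₀ hT1) two_ne_zero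
    obtain ⟨z, -, hz⟩ := exists_root_of_hensel (K := F) (-1) (T⁻¹ ^ 2) 0 (by simp) hTi.le
      (by simp) (by simpa using hTi) (by simp)
    have hz' : (algebraMap F E z * algebraMap F E T - y) *
        (algebraMap F E z * algebraMap F E T - c y) = 0 := by
      have h1 : y * c y = 1 := by rw [hy]; field_simp
      have h2 := congrArg (algebraMap F E) hz
      simp only [map_add, map_mul, map_pow, map_neg, map_one, map_inv₀, map_zero] at h2
      field_simp at h2
      linear_combination h2 + h1 + algebraMap F E z * algebraMap F E T * hT
    have hfix : c y = y := by
      rcases mul_eq_zero.mp hz' with h | h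
      · rw [← sub_eq_zero.mp h]; simp
      · have h3 := sub_eq_zero.mp h
        have h4 := congrArg c h3
        rw [conj_conj hquad hc] at h4
        rw [← h3, ← h4]; simp
    rw [hfix] at hcy
    exact absurd hcy (not_lt.mpr hlt.le)
  by_cases hx : x = 0
  · simp [hx]
  have hcx : c x ≠ 0 := by simpa using hx
  have h1 := key (c x / x) (div_ne_zero hcx hx) (by rw [map_div₀, conj_conj hquad hc, inv_div])
  have h2 := key (x / c x) (div_ne_zero hx hcx) (by rw [map_div₀, conj_conj hquad hc, inv_div])
  have p1 : 0 < valuation E x := zero_lt_iff.mpr (by simpa using hx)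
  have p2 : 0 < valuation E (c x) := zero_lt_iff.mpr (by simpa using hx)
  rw [map_div₀, not_lt, one_le_div₀ p1] at h1
  rw [map_div₀, not_lt, one_le_div₀ p2] at h2
  exact le_antisymm h2 h1

/-- The facts about the involution `c` and the generator `δ` of the different that enter the
computation. Writing `x - xᶜ = D(x) δ`, they say that `D` maps the integers of `E` onto the
integers of `F`. -/
structure QuadFacts (c : E ≃ₐ[F] E) (δ : E) : Prop where
  conj_conj : ∀ x, c (c x) = x
  of_fixed : ∀ {x : E}, c x = x → ∃ a : F, algebraMap F E a = x
  val_conj : ∀ x, valuation E (c x) = valuation E x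
  norm_eq : ∀ x : E, algebraMap F E (Algebra.norm F x) = x * c x
  delta_ne : δ ≠ 0
  conj_delta : c δ = -δ
  exists_gen : ∃ x₀ : E, valuation E x₀ ≤ 1 ∧ x₀ - c x₀ = δ
  val_sub_le : ∀ {x : E}, valuation E x ≤ 1 → valuation E (x - c x) ≤ valuation E δ

theorem quadFacts [ValuativeExtension F E] (hquad : Module.finrank F E = 2) {c : E ≃ₐ[F] E}
    (hc : c ≠ AlgEquiv.refl) {δ : E} (hδ : IsDifferentGen c δ) : QuadFacts c δ := by
  obtain ⟨hcδ, ⟨x₁, hx₁, hx₁δ⟩, hmax⟩ := hδ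
  have hle : ∀ {x : E}, valuation E x ≤ 1 → valuation E (x - c x) ≤ valuation E δ :=
    fun {x} hx => hmax ⟨x, hx, rfl⟩
  have hne : δ ≠ 0 := by
    rintro rfl
    apply hc
    have h1 : ∀ x : E, valuation E x ≤ 1 → c x = x := by
      intro x hx
      have := hle hx
      simp only [map_zero, le_zero_iff, map_eq_zero] at this
      exact (sub_eq_zero.mp this).symm
    ext x
    rcases le_total (valuation E x) 1 with h | h
    · exact h1 x h
    · have := h1 x⁻¹ (by rw [map_inv₀]; exact inv_le_one_of_one_le₀ h)
      rw [map_inv₀] at this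
      exact inv_injective this
  refine ⟨conj_conj hquad hc, exists_of_fixed hquad hc, val_conj hquad hc,
    algebraMap_norm_eq hquad hc, hne, hcδ, ?_, hle⟩
  obtain ⟨u, hu⟩ := exists_of_fixed hquad hc (x := (x₁ - c x₁) / δ) (by
    rw [map_div₀, map_sub, conj_conj hquad hc, hcδ, div_neg, ← neg_div, neg_sub])
  have hvδ : valuation E δ ≠ 0 := by simpa using hne
  have hvu : valuation E (algebraMap F E u) = 1 := by
    rw [hu, map_div₀]
    simp only at hx₁δ
    rw [hx₁δ, div_self hvδ]
  have hu0 : algebraMap F E u ≠ 0 := by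
    intro h; rw [h] at hvu; simp at hvu
  refine ⟨x₁ / algebraMap F E u, ?_, ?_⟩
  · rw [map_div₀, hvu, div_one]; exact hx₁
  · rw [map_div₀, AlgEquiv.commutes, ← sub_div, div_eq_iff hu0, hu]
    field_simp

namespace QuadFacts

variable {c : E ≃ₐ[F] E} {δ : E} (hq : QuadFacts c δ)
include hq

theorem conj_ne_zero {x : E} (hx : x ≠ 0) : c x ≠ 0 := by simpa using hx

theorem exists_sub_eq (x : E) : ∃ a : F, x - c x = algebraMap F E a * δ := by
  obtain ⟨a, ha⟩ := hq.of_fixed (x := (x - c x) / δ) (by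
    rw [map_div₀, map_sub, hq.conj_conj, hq.conj_delta, div_neg, ← neg_div, neg_sub])
  exact ⟨a, by rw [ha, div_mul_cancel₀ _ hq.delta_ne]⟩

theorem val_delta_pos : 0 < valuation E δ := by
  rw [zero_lt_iff]; simpa using hq.delta_ne

theorem val_delta_le_one : valuation E δ ≤ 1 := by
  obtain ⟨x₀, h0, h1⟩ := hq.exists_gen
  rw [← h1]
  exact (Valuation.map_sub _ _ _).trans (max_le h0 (by rw [hq.val_conj]; exact h0))

/-- The map `D` does not increase divisibility by elements of `F`. -/
theorem val_coeff_le {x : E} {a b : F} (ha : x - c x = algebraMap F E a * δ)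
    (hx : valuation E x ≤ valuation E (algebraMap F E b)) :
    valuation E (algebraMap F E a) ≤ valuation E (algebraMap F E b) := by
  by_cases hb : b = 0
  · subst hb
    simp only [map_zero, le_zero_iff, map_eq_zero] at hx
    subst hx
    simp only [map_zero, sub_zero] at ha
    have := mul_eq_zero.mp ha.symm
    rw [this.resolve_right hq.delta_ne]; simp
  have hb' : algebraMap F E b ≠ 0 := by simpa using hb
  have hvb : 0 < valuation E (algebraMap F E b) := by rw [zero_lt_iff]; simpa using hb'
  have h1 := hq.val_sub_le (x := x / algebraMap F E b) (by
    rw [map_div₀]; exact div_le_one_of_le₀ hx zero_le)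
  rw [map_div₀, AlgEquiv.commutes, ← sub_div, ha, map_div₀, map_mul,
    div_le_iff₀ hvb, mul_comm (valuation E δ)] at h1
  exact le_of_mul_le_mul_right h1 hq.val_delta_pos

theorem val_coeff_le_one {x : E} {a : F} (ha : x - c x = algebraMap F E a * δ)
    (hx : valuation E x ≤ 1) : valuation E (algebraMap F E a) ≤ 1 := by
  simpa using hq.val_coeff_le (b := 1) ha (by simpa using hx)

/-- Subtracting an element of `F` makes `x` as divisible as `D(x)` is. -/
theorem exists_sub_le {x : E} {a b : F} (ha : x - c x = algebraMap F E a * δ)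
    (hab : valuation E (algebraMap F E a) ≤ valuation E (algebraMap F E b)) :
    ∃ s : F, valuation E (x + algebraMap F E s) ≤ valuation E (algebraMap F E b) := by
  obtain ⟨x₀, h0, h1⟩ := hq.exists_gen
  obtain ⟨s, hs⟩ := hq.of_fixed (x := algebraMap F E a * x₀ - x) (by
    simp only [map_sub, map_mul, AlgEquiv.commutes]
    linear_combination ha - algebraMap F E a * h1)
  refine ⟨s, ?_⟩
  rw [hs, add_sub_cancel, map_mul]
  exact (mul_le_of_le_one_right' h0).trans hab

/-- The integers of `E` are generated by `1` and `x₀` over those of `F`. -/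
theorem exists_decomp {x₀ : E} (h0 : valuation E x₀ ≤ 1) (h1 : x₀ - c x₀ = δ) {x : E}
    (hx : valuation E x ≤ 1) : ∃ a b : F, valuation E (algebraMap F E a) ≤ 1 ∧
      valuation E (algebraMap F E b) ≤ 1 ∧ x - c x = algebraMap F E b * δ ∧
      x = algebraMap F E a + algebraMap F E b * x₀ := by
  obtain ⟨b, hb⟩ := hq.exists_sub_eq x
  have hb1 := hq.val_coeff_le_one hb hx
  obtain ⟨a, ha⟩ := hq.of_fixed (x := x - algebraMap F E b * x₀) (by
    simp only [map_sub, map_mul, AlgEquiv.commutes]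
    linear_combination algebraMap F E b * h1 - hb)
  refine ⟨a, b, ?_, hb1, hb, by rw [ha]; ring⟩
  rw [ha]
  refine (Valuation.map_sub _ _ _).trans (max_le hx ?_)
  rw [map_mul]
  exact mul_le_one' hb1 h0

end QuadFacts

end Quadratic

/-! ### Ramification and representatives -/

section Ramification

variable {F E : Type*} [Field F] [ValuativeRel F] [TopologicalSpace F]
  [IsNonarchimedeanLocalField F] [Field E] [ValuativeRel E] [TopologicalSpace E]
  [IsNonarchimedeanLocalField E] [Algebra F E] [ValuativeExtension F E]

/-- Two systems of representatives modulo the maximal ideal have the same cardinality. -/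
theorem card_le_of_reps {K : Type*} [Field K] [ValuativeRel K] {A B : Finset K}
    (hA1 : ∀ a ∈ A, valuation K a ≤ 1)
    (hA : ∀ t : K, valuation K t ≤ 1 → ∃! a, a ∈ A ∧ valuation K (t + a) < 1)
    (hB : ∀ t : K, valuation K t ≤ 1 → ∃! a, a ∈ B ∧ valuation K (t + a) < 1) :
    A.card ≤ B.card := by
  have hB' : ∀ a ∈ A, ∃ b, b ∈ B ∧ valuation K (-a + b) < 1 := fun a ha =>
    (hB (-a) (by rw [Valuation.map_neg]; exact hA1 a ha)).exists
  choose! g hg using hB'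
  refine Finset.card_le_card_of_injOn g (fun a ha => (hg a ha).1) ?_
  intro a ha a' ha' h
  refine (hA (-a) (by rw [Valuation.map_neg]; exact hA1 a ha)).unique ⟨ha, by simp⟩ ⟨ha', ?_⟩
  have : -a + a' = (-a + g a) - (-a' + g a') := by rw [h]; ring
  rw [this]
  exact (Valuation.map_sub _ _ _).trans_lt (max_lt (hg a ha).2 (hg a' ha').2)

namespace QuadFacts

variable {c : E ≃ₐ[F] E} {δ : E} (hq : QuadFacts c δ)
include hq

/-- An element of `F` whose valuation in `E` is that of the square of a uniformizer. -/
theorem exists_normUnif : ∃ ν : F, algebraMap F E ν = unif E * c (unif E) ∧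
    valuation E (algebraMap F E ν) = unifVal E ^ 2 := by
  obtain ⟨ν, hν⟩ := hq.of_fixed (x := unif E * c (unif E)) (by
    rw [map_mul, hq.conj_conj, mul_comm])
  exact ⟨ν, hν, by rw [hν, map_mul, hq.val_conj, pow_two]; rfl⟩

theorem val_unif_base_lt : valuation E (algebraMap F E (unif F : F)) < 1 :=
  (val_map_lt_one_iff _).mpr (unifVal_lt_one F)

theorem val_le_unif_base {a : F} (ha : valuation E (algebraMap F E a) < 1) :
    valuation E (algebraMap F E a) ≤ valuation E (algebraMap F E (unif F : F)) :=
  (val_map_le_iff _ _).mpr ((val_lt_one_iff a).mp ((val_map_lt_one_iff a).mp ha))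

/-- If `δ` is a unit, the extension is unramified: writing a uniformizer of `E` as `a + b x₀`, both
`a` and `b` are divisible by the uniformizer of `F`. -/
theorem unif_base_of_unit (h : valuation E δ = 1) :
    valuation E (algebraMap F E (unif F : F)) = unifVal E := by
  apply le_antisymm ((val_lt_one_iff _).mp hq.val_unif_base_lt)
  obtain ⟨x₀, h0, h1⟩ := hq.exists_gen
  have hπ := unifVal_lt_one E
  obtain ⟨a, b, -, -, hb, hab⟩ := hq.exists_decomp h0 h1 (x := (unif E : E)) hπ.le
  have hb1 : valuation E (algebraMap F E b) < 1 := by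
    have := congrArg (valuation E) hb
    rw [map_mul, h, mul_one] at this
    rw [← this]
    refine (Valuation.map_sub _ _ _).trans_lt (max_lt hπ ?_)
    rw [hq.val_conj]; exact hπ
  have hbx : valuation E (algebraMap F E b * x₀) < 1 := by
    rw [map_mul]; exact (mul_le_of_le_one_right' h0).trans_lt hb1
  have ha1 : valuation E (algebraMap F E a) < 1 := by
    have : algebraMap F E a = unif E - algebraMap F E b * x₀ := by rw [hab]; ring
    rw [this]
    exact (Valuation.map_sub _ _ _).trans_lt (max_lt hπ hbx)
  have hv : unifVal E = valuation E (algebraMap F E a + algebraMap F E b * x₀) := by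
    rw [← hab]; rfl
  rw [hv]
  refine (Valuation.map_add _ _ _).trans (max_le (hq.val_le_unif_base ha1) ?_)
  rw [map_mul]
  exact (mul_le_of_le_one_right' h0).trans (hq.val_le_unif_base hb1)

/-- If `δ` is a unit, `1` and `x₀` are a basis of the residue extension. -/
theorem resCard_of_unit (h : valuation E δ = 1) : resCard E = resCard F ^ 2 := by
  classical
  obtain ⟨x₀, h0, h1⟩ := hq.exists_gen
  obtain ⟨A, hA, hA1, hAr⟩ := exists_residue_reps (K := E)
  obtain ⟨C, hC, hC1, hCr⟩ := exists_residue_reps (K := F)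
  -- independence of `1` and `x₀` modulo the maximal ideal
  have hind : ∀ a b : F, valuation E (algebraMap F E a + algebraMap F E b * x₀) < 1 →
      valuation F a < 1 ∧ valuation F b < 1 := by
    intro a b hab
    have hb : valuation F b < 1 := by
      rw [← val_map_lt_one_iff (E := E)]
      have : algebraMap F E b * δ = (algebraMap F E a + algebraMap F E b * x₀)
          - c (algebraMap F E a + algebraMap F E b * x₀) := by
        simp only [map_add, map_mul, AlgEquiv.commutes]
        rw [← h1]; ring
      have h2 := congrArg (valuation E) this
      rw [map_mul, h, mul_one] at h2
      rw [h2]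
      exact (Valuation.map_sub _ _ _).trans_lt (max_lt hab (by rw [hq.val_conj]; exact hab))
    refine ⟨?_, hb⟩
    rw [← val_map_lt_one_iff (E := E)]
    have : algebraMap F E a = (algebraMap F E a + algebraMap F E b * x₀)
        - algebraMap F E b * x₀ := by ring
    rw [this]
    refine (Valuation.map_sub _ _ _).trans_lt (max_lt hab ?_)
    rw [map_mul]
    exact (mul_le_of_le_one_right' h0).trans_lt ((val_map_lt_one_iff b).mpr hb)
  let g : F × F → E := fun p => algebraMap F E p.1 + algebraMap F E p.2 * x₀
  have hg1 : ∀ p : F × F, p ∈ C ×ˢ C → valuation E (g p) ≤ 1 := by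
    intro p hp
    rw [Finset.mem_product] at hp
    refine (Valuation.map_add _ _ _).trans (max_le ?_ ?_)
    · exact (val_map_le_one_iff _).mpr (hC1 _ hp.1)
    · rw [map_mul]
      exact mul_le_one' ((val_map_le_one_iff _).mpr (hC1 _ hp.2)) h0
  have hCu : ∀ a ∈ C, ∀ b ∈ C, valuation F (a - b) < 1 → a = b := by
    intro a ha b hb hab
    refine (hCr (-b) (by rw [Valuation.map_neg]; exact hC1 b hb)).unique ⟨ha, ?_⟩ ⟨hb, by simp⟩
    rwa [neg_add_eq_sub]
  have hgu : ∀ p ∈ C ×ˢ C, ∀ p' ∈ C ×ˢ C, valuation E (g p - g p') < 1 → p = p' := by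
    intro p hp p' hp' hpp
    rw [Finset.mem_product] at hp hp'
    have : g p - g p' = algebraMap F E (p.1 - p'.1) + algebraMap F E (p.2 - p'.2) * x₀ := by
      simp only [g, map_sub]; ring
    rw [this] at hpp
    obtain ⟨e1, e2⟩ := hind _ _ hpp
    exact Prod.ext (hCu _ hp.1 _ hp'.1 e1) (hCu _ hp.2 _ hp'.2 e2)
  have hgi : Set.InjOn g (C ×ˢ C : Finset (F × F)) := by
    intro p hp p' hp' hpp
    exact hgu p hp p' hp' (by rw [hpp]; simp)
  have hBr : ∀ t : E, valuation E t ≤ 1 →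
      ∃! a, a ∈ (C ×ˢ C).image g ∧ valuation E (t + a) < 1 := by
    intro t ht
    obtain ⟨a, b, ha, hb, -, hab⟩ := hq.exists_decomp h0 h1 ht
    obtain ⟨a', ⟨ha', haa⟩, -⟩ := hCr a ((val_map_le_one_iff _).mp ha)
    obtain ⟨b', ⟨hb', hbb⟩, -⟩ := hCr b ((val_map_le_one_iff _).mp hb)
    refine ⟨g (a', b'), ⟨Finset.mem_image_of_mem _ (Finset.mem_product.mpr ⟨ha', hb'⟩), ?_⟩, ?_⟩
    · have : t + g (a', b') = algebraMap F E (a + a') + algebraMap F E (b + b') * x₀ := by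
        simp only [g, map_add]; rw [hab]; ring
      rw [this]
      refine (Valuation.map_add _ _ _).trans_lt (max_lt ((val_map_lt_one_iff _).mpr haa) ?_)
      rw [map_mul]
      exact (mul_le_of_le_one_right' h0).trans_lt ((val_map_lt_one_iff _).mpr hbb)
    · rintro y ⟨hy, hty⟩
      obtain ⟨p, hp, rfl⟩ := Finset.mem_image.mp hy
      have hp' : ((a', b') : F × F) ∈ C ×ˢ C := Finset.mem_product.mpr ⟨ha', hb'⟩
      rw [hgu p hp (a', b') hp' ?_]
      have e1 : g p - g (a', b') = (t + g p) - (t + g (a', b')) := by ring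
      have e2 : t + g (a', b') = algebraMap F E (a + a') + algebraMap F E (b + b') * x₀ := by
        simp only [g, map_add]; rw [hab]; ring
      rw [e1]
      refine (Valuation.map_sub _ _ _).trans_lt (max_lt hty ?_)
      rw [e2]
      refine (Valuation.map_add _ _ _).trans_lt (max_lt ((val_map_lt_one_iff _).mpr haa) ?_)
      rw [map_mul]
      exact (mul_le_of_le_one_right' h0).trans_lt ((val_map_lt_one_iff _).mpr hbb)
  have hB1 : ∀ a ∈ (C ×ˢ C).image g, valuation E a ≤ 1 := by
    intro a ha
    obtain ⟨p, hp, rfl⟩ := Finset.mem_image.mp ha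
    exact hg1 p hp
  have hcard : ((C ×ˢ C).image g).card = resCard F ^ 2 := by
    rw [Finset.card_image_of_injOn hgi, Finset.card_product, hC, pow_two]
  rw [← hcard, ← hA]
  exact le_antisymm (card_le_of_reps hA1 hAr hBr) (card_le_of_reps hB1 hBr hAr)

/-- If `E/F` is ramified, its residue extension is trivial. -/
theorem exists_base_residue (h : valuation E δ < 1) {x : E} (hx : valuation E x ≤ 1) :
    ∃ a : F, valuation E (algebraMap F E a) ≤ 1 ∧ valuation E (x - algebraMap F E a) < 1 := by
  have hxc : valuation E (x - c x) < 1 := (hq.val_sub_le hx).trans_lt h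
  have hcx : valuation E (c x) ≤ 1 := by rw [hq.val_conj]; exact hx
  have h2le : valuation F (2 : F) ≤ 1 := (2 : 𝒪[F]).2
  rcases h2le.lt_or_eq with h2 | h2
  · -- residue characteristic two: the norm of `x` is congruent to `x ^ 2` and to a square
    obtain ⟨N, hN⟩ := hq.of_fixed (x := x * c x) (by rw [map_mul, hq.conj_conj, mul_comm])
    have hN1 : valuation F N ≤ 1 := by
      rw [← val_map_le_one_iff (E := E), hN, map_mul]; exact mul_le_one' hx hcx
    have := Fintype.ofFinite 𝓀[F]
    have hchar : ringChar 𝓀[F] = 2 := by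
      have h20 : (2 : 𝓀[F]) = 0 := by
        have : IsLocalRing.residue 𝒪[F] (2 : 𝒪[F]) = 0 := by
          rw [IsLocalRing.residue_eq_zero_iff, mem_maximalIdeal_iff]; exact h2
        rwa [map_ofNat] at this
      have hdvd : ringChar 𝓀[F] ∣ 2 := ringChar.dvd (by exact_mod_cast h20)
      exact (Nat.dvd_prime Nat.prime_two).mp hdvd |>.resolve_left (CharP.ringChar_ne_one)
    obtain ⟨s, hs⟩ := FiniteField.isSquare_of_char_two hchar
      (IsLocalRing.residue 𝒪[F] (⟨N, hN1⟩ : 𝒪[F]))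
    obtain ⟨a, rfl⟩ := IsLocalRing.residue_surjective s
    have ha : valuation F (N - (a : F) ^ 2) < 1 := by
      have : (⟨N, hN1⟩ : 𝒪[F]) - a * a ∈ 𝓂[F] := by
        rw [← IsLocalRing.residue_eq_zero_iff, map_sub, map_mul, hs, sub_self]
      have := (mem_maximalIdeal_iff _).mp this
      rw [pow_two]
      exact this
    have ha1 : valuation E (algebraMap F E (a : F)) ≤ 1 := (val_map_le_one_iff _).mpr a.2
    refine ⟨a, ha1, ?_⟩
    have e : (x - algebraMap F E (a : F)) ^ 2 = (x * (x - c x) + algebraMap F E (N - (a : F) ^ 2))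
        - algebraMap F E 2 * (algebraMap F E (a : F) * (x - algebraMap F E (a : F))) := by
      rw [map_sub, hN, map_pow, map_ofNat]; ring
    have hlt : valuation E ((x - algebraMap F E (a : F)) ^ 2) < 1 := by
      rw [e]
      refine (Valuation.map_sub _ _ _).trans_lt (max_lt
        ((Valuation.map_add _ _ _).trans_lt (max_lt ?_ ?_)) ?_)
      · rw [map_mul]; exact (mul_le_of_le_one_left' hx).trans_lt hxc
      · exact (val_map_lt_one_iff _).mpr ha
      · rw [map_mul]
        refine (mul_le_of_le_one_right' ?_).trans_lt ((val_map_lt_one_iff _).mpr h2)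
        rw [map_mul]
        exact mul_le_one' ha1 ((Valuation.map_sub _ _ _).trans (max_le hx ha1))
    rw [map_pow] at hlt
    exact (pow_lt_one_iff_of_nonneg zero_le two_ne_zero).mp hlt
  · obtain ⟨a, ha⟩ := hq.of_fixed (x := (x + c x) / algebraMap F E 2) (by
      rw [map_div₀, map_add, hq.conj_conj, AlgEquiv.commutes, add_comm])
    have h2E : valuation E (algebraMap F E 2) = 1 := (val_map_eq_one_iff _).mpr h2
    have h20 : (2 : E) ≠ 0 := by
      intro h0
      rw [map_ofNat, h0, map_zero] at h2E
      exact zero_ne_one h2E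
    have e : x - algebraMap F E a = (x - c x) / algebraMap F E 2 := by
      rw [ha, map_ofNat]; field_simp; ring
    refine ⟨a, ?_, by rw [e, map_div₀, h2E, div_one]; exact hxc⟩
    rw [ha, map_div₀, h2E, div_one]
    exact (Valuation.map_add _ _ _).trans (max_le hx hcx)

theorem unif_base_of_lt (h : valuation E δ < 1) :
    valuation E (algebraMap F E (unif F : F)) = unifVal E ^ 2 := by
  obtain ⟨ν, -, hν⟩ := hq.exists_normUnif
  have hϖ : algebraMap F E (unif F : F) ≠ 0 := by simp
  obtain ⟨n, hn⟩ := exists_val_eq_pow hϖ hq.val_unif_base_lt.le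
  have hνlt : valuation E (algebraMap F E ν) < 1 := by
    rw [hν]; exact pow_lt_one₀ zero_le (unifVal_lt_one E) two_ne_zero
  have hle := hq.val_le_unif_base hνlt
  have h1 := hq.val_unif_base_lt
  rw [hν, hn, ← zpow_natCast, ← zpow_natCast, unifVal_zpow_le_iff] at hle
  rw [hn, ← zpow_natCast, ← zpow_zero (unifVal E), unifVal_zpow_lt_iff] at h1
  have hn1 : n ≠ 1 := by
    rintro rfl
    rw [pow_one] at hn
    obtain ⟨x₀, h0, h1⟩ := hq.exists_gen
    obtain ⟨a, -, hxa⟩ := hq.exists_base_residue h h0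
    rw [val_lt_one_iff, ← hn] at hxa
    have h2 := hq.val_coeff_le (x := x₀ - algebraMap F E a) (a := 1) (by
      rw [map_sub, AlgEquiv.commutes, map_one, ← h1]; ring) hxa
    rw [map_one, map_one, hn] at h2
    exact absurd (unifVal_lt_one E) (not_lt.mpr h2)
  rw [hn]
  congr 1
  omega

theorem resCard_of_lt (h : valuation E δ < 1) : resCard E = resCard F := by
  classical
  obtain ⟨A, hA, hA1, hAr⟩ := exists_residue_reps (K := E)
  obtain ⟨C, hC, hC1, hCr⟩ := exists_residue_reps (K := F)
  have hB1 : ∀ a ∈ C.image (algebraMap F E), valuation E a ≤ 1 := by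
    intro a ha
    obtain ⟨p, hp, rfl⟩ := Finset.mem_image.mp ha
    exact (val_map_le_one_iff _).mpr (hC1 p hp)
  have hBr : ∀ t : E, valuation E t ≤ 1 →
      ∃! a, a ∈ C.image (algebraMap F E) ∧ valuation E (t + a) < 1 := by
    intro t ht
    obtain ⟨a, ha, hta⟩ := hq.exists_base_residue h ht
    have key : ∀ b : F, valuation E (t + algebraMap F E b) < 1 ↔ valuation F (a + b) < 1 := by
      intro b
      rw [← val_map_lt_one_iff (E := E) (a + b)]
      have e1 : algebraMap F E (a + b) = (t + algebraMap F E b) - (t - algebraMap F E a) := by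
        rw [map_add]; ring
      have e2 : t + algebraMap F E b = algebraMap F E (a + b) + (t - algebraMap F E a) := by
        rw [map_add]; ring
      refine ⟨fun hb => ?_, fun hb => ?_⟩
      · rw [e1]; exact (Valuation.map_sub _ _ _).trans_lt (max_lt hb hta)
      · rw [e2]; exact (Valuation.map_add _ _ _).trans_lt (max_lt hb hta)
    obtain ⟨b, ⟨hb, hab⟩, hu⟩ := hCr a ((val_map_le_one_iff _).mp ha)
    refine ⟨algebraMap F E b, ⟨Finset.mem_image_of_mem _ hb, (key b).mpr hab⟩, ?_⟩
    rintro y ⟨hy, hty⟩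
    obtain ⟨b', hb', rfl⟩ := Finset.mem_image.mp hy
    rw [hu b' ⟨hb', (key b').mp hty⟩]
  rw [← hA, ← hC, ← Finset.card_image_of_injective C (algebraMap F E).injective]
  exact le_antisymm (card_le_of_reps hA1 hAr hBr) (card_le_of_reps hB1 hBr hAr)

end QuadFacts

variable (F) in
open Classical in
/-- The index of the elements of `F` divisible by the square of a uniformizer of `E` in those
divisible by the uniformizer. -/
def halfIndex (δ : E) : ℕ := if valuation E δ = 1 then resCard F else 1

namespace QuadFacts

variable {c : E ≃ₐ[F] E} {δ : E} (hq : QuadFacts c δ)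
include hq

/-- The integers of `F` modulo those divisible by the square of a uniformizer of `E` have as many
classes as the residue field of `E`, whether `E/F` is ramified or not. -/
theorem exists_residue_reps_sq : ∃ C : Finset F, C.card = resCard E ∧
    (∀ a ∈ C, valuation E (algebraMap F E a) ≤ 1) ∧
    ∀ t : F, valuation E (algebraMap F E t) ≤ 1 →
      ∃! a, a ∈ C ∧ valuation E (algebraMap F E (t + a)) ≤ unifVal E ^ 2 := by
  classical
  obtain ⟨C, hC, hC1, hCr⟩ := exists_residue_reps (K := F)
  rcases hq.val_delta_le_one.lt_or_eq with h | h
  · refine ⟨C, by rw [hC, hq.resCard_of_lt h], fun a ha => (val_map_le_one_iff a).mpr (hC1 a ha),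
      fun t ht => ?_⟩
    simp only [← hq.unif_base_of_lt h, val_map_le_iff]
    simpa only [val_lt_one_iff, unifVal] using hCr t ((val_map_le_one_iff t).mp ht)
  · have hϖ := hq.unif_base_of_unit h
    have hϖ0 : (unif F : F) ≠ 0 := Units.ne_zero _
    have hvϖ : 0 < valuation F (unif F : F) := unifVal_pos F
    have hval : ∀ a : F, valuation E (algebraMap F E a) ≤ unifVal E ^ 2 ↔
        valuation F a ≤ valuation F (unif F : F) ^ 2 := by
      intro a
      rw [← hϖ, ← map_pow, ← map_pow, ← map_pow, val_map_le_iff]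
    simp only [hval, val_map_le_one_iff]
    have hsplit : ∀ (t a b : F), valuation F t ≤ 1 → a ∈ C → b ∈ C →
        (valuation F (t + (a + unif F * b)) ≤ valuation F (unif F : F) ^ 2 ↔
        valuation F (t + a) < 1 ∧ valuation F ((t + a) / unif F + b) < 1) := by
      intro t a b ht ha hb
      have e : t + (a + unif F * b) = unif F * ((t + a) / unif F + b) := by field_simp; ring
      have h1 : valuation F (t + (a + unif F * b)) ≤ valuation F (unif F : F) ^ 2 ↔
          valuation F ((t + a) / unif F + b) < 1 := by
        rw [e, map_mul, pow_two, mul_le_mul_iff_right₀ hvϖ]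
        exact (val_lt_one_iff _).symm
      rw [h1]
      refine ⟨fun h2 => ⟨?_, h2⟩, fun h2 => h2.2⟩
      have e' : t + a = unif F * (((t + a) / unif F + b) - b) := by field_simp; ring
      rw [e', map_mul]
      refine (mul_le_of_le_one_right' ?_).trans_lt (unifVal_lt_one F)
      exact (Valuation.map_sub _ _ _).trans (max_le h2.le (hC1 b hb))
    have hdiv : ∀ {u : F}, valuation F u < 1 → valuation F (u / unif F) ≤ 1 := by
      intro u hu
      rw [map_div₀]
      exact div_le_one_of_le₀ ((val_lt_one_iff u).mp hu) zero_le
    have huniq : ∀ t : F, valuation F t ≤ 1 → ∃ a ∈ C, ∃ b ∈ C,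
        valuation F (t + (a + unif F * b)) ≤ valuation F (unif F : F) ^ 2 ∧
        ∀ a' ∈ C, ∀ b' ∈ C,
          valuation F (t + (a' + unif F * b')) ≤ valuation F (unif F : F) ^ 2 →
            a' = a ∧ b' = b := by
      intro t ht
      obtain ⟨a, ⟨ha, hta⟩, hau⟩ := hCr t ht
      obtain ⟨b, ⟨hb, htb⟩, hbu⟩ := hCr _ (hdiv hta)
      refine ⟨a, ha, b, hb, (hsplit t a b ht ha hb).mpr ⟨hta, htb⟩, ?_⟩
      intro a' ha' b' hb' hab'
      obtain ⟨h1, h2⟩ := (hsplit t a' b' ht ha' hb').mp hab'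
      obtain rfl := hau a' ⟨ha', h1⟩
      exact ⟨rfl, hbu b' ⟨hb', h2⟩⟩
    let g : F × F → F := fun p => p.1 + unif F * p.2
    have hgle : ∀ p ∈ C ×ˢ C, valuation F (g p) ≤ 1 := by
      intro p hp
      rw [Finset.mem_product] at hp
      refine (Valuation.map_add _ _ _).trans (max_le (hC1 _ hp.1) ?_)
      rw [map_mul]
      exact mul_le_one' (unifVal_lt_one F).le (hC1 _ hp.2)
    have hgi : Set.InjOn g (C ×ˢ C : Finset (F × F)) := by
      intro p hp p' hp' hpp
      have hp1 := Finset.mem_product.mp hp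
      have hp1' := Finset.mem_product.mp hp'
      obtain ⟨a, -, b, -, -, hu⟩ := huniq (-g p) (by rw [Valuation.map_neg]; exact hgle p hp)
      obtain ⟨e1, e2⟩ := hu p.1 hp1.1 p.2 hp1.2 (by simp [g])
      obtain ⟨e3, e4⟩ := hu p'.1 hp1'.1 p'.2 hp1'.2 (by
        have : p'.1 + unif F * p'.2 = g p := hpp.symm
        rw [this]; simp)
      exact Prod.ext (e1.trans e3.symm) (e2.trans e4.symm)
    refine ⟨(C ×ˢ C).image g, ?_, ?_, ?_⟩
    · rw [Finset.card_image_of_injOn hgi, Finset.card_product, hC, hq.resCard_of_unit h, pow_two]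
    · intro a ha
      obtain ⟨p, hp, rfl⟩ := Finset.mem_image.mp ha
      exact hgle p hp
    · intro t ht
      obtain ⟨a, ha, b, hb, hab, hu⟩ := huniq t ht
      refine ⟨g (a, b), ⟨Finset.mem_image_of_mem _ (Finset.mem_product.mpr ⟨ha, hb⟩), hab⟩, ?_⟩
      rintro y ⟨hy, hty⟩
      obtain ⟨p, hp, rfl⟩ := Finset.mem_image.mp hy
      rw [Finset.mem_product] at hp
      obtain ⟨e1, e2⟩ := hu p.1 hp.1 p.2 hp.2 hty
      rw [← e1, ← e2]

theorem exists_half_reps : ∃ C : Finset F, C.card = halfIndex F δ ∧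
    (∀ a ∈ C, valuation E (algebraMap F E a) ≤ unifVal E) ∧
    ∀ t : F, valuation E (algebraMap F E t) ≤ unifVal E →
      ∃! a, a ∈ C ∧ valuation E (algebraMap F E (t + a)) ≤ unifVal E ^ 2 := by
  classical
  obtain ⟨C, hC, hC1, hCr⟩ := exists_residue_reps (K := F)
  rcases hq.val_delta_le_one.lt_or_eq with h | h
  · refine ⟨{0}, by simp [halfIndex, h.ne], by simp, fun t ht => ⟨0, ⟨by simp, ?_⟩, by simp⟩⟩
    rw [add_zero, ← hq.unif_base_of_lt h]
    exact hq.val_le_unif_base ((val_lt_one_iff _).mpr ht)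
  · have hϖ := hq.unif_base_of_unit h
    have hϖ0 : (unif F : F) ≠ 0 := Units.ne_zero _
    have hinj : Function.Injective fun a : F => (unif F : F) * a := mul_right_injective₀ hϖ0
    refine ⟨C.image fun a => unif F * a, ?_, ?_, ?_⟩
    · rw [Finset.card_image_of_injective _ hinj, hC, halfIndex, if_pos h]
    · intro a ha
      obtain ⟨b, hb, rfl⟩ := Finset.mem_image.mp ha
      rw [map_mul, map_mul, hϖ]
      exact mul_le_of_le_one_right' ((val_map_le_one_iff b).mpr (hC1 b hb))
    · intro t ht
      have key : ∀ b : F, valuation E (algebraMap F E (t + unif F * b)) ≤ unifVal E ^ 2 ↔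
          valuation F (t / unif F + b) < 1 := by
        intro b
        have e : t + unif F * b = unif F * (t / unif F + b) := by field_simp
        rw [e, map_mul, map_mul, hϖ, pow_two, mul_le_mul_iff_right₀ (unifVal_pos E),
          ← val_lt_one_iff, val_map_lt_one_iff]
      have htd : valuation F (t / unif F) ≤ 1 := by
        rw [← val_map_le_one_iff (E := E), map_div₀, map_div₀, hϖ]
        exact div_le_one_of_le₀ ht zero_le
      obtain ⟨b, ⟨hb, htb⟩, hu⟩ := hCr _ htd
      refine ⟨unif F * b, ⟨Finset.mem_image_of_mem _ hb, (key b).mpr htb⟩, ?_⟩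
      rintro y ⟨hy, hty⟩
      obtain ⟨b', hb', rfl⟩ := Finset.mem_image.mp hy
      simp only [hu b' ⟨hb', (key b').mp hty⟩]

/-- In the Heisenberg group of pairs `(x, y)` with `x - xᶜ = δ y yᶜ`, the first coordinate
controls the second. -/
theorem val_sq_le {x y : E} (hxy : x - c x = δ * (y * c y)) {b : F}
    (hx : valuation E x ≤ valuation E (algebraMap F E b)) :
    valuation E y ^ 2 ≤ valuation E (algebraMap F E b) := by
  have h := hq.val_coeff_le (x := x) (a := Algebra.norm F y)
    (by rw [hq.norm_eq, hxy, mul_comm]) hx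
  rw [hq.norm_eq, map_mul, hq.val_conj] at h
  rwa [pow_two]

theorem heis_mul {x y s a : E} (hxy : x - c x = δ * (y * c y)) (hsa : s - c s = δ * (a * c a)) :
    (x + δ * c a * y + s) - c (x + δ * c a * y + s) = δ * ((y + a) * c (y + a)) := by
  simp only [map_add, map_mul, hq.conj_conj, hq.conj_delta]
  linear_combination hxy + hsa

theorem val_heis_le {x y s a : E} {γ : ValueGroupWithZero E} (hx : valuation E x ≤ γ)
    (hs : valuation E s ≤ γ) (hm : valuation E (δ * c a * y) ≤ γ) :
    valuation E (x + δ * c a * y + s) ≤ γ :=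
  (Valuation.map_add _ _ _).trans (max_le ((Valuation.map_add _ _ _).trans (max_le hx hm)) hs)

theorem val_snd_le_one {x y : E} (hxy : x - c x = δ * (y * c y)) (hx : valuation E x ≤ 1) :
    valuation E y ≤ 1 := by
  have := hq.val_sq_le hxy (b := 1) (by simpa using hx)
  rw [map_one, map_one] at this
  exact (pow_le_one_iff_of_nonneg zero_le two_ne_zero).mp this

theorem val_snd_lt_one {x y : E} (hxy : x - c x = δ * (y * c y))
    (hx : valuation E x ≤ unifVal E ^ 2) : valuation E y < 1 := by
  obtain ⟨ν, -, hν⟩ := hq.exists_normUnif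
  have := hq.val_sq_le hxy (b := ν) (by rwa [hν])
  rw [hν] at this
  have h2 := (pow_le_pow_iff_left₀ zero_le zero_le two_ne_zero).mp this
  exact (val_lt_one_iff y).mpr h2

/-- If `y` is not a unit, `x` is congruent to an element of `F` modulo the square of a
uniformizer. -/
theorem exists_heis_center {x y : E} (hxy : x - c x = δ * (y * c y)) (hy : valuation E y < 1) :
    ∃ s : F, valuation E (x + algebraMap F E s) ≤ unifVal E ^ 2 := by
  obtain ⟨ν, -, hν⟩ := hq.exists_normUnif
  obtain ⟨s, hs⟩ := hq.exists_sub_le (x := x) (a := Algebra.norm F y) (b := ν)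
    (by rw [hq.norm_eq, hxy, mul_comm])
    (by
      rw [hq.norm_eq, map_mul, hq.val_conj, hν, ← pow_two]
      exact pow_le_pow_left₀ zero_le ((val_lt_one_iff y).mp hy) 2)
  exact ⟨s, by rwa [hν] at hs⟩

theorem val_le_iff_of_close {x : E} {s : F}
    (hs : valuation E (x + algebraMap F E s) ≤ unifVal E ^ 2)
    (t : F) : valuation E (x + algebraMap F E t) ≤ unifVal E ^ 2 ↔
      valuation E (algebraMap F E (-s + t)) ≤ unifVal E ^ 2 := by
  have e1 : x + algebraMap F E t = (x + algebraMap F E s) + algebraMap F E (-s + t) := by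
    rw [map_add, map_neg]; ring
  have e2 : algebraMap F E (-s + t) = (x + algebraMap F E t) - (x + algebraMap F E s) := by
    rw [map_add, map_neg]; ring
  refine ⟨fun h => ?_, fun h => ?_⟩
  · rw [e2]; exact (Valuation.map_sub _ _ _).trans (max_le h hs)
  · rw [e1]; exact (Valuation.map_add _ _ _).trans (max_le hs h)

theorem val_base_le_of_close {x : E} {s : F} {γ : ValueGroupWithZero E} (hγ : unifVal E ^ 2 ≤ γ)
    (hs : valuation E (x + algebraMap F E s) ≤ unifVal E ^ 2) (hx : valuation E x ≤ γ) :
    valuation E (algebraMap F E (-s)) ≤ γ := by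
  have : algebraMap F E (-s) = x - (x + algebraMap F E s) := by rw [map_neg]; ring
  rw [this]
  exact (Valuation.map_sub _ _ _).trans (max_le hx (hs.trans hγ))

/-- Representatives of the integral points of the Heisenberg group modulo those with first
coordinate divisible by the square of a uniformizer: `y` runs over the residue field and `x` over a
coset of a system of representatives in `F`. -/
theorem exists_heis_reps : ∃ T : Finset (E × E), T.card = resCard E ^ 2 ∧
    (∀ t ∈ T, valuation E t.1 ≤ 1 ∧ valuation E t.2 ≤ 1 ∧ t.1 - c t.1 = δ * (t.2 * c t.2)) ∧
    ∀ x y : E, valuation E x ≤ 1 → x - c x = δ * (y * c y) →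
      ∃! t, t ∈ T ∧ valuation E (x + δ * c t.2 * y + t.1) ≤ unifVal E ^ 2 := by
  classical
  obtain ⟨x₀, h0, h1⟩ := hq.exists_gen
  obtain ⟨A, hA, hA1, hAr⟩ := exists_residue_reps (K := E)
  obtain ⟨C, hC, hC1, hCr⟩ := hq.exists_residue_reps_sq
  have hδ1 := hq.val_delta_le_one
  have hp2 : unifVal E ^ 2 ≤ 1 := pow_le_one₀ zero_le (unifVal_lt_one E).le
  let g : E × F → E × E := fun p => (p.1 * c p.1 * x₀ + algebraMap F E p.2, p.1)
  have hgi : Function.Injective g := by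
    intro p p' h
    simp only [g, Prod.mk.injEq] at h
    obtain ⟨h2, h3⟩ := h
    rw [h3, add_right_inj] at h2
    exact Prod.ext h3 ((algebraMap F E).injective h2)
  have hgD : ∀ p : E × F, (g p).1 - c (g p).1 = δ * ((g p).2 * c (g p).2) := by
    intro p
    simp only [g, map_add, map_mul, hq.conj_conj, AlgEquiv.commutes]
    linear_combination (p.1 * c p.1) * h1
  have hg1 : ∀ p : E × F, p ∈ A ×ˢ C → valuation E (g p).1 ≤ 1 ∧ valuation E (g p).2 ≤ 1 := by
    intro p hp
    rw [Finset.mem_product] at hp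
    have hp1 := hA1 _ hp.1
    refine ⟨(Valuation.map_add _ _ _).trans (max_le ?_ (hC1 _ hp.2)), hp1⟩
    rw [map_mul, map_mul, hq.val_conj]
    exact mul_le_one' (mul_le_one' hp1 hp1) h0
  refine ⟨(A ×ˢ C).image g, ?_, ?_, ?_⟩
  · rw [Finset.card_image_of_injective _ hgi, Finset.card_product, hA, hC, pow_two]
  · intro t ht
    obtain ⟨p, hp, rfl⟩ := Finset.mem_image.mp ht
    exact ⟨(hg1 p hp).1, (hg1 p hp).2, hgD p⟩
  · intro x y hx hxy
    have hy := hq.val_snd_le_one hxy hx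
    obtain ⟨a, ⟨ha, hya⟩, hau⟩ := hAr y hy
    let x₁ := x + δ * c a * y + a * c a * x₀
    have ha1 := hA1 a ha
    have hx₁ : valuation E x₁ ≤ 1 := by
      apply hq.val_heis_le hx
      · rw [map_mul, map_mul, hq.val_conj]
        exact mul_le_one' (mul_le_one' ha1 ha1) h0
      · rw [map_mul, map_mul, hq.val_conj]
        exact mul_le_one' (mul_le_one' hδ1 ha1) hy
    have hx₁D : x₁ - c x₁ = δ * ((y + a) * c (y + a)) :=
      hq.heis_mul hxy (by simpa [g] using hgD (a, 0))
    obtain ⟨s, hs⟩ := hq.exists_heis_center hx₁D hya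
    obtain ⟨b, ⟨hb, hsb⟩, hbu⟩ := hCr (-s) (hq.val_base_le_of_close hp2 hs hx₁)
    have e : ∀ b : F, x + δ * c (g (a, b)).2 * y + (g (a, b)).1 = x₁ + algebraMap F E b := by
      intro b; simp only [g, x₁]; ring
    refine ⟨g (a, b), ⟨Finset.mem_image_of_mem _ (Finset.mem_product.mpr ⟨ha, hb⟩), ?_⟩, ?_⟩
    · rw [e]
      exact (hq.val_le_iff_of_close hs b).mpr hsb
    · rintro t ⟨ht, hxt⟩
      obtain ⟨⟨a', b'⟩, hp, rfl⟩ := Finset.mem_image.mp ht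
      have hp' := Finset.mem_product.mp hp
      have h2 := hq.val_snd_lt_one (hq.heis_mul hxy (hgD (a', b'))) hxt
      obtain rfl := hau a' ⟨hp'.1, h2⟩
      rw [e] at hxt
      rw [hbu b' ⟨hp'.2, (hq.val_le_iff_of_close hs b').mp hxt⟩]

/-- Representatives of the points of the Heisenberg group with non-unit first coordinate. Their
number is `q_F` in both cases, for different reasons: in the ramified case they are parametrized by
`y` modulo the maximal ideal, in the unramified case by `x` alone. -/
theorem exists_heis_half_reps : ∃ T : Finset (E × E), T.card = resCard F ∧
    (∀ t ∈ T, valuation E t.1 ≤ unifVal E ∧ valuation E t.2 ≤ 1 ∧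
      t.1 - c t.1 = δ * (t.2 * c t.2) ∧
      ∀ y, valuation E y ≤ 1 → valuation E (δ * c t.2 * y) ≤ unifVal E) ∧
    ∀ x y : E, valuation E x ≤ unifVal E → x - c x = δ * (y * c y) →
      ∃! t, t ∈ T ∧ valuation E (x + δ * c t.2 * y + t.1) ≤ unifVal E ^ 2 := by
  classical
  have hp1 := unifVal_lt_one E
  have hp2 : unifVal E ^ 2 ≤ unifVal E := by
    rw [pow_two]; exact mul_le_of_le_one_right' hp1.le
  rcases hq.val_delta_le_one.lt_or_eq with h | h
  · -- ramified: every residue class of `y` lifts to a pair with `x` in the maximal ideal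
    obtain ⟨x₀, h0, h1⟩ := hq.exists_gen
    obtain ⟨A, hA, hA1, hAr⟩ := exists_residue_reps (K := E)
    obtain ⟨b, hb, hx₀b⟩ := hq.exists_base_residue h h0
    rw [val_lt_one_iff] at hx₀b
    have hδ := (val_lt_one_iff δ).mp h
    let g : E → E × E := fun a => (a * c a * (x₀ - algebraMap F E b), a)
    have hgD : ∀ a, (g a).1 - c (g a).1 = δ * ((g a).2 * c (g a).2) := by
      intro a
      simp only [g, map_sub, map_mul, hq.conj_conj, AlgEquiv.commutes]
      linear_combination (a * c a) * h1
    have hg1 : ∀ a ∈ A, valuation E (g a).1 ≤ unifVal E := by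
      intro a ha
      simp only [g]
      rw [map_mul, map_mul, hq.val_conj]
      exact (mul_le_of_le_one_left' (mul_le_one' (hA1 a ha) (hA1 a ha))).trans hx₀b
    refine ⟨A.image g, ?_, ?_, ?_⟩
    · rw [Finset.card_image_of_injective _ (fun a b h => (Prod.ext_iff.mp h).2), hA,
        hq.resCard_of_lt h]
    · intro t ht
      obtain ⟨a, ha, rfl⟩ := Finset.mem_image.mp ht
      refine ⟨hg1 a ha, hA1 a ha, hgD a, fun y hy => ?_⟩
      rw [map_mul, map_mul, hq.val_conj]
      exact (mul_le_of_le_one_right' hy).trans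
        ((mul_le_of_le_one_right' (hA1 a ha)).trans hδ)
    · intro x y hx hxy
      have hy := hq.val_snd_le_one hxy (hx.trans hp1.le)
      obtain ⟨a, ⟨ha, hya⟩, hau⟩ := hAr y hy
      refine ⟨g a, ⟨Finset.mem_image_of_mem _ ha, ?_⟩, ?_⟩
      · have hx₁ : valuation E (x + δ * c (g a).2 * y + (g a).1) ≤ unifVal E := by
          apply hq.val_heis_le hx (hg1 a ha)
          rw [map_mul, map_mul, hq.val_conj]
          exact (mul_le_of_le_one_right' hy).trans
            ((mul_le_of_le_one_right' (hA1 a ha)).trans hδ)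
        obtain ⟨s, hs⟩ := hq.exists_heis_center (hq.heis_mul hxy (hgD a)) hya
        have hs1 := hq.val_base_le_of_close hp2 hs hx₁
        have hs2 : valuation E (algebraMap F E (-s)) ≤ unifVal E ^ 2 := by
          rw [← hq.unif_base_of_lt h]
          exact hq.val_le_unif_base (hs1.trans_lt hp1)
        have := (hq.val_le_iff_of_close hs 0).mpr (by simpa using hs2)
        simpa using this
      · rintro t ⟨ht, hxt⟩
        obtain ⟨a', ha', rfl⟩ := Finset.mem_image.mp ht
        have h2 := hq.val_snd_lt_one (hq.heis_mul hxy (hgD a')) hxt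
        rw [hau a' ⟨ha', h2⟩]
  · -- unramified: `y` is not a unit as soon as `x` is not
    obtain ⟨C, hC, hC1, hCr⟩ := hq.exists_half_reps
    refine ⟨C.image fun a => (algebraMap F E a, 0), ?_, ?_, ?_⟩
    · rw [Finset.card_image_of_injective, hC, halfIndex, if_pos h]
      intro a b hab
      exact (algebraMap F E).injective (Prod.ext_iff.mp hab).1
    · intro t ht
      obtain ⟨a, ha, rfl⟩ := Finset.mem_image.mp ht
      exact ⟨hC1 a ha, by simp, by simp, by simp⟩
    · intro x y hx hxy
      have hy : valuation E y < 1 := by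
        have h2 := hq.val_sq_le hxy (b := (unif F : F)) (by rwa [hq.unif_base_of_unit h])
        rw [hq.unif_base_of_unit h] at h2
        exact (pow_lt_one_iff_of_nonneg zero_le two_ne_zero).mp (h2.trans_lt hp1)
      obtain ⟨s, hs⟩ := hq.exists_heis_center hxy hy
      obtain ⟨b, ⟨hb, hsb⟩, hbu⟩ := hCr (-s) (hq.val_base_le_of_close hp2 hs hx)
      refine ⟨(algebraMap F E b, 0), ⟨Finset.mem_image_of_mem _ hb, ?_⟩, ?_⟩
      · simpa using (hq.val_le_iff_of_close hs b).mpr hsb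
      · rintro t ⟨ht, hxt⟩
        obtain ⟨b', hb', rfl⟩ := Finset.mem_image.mp ht
        simp only [map_zero, mul_zero, zero_mul, add_zero] at hxt
        rw [hbu b' ⟨hb', (hq.val_le_iff_of_close hs b').mp hxt⟩]

end QuadFacts

end Ramification

/-! ### Norms and the quadratic character -/

section Norms

variable {F E : Type*} [Field F] [ValuativeRel F] [TopologicalSpace F]
  [IsNonarchimedeanLocalField F] [Field E] [ValuativeRel E] [TopologicalSpace E]
  [IsNonarchimedeanLocalField E] [Algebra F E] [ValuativeExtension F E]

theorem residue_eq_iff {K : Type*} [Field K] [ValuativeRel K]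
    [TopologicalSpace K] [IsNonarchimedeanLocalField K] (a b : 𝒪[K]) :
    IsLocalRing.residue 𝒪[K] a = IsLocalRing.residue 𝒪[K] b ↔ valuation K ((a : K) - b) < 1 := by
  rw [← sub_eq_zero, ← map_sub, IsLocalRing.residue_eq_zero_iff, mem_maximalIdeal_iff]; rfl

theorem val_two_le {K : Type*} [Field K] [ValuativeRel K]
    [TopologicalSpace K] [IsNonarchimedeanLocalField K] : valuation K (2 : K) ≤ 1 :=
  (2 : 𝒪[K]).2

theorem residue_two_eq_zero_iff {K : Type*} [Field K] [ValuativeRel K]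
    [TopologicalSpace K] [IsNonarchimedeanLocalField K] :
    (2 : 𝓀[K]) = 0 ↔ valuation K (2 : K) < 1 := by
  rw [← map_ofNat (IsLocalRing.residue 𝒪[K]) 2, IsLocalRing.residue_eq_zero_iff,
    mem_maximalIdeal_iff]; rfl

theorem ringChar_residue_eq_two_iff {K : Type*} [Field K] [ValuativeRel K]
    [TopologicalSpace K] [IsNonarchimedeanLocalField K] :
    ringChar 𝓀[K] = 2 ↔ valuation K (2 : K) < 1 := by
  rw [← residue_two_eq_zero_iff]
  constructor
  · intro h
    have : ((ringChar 𝓀[K] : ℕ) : 𝓀[K]) = 0 := ringChar.Nat.cast_ringChar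
    rw [h] at this
    exact_mod_cast this
  · intro h
    have hdvd : ringChar 𝓀[K] ∣ 2 := ringChar.dvd (by exact_mod_cast h)
    exact (Nat.dvd_prime Nat.prime_two).mp hdvd |>.resolve_left (CharP.ringChar_ne_one)

/-- In residue characteristic two, every integer is a square modulo the maximal ideal. -/
theorem exists_sq_close {u : F} (h2 : valuation F (2 : F) < 1) (hu : valuation F u ≤ 1) :
    ∃ a : F, valuation F a ≤ 1 ∧ valuation F (a ^ 2 - u) < 1 := by
  have := Fintype.ofFinite 𝓀[F]
  obtain ⟨s, hs⟩ := FiniteField.isSquare_of_char_two (ringChar_residue_eq_two_iff.mpr h2)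
    (IsLocalRing.residue 𝒪[F] (⟨u, hu⟩ : 𝒪[F]))
  obtain ⟨a, rfl⟩ := IsLocalRing.residue_surjective s
  refine ⟨a, a.2, ?_⟩
  rw [← map_mul, eq_comm, residue_eq_iff] at hs
  rw [pow_two]; exact hs

namespace QuadFacts

variable {c : E ≃ₐ[F] E} {δ : E} (hq : QuadFacts c δ)
include hq

theorem norm_eq_iff (y : E) (x : F) : Algebra.norm F y = x ↔ y * c y = algebraMap F E x := by
  rw [← hq.norm_eq]; exact (algebraMap F E).injective.eq_iff.symm

/-- In the unramified case every unit is a norm modulo the maximal ideal. -/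
theorem exists_norm_close (h : valuation E δ = 1) {u : F} (hu : valuation F u = 1) :
    ∃ (x : E) (N : F), valuation E x ≤ 1 ∧ x * c x = algebraMap F E N ∧
      valuation F (N - u) < 1 := by
  rcases (val_two_le (K := F)).lt_or_eq with h2 | h2
  · obtain ⟨a, ha, hau⟩ := exists_sq_close h2 hu.le
    refine ⟨algebraMap F E a, a ^ 2, (val_map_le_one_iff a).mpr ha, ?_, hau⟩
    rw [AlgEquiv.commutes, map_pow, pow_two]
  · -- the binary form `a ^ 2 - d b ^ 2` represents every element of the residue field
    have := Fintype.ofFinite 𝓀[F]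
    obtain ⟨d, hd⟩ := hq.of_fixed (x := δ ^ 2) (by rw [map_pow, hq.conj_delta, neg_sq])
    have hvd : valuation F d = 1 := by
      rw [← val_map_eq_one_iff (E := E), hd, map_pow, h, one_pow]
    let d' : 𝓀[F] := IsLocalRing.residue 𝒪[F] (⟨d, hvd.le⟩ : 𝒪[F])
    let u' : 𝓀[F] := IsLocalRing.residue 𝒪[F] (⟨u, hu.le⟩ : 𝒪[F])
    have hd' : d' ≠ 0 := by
      intro h0
      rw [IsLocalRing.residue_eq_zero_iff, mem_maximalIdeal_iff] at h0
      exact h0.ne hvd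
    have hodd : Fintype.card 𝓀[F] % 2 = 1 := FiniteField.odd_card_of_char_ne_two (by
      rw [ne_eq, ringChar_residue_eq_two_iff, h2]; simp)
    obtain ⟨a, b, hab⟩ := FiniteField.exists_root_sum_quadratic (R := 𝓀[F])
      (f := Polynomial.X ^ 2 - Polynomial.C u') (g := Polynomial.C (-d') * Polynomial.X ^ 2)
      (Polynomial.degree_X_pow_sub_C two_pos _)
      (Polynomial.degree_C_mul_X_pow 2 (neg_ne_zero.mpr hd')) hodd
    obtain ⟨a, rfl⟩ := IsLocalRing.residue_surjective a
    obtain ⟨b, rfl⟩ := IsLocalRing.residue_surjective b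
    simp only [Polynomial.eval_sub, Polynomial.eval_pow, Polynomial.eval_X, Polynomial.eval_C,
      Polynomial.eval_mul] at hab
    have hab' : IsLocalRing.residue 𝒪[F] (a ^ 2 - (⟨d, hvd.le⟩ : 𝒪[F]) * b ^ 2)
        = IsLocalRing.residue 𝒪[F] (⟨u, hu.le⟩ : 𝒪[F]) := by
      rw [map_sub, map_mul, map_pow, map_pow]
      linear_combination hab
    rw [residue_eq_iff] at hab'
    refine ⟨algebraMap F E a + algebraMap F E b * δ, (a : F) ^ 2 - d * (b : F) ^ 2, ?_, ?_, hab'⟩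
    · refine (Valuation.map_add _ _ _).trans (max_le ((val_map_le_one_iff _).mpr a.2) ?_)
      rw [map_mul, h, mul_one]
      exact (val_map_le_one_iff _).mpr b.2
    · simp only [map_add, map_mul, AlgEquiv.commutes, hq.conj_delta, map_sub, map_pow, hd]
      ring

/-- In the unramified case every unit is a norm: Hensel's lemma applied to `N(x + X y) = u`, where
`x yᶜ` has trace `1`. -/
theorem exists_norm_of_unit (h : valuation E δ = 1) {u : F} (hu : valuation F u = 1) :
    ∃ y : E, Algebra.norm F y = u := by
  obtain ⟨x, N, hx, hN, hNu⟩ := hq.exists_norm_close h hu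
  obtain ⟨x₀, h0, h1⟩ := hq.exists_gen
  have hδ := hq.delta_ne
  have hvN : valuation F N = 1 := by
    have : N = u + (N - u) := by ring
    rw [this, ← hu]
    exact Valuation.map_add_eq_of_lt_left _ (by rw [hu]; exact hNu)
  have hvx : valuation E x = 1 := by
    have h3 := congrArg (valuation E) hN
    rw [map_mul, hq.val_conj, (val_map_eq_one_iff N).mpr hvN, ← pow_two] at h3
    exact (pow_eq_one_iff_of_nonneg zero_le two_ne_zero).mp h3
  have hx0 : x ≠ 0 := by rintro rfl; simp at hvx
  have hcx0 := hq.conj_ne_zero hx0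
  let z := x₀ / δ
  have hz : z + c z = 1 := by
    simp only [z, map_div₀, hq.conj_delta]
    rw [div_neg, ← sub_eq_add_neg, ← sub_div, h1, div_self hδ]
  have hvz1 : valuation E z ≤ 1 := by
    simp only [z, map_div₀, h, div_one]; exact h0
  have hvz : valuation E z = 1 := by
    apply le_antisymm hvz1
    by_contra hlt
    rw [not_le] at hlt
    have h3 : valuation E (z + c z) < 1 :=
      (Valuation.map_add _ _ _).trans_lt (max_lt hlt (by rw [hq.val_conj]; exact hlt))
    rw [hz] at h3
    simp at h3
  let y := c (z / x)
  have hcy : c y = z / x := hq.conj_conj _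
  have hvy : valuation E y = 1 := by
    simp only [y, hq.val_conj, map_div₀, hvz, hvx, div_one]
  obtain ⟨M, hM⟩ := hq.of_fixed (x := y * c y) (by rw [map_mul, hq.conj_conj, mul_comm])
  have hvM : valuation F M = 1 := by
    rw [← val_map_eq_one_iff (E := E), hM, map_mul, hvy, one_mul, hcy, map_div₀, hvz,
      hvx, div_one]
  have hM0 : M ≠ 0 := by rintro rfl; simp at hvM
  obtain ⟨X, -, hX⟩ := exists_root_of_hensel (K := F) M⁻¹ ((N - u) * M⁻¹) 0
    (by rw [map_inv₀, hvM, inv_one])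
    (by rw [map_mul, map_inv₀, hvM, inv_one, mul_one]; exact hNu.le)
    (by simp) (by simpa [hvM] using hNu) (by simp [hvM])
  have hX' : N + X + X ^ 2 * M = u := by
    field_simp at hX
    linear_combination hX
  refine ⟨x + algebraMap F E X * y, (hq.norm_eq_iff _ _).mpr ?_⟩
  rw [← hX']
  simp only [map_add, map_mul, map_pow, AlgEquiv.commutes, ← hN, hM]
  have e1 : x * c y = z := by rw [hcy]; field_simp
  have e2 : c x * y = c z := by simp only [y, map_div₀]; field_simp
  linear_combination algebraMap F E X * (e1 + e2 + hz)

theorem isUnram_quadChar (h : valuation E δ = 1) : IsUnram (quadChar F E) := by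
  intro u hu
  rw [quadChar, if_pos (hq.exists_norm_of_unit h hu)]

theorem quadChar_unif (h : valuation E δ = 1) : quadChar F E (unif F) = -1 := by
  rw [quadChar, if_neg]
  rintro ⟨y, hy⟩
  rw [hq.norm_eq_iff] at hy
  have h1 := congrArg (valuation E) hy
  have hy0 : y ≠ 0 := by
    rintro rfl
    rw [zero_mul] at hy
    have h3 := Units.ne_zero (unif F)
    exact h3 ((map_eq_zero _).mp hy.symm)
  obtain ⟨n, hn⟩ := exists_val_eq_zpow hy0
  rw [map_mul, hq.val_conj, hq.unif_base_of_unit h, hn, ← zpow_add₀ (unifVal_ne_zero E),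
    ← zpow_one (unifVal E), ← zpow_mul, one_mul, unifVal_zpow_inj] at h1
  omega

/-- Traces are values of `D`. -/
theorem val_trace_le {z : E} {T b : F} (hT : algebraMap F E T = z + c z)
    (hz : valuation E (z * δ) ≤ valuation E (algebraMap F E b)) :
    valuation E (algebraMap F E T) ≤ valuation E (algebraMap F E b) := by
  refine hq.val_coeff_le (x := z * δ) ?_ hz
  rw [hT, map_mul, hq.conj_delta]; ring

/-- In the ramified case `D` maps uniformizers to units. -/
theorem val_coeff_unif (h : valuation E δ < 1) {y : E} (hy : valuation E y = unifVal E) {a : F}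
    (ha : y - c y = algebraMap F E a * δ) : ¬ valuation E (algebraMap F E a) < 1 := by
  intro hlt
  obtain ⟨ν, -, hν⟩ := hq.exists_normUnif
  obtain ⟨x₀, h0, h1⟩ := hq.exists_gen
  have hy0 : y ≠ 0 := by
    rintro rfl
    exact unifVal_ne_zero E (by rw [← hy, map_zero])
  obtain ⟨b, -, hb⟩ := hq.exists_base_residue h h0
  obtain ⟨b', hb'1, hb'⟩ := hq.exists_base_residue h (x := (x₀ - algebraMap F E b) / y) (by
    rw [map_div₀, hy]
    exact div_le_one_of_le₀ ((val_lt_one_iff _).mp hb) zero_le)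
  let w := x₀ - algebraMap F E b - algebraMap F E b' * y
  have hw : valuation E w ≤ valuation E (algebraMap F E ν) := by
    have e : w = ((x₀ - algebraMap F E b) / y - algebraMap F E b') * y := by
      simp only [w]; field_simp
    rw [e, map_mul, hy, hν, pow_two]
    exact mul_le_mul' ((val_lt_one_iff _).mp hb') le_rfl
  obtain ⟨e, he⟩ := hq.exists_sub_eq w
  have he1 := hq.val_coeff_le he hw
  have hone : (1 : E) = algebraMap F E e + algebraMap F E b' * algebraMap F E a := by
    apply mul_right_cancel₀ hq.delta_ne
    rw [one_mul, add_mul, ← he, mul_assoc, ← ha, ← h1]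
    simp only [w, map_sub, map_mul, AlgEquiv.commutes]
    ring
  have : valuation E (1 : E) < 1 := by
    rw [hone]
    refine (Valuation.map_add _ _ _).trans_lt (max_lt (he1.trans_lt ?_) ?_)
    · rw [hν]; exact pow_lt_one₀ zero_le (unifVal_lt_one E) two_ne_zero
    · rw [map_mul]; exact (mul_le_of_le_one_left' hb'1).trans_lt hlt
  simp at this

/-- If `2` is a unit, norms of units are congruent to squares. -/
theorem exists_not_norm_odd (h : valuation E δ < 1) (h2 : valuation F (2 : F) = 1) :
    ∃ u : F, valuation F u = 1 ∧ ∀ y : E, Algebra.norm F y ≠ u := by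
  have := Fintype.ofFinite 𝓀[F]
  obtain ⟨s, hs⟩ := FiniteField.exists_nonsquare (F := 𝓀[F]) (by
    rw [ne_eq, ringChar_residue_eq_two_iff, h2]; simp)
  obtain ⟨u, rfl⟩ := IsLocalRing.residue_surjective s
  have hu : valuation F (u : F) = 1 := by
    rw [← isUnit_integer_iff]
    by_contra hn
    apply hs
    rw [(IsLocalRing.residue_eq_zero_iff u).mpr ((IsLocalRing.mem_maximalIdeal u).mpr hn)]
    exact IsSquare.zero
  refine ⟨u, hu, fun y hy => hs ?_⟩
  rw [hq.norm_eq_iff] at hy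
  have hvy : valuation E y ^ 2 = 1 := by
    have h1 := congrArg (valuation E) hy
    rwa [map_mul, hq.val_conj, ← pow_two, (val_map_eq_one_iff _).mpr hu] at h1
  have hvy1 : valuation E y = 1 := (pow_eq_one_iff_of_nonneg zero_le two_ne_zero).mp hvy
  obtain ⟨a, ha, hya⟩ := hq.exists_base_residue h hvy1.le
  have ha' := (val_map_le_one_iff a).mp ha
  refine ⟨IsLocalRing.residue 𝒪[F] (⟨a, ha'⟩ : 𝒪[F]), ?_⟩
  rw [← map_mul, residue_eq_iff, ← val_map_lt_one_iff (E := E)]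
  change valuation E (algebraMap F E ((u : F) - a * a)) < 1
  have hya' : valuation E (c y - algebraMap F E a) < 1 := by
    rw [← AlgEquiv.commutes c a, ← map_sub, hq.val_conj]; exact hya
  have e : algebraMap F E ((u : F) - a * a) =
      (y - algebraMap F E a) * c y + algebraMap F E a * (c y - algebraMap F E a) := by
    rw [map_sub, ← hy, map_mul]; ring
  rw [e]
  refine (Valuation.map_add _ _ _).trans_lt (max_lt ?_ ?_)
  · rw [map_mul, hq.val_conj, hvy1, mul_one]; exact hya
  · rw [map_mul]; exact (mul_le_of_le_one_left' ha).trans_lt hya'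

/-- The norm of a perturbation of `1 + w a`. -/
theorem norm_perturb (w z : E) (a : E) : (1 + (w * a + z)) * c (1 + (w * a + z)) =
    (1 + w * a) * c (1 + w * a) + (z * c (1 + w * a) + c (z * c (1 + w * a))) + z * c z := by
  simp only [map_add, map_mul, map_one, hq.conj_conj]; ring

/-- In residue characteristic two, let `v(δ) = t + 1` and let `ν` be the norm of a uniformizer.
If `1 + c₀ ν ^ t` is a norm, the norm is that of some `1 + ϖ ^ t a + ⋯`, so that `c₀` is in the
image of an additive map of the residue field with a nontrivial kernel. -/
theorem exists_not_norm_even (h : valuation E δ < 1) (h2 : valuation F (2 : F) < 1) :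
    ∃ u : F, valuation F u = 1 ∧ ∀ y : E, Algebra.norm F y ≠ u := by
  obtain ⟨ν, hνE, hν⟩ := hq.exists_normUnif
  have hp0 := unifVal_pos E
  have hp1 := unifVal_lt_one E
  have hpow : ∀ {m n : ℕ}, n ≤ m → unifVal E ^ m ≤ unifVal E ^ n :=
    fun hmn => pow_le_pow_of_le_one zero_le hp1.le hmn
  have hpow' : ∀ {m n : ℕ}, unifVal E ^ m ≤ unifVal E ^ n → n ≤ m := by
    intro m n hmn
    rw [← zpow_natCast, ← zpow_natCast, unifVal_zpow_le_iff] at hmn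
    exact_mod_cast hmn
  have hνp : ∀ n : ℕ, valuation E (algebraMap F E (ν ^ n)) = unifVal E ^ (2 * n) := by
    intro n; rw [map_pow, map_pow, hν, ← pow_mul]
  have hν0 : ν ≠ 0 := by
    rintro rfl
    rw [map_zero, map_zero] at hν
    exact (pow_ne_zero 2 (unifVal_ne_zero E)) hν.symm
  obtain ⟨d, hd⟩ := exists_val_eq_pow hq.delta_ne h.le
  have hd0 : d ≠ 0 := by rintro rfl; rw [hd, pow_zero] at h; exact lt_irrefl _ h
  have hd1 : d ≠ 1 := by
    rintro rfl
    rw [pow_one] at hd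
    refine hq.val_coeff_unif h hd (a := 2) ?_ ((val_map_lt_one_iff _).mpr h2)
    rw [hq.conj_delta, map_ofNat]; ring
  obtain ⟨t, rfl⟩ : ∃ t, d = t + 1 := ⟨d - 1, by omega⟩
  have ht : 1 ≤ t := by omega
  let w : E := (unif E : E) ^ t
  have hvw : valuation E w = unifVal E ^ t := map_pow _ _ _
  have hw0 : w ≠ 0 := pow_ne_zero _ (Units.ne_zero _)
  have hNw : w * c w = algebraMap F E (ν ^ t) := by
    simp only [w, map_pow, hνE]; rw [mul_pow]
  -- the trace of `ϖ ^ t` is `τ ν ^ t` with a unit `τ`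
  obtain ⟨T, hT⟩ := hq.of_fixed (x := w + c w) (by rw [map_add, hq.conj_conj, add_comm])
  let τ : F := T / ν ^ t
  have hTτ : T = τ * ν ^ t := by simp only [τ]; field_simp
  have hτ : ¬ valuation E (algebraMap F E τ) < 1 := by
    refine hq.val_coeff_unif h (y := δ * w / algebraMap F E (ν ^ t)) ?_ ?_
    · rw [map_div₀, map_mul, hd, hvw, hνp, ← pow_add,
        div_eq_iff (pow_ne_zero _ (unifVal_ne_zero E)), ← pow_succ']
      congr 1; omega
    · have hνt : algebraMap F E (ν ^ t) ≠ 0 := by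
        rw [ne_eq, map_eq_zero]; exact pow_ne_zero _ hν0
      simp only [τ, map_div₀, map_mul, AlgEquiv.commutes, hT, hq.conj_delta]
      field_simp
      ring
  have hτ1 : valuation E (algebraMap F E τ) ≤ 1 := by
    have h1 := hq.val_trace_le hT (b := ν ^ t) (by
      rw [map_mul, hvw, hd, hνp, ← pow_add]; exact hpow (by omega))
    simp only [τ, map_div₀]
    exact div_le_one_of_le₀ h1 zero_le
  have hunit : ∀ c₀ : F, valuation F c₀ ≤ 1 → valuation F (1 + c₀ * ν ^ t) = 1 := by
    intro c₀ hc₀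
    rw [← map_one (valuation F)]
    apply Valuation.map_add_eq_of_lt_left
    rw [map_one, ← val_map_lt_one_iff (E := E), map_mul, map_mul, hνp]
    refine (mul_le_of_le_one_left' ((val_map_le_one_iff _).mpr hc₀)).trans_lt ?_
    exact pow_lt_one₀ zero_le hp1 (by omega)
  by_contra! hall
  have hsurj : ∀ c₀ : F, valuation F c₀ ≤ 1 → ∃ a : F, valuation F a ≤ 1 ∧
      valuation F (a ^ 2 + τ * a - c₀) < 1 := by
    intro c₀ hc₀
    have hc₀E := (val_map_le_one_iff (E := E) _).mpr hc₀
    obtain ⟨y, hy⟩ := hall _ (hunit c₀ hc₀)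
    rw [hq.norm_eq_iff] at hy
    have hvu : valuation E (algebraMap F E (c₀ * ν ^ t)) ≤ unifVal E ^ (2 * t) := by
      rw [map_mul, map_mul, hνp]; exact mul_le_of_le_one_left' hc₀E
    have hvy1 : valuation E y = 1 := by
      have h1 := congrArg (valuation E) hy
      rw [map_mul, hq.val_conj, ← pow_two, (val_map_eq_one_iff _).mpr (hunit c₀ hc₀)] at h1
      exact (pow_eq_one_iff_of_nonneg zero_le two_ne_zero).mp h1
    -- `y` is congruent to `1`
    have hz1 : valuation E (y - 1) < 1 := by
      have hyc : valuation E (y - c y) < 1 := (hq.val_sub_le hvy1.le).trans_lt h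
      have e : (y - 1) ^ 2 = (y * (y - c y) + algebraMap F E (c₀ * ν ^ t))
          - algebraMap F E 2 * (y - 1) := by
        rw [map_add, map_one] at hy
        rw [map_ofNat]; linear_combination hy
      have h1 : valuation E ((y - 1) ^ 2) < 1 := by
        rw [e]
        refine (Valuation.map_sub _ _ _).trans_lt (max_lt
          ((Valuation.map_add _ _ _).trans_lt (max_lt ?_ ?_)) ?_)
        · rw [map_mul, hvy1, one_mul]; exact hyc
        · exact hvu.trans_lt (pow_lt_one₀ zero_le hp1 (by omega))
        · rw [map_mul]
          refine (mul_le_of_le_one_right' ?_).trans_lt ((val_map_lt_one_iff _).mpr h2)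
          exact (Valuation.map_sub _ _ _).trans (max_le hvy1.le (by simp))
      rw [map_pow] at h1
      exact (pow_lt_one_iff_of_nonneg zero_le two_ne_zero).mp h1
    set z := y - 1 with hzdef
    have hyz : y = 1 + z := by rw [hzdef]; ring
    -- `z` is divisible by `ϖ ^ t`
    have hzt : valuation E z ≤ unifVal E ^ t := by
      by_contra hlt
      rw [not_le] at hlt
      have hz0 : z ≠ 0 := by
        intro h0
        rw [h0, map_zero] at hlt
        exact absurd hlt (not_lt.mpr zero_le)
      obtain ⟨n, hn⟩ := exists_val_eq_pow hz0 hz1.le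
      have hnt : n < t := by
        by_contra hnt
        rw [hn] at hlt
        exact absurd (hpow (not_lt.mp hnt)) (not_le.mpr hlt)
      obtain ⟨S, hS⟩ := hq.of_fixed (x := z + c z) (by rw [map_add, hq.conj_conj, add_comm])
      have hvS := hq.val_trace_le hS (b := ν ^ (n + 1)) (by
        rw [map_mul, hn, hd, hνp, ← pow_add]; exact hpow (by omega))
      rw [hνp] at hvS
      have e : z * c z = algebraMap F E (c₀ * ν ^ t) - algebraMap F E S := by
        rw [hyz, map_add, map_one, map_add, map_one] at hy
        rw [hS]; linear_combination hy
      have h1 : valuation E (z * c z) ≤ unifVal E ^ (2 * n + 1) := by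
        rw [e]
        exact (Valuation.map_sub _ _ _).trans
          (max_le (hvu.trans (hpow (by omega))) (hvS.trans (hpow (by omega))))
      rw [map_mul, hq.val_conj, hn, ← pow_add] at h1
      have := hpow' h1
      omega
    obtain ⟨a, ha, hza⟩ := hq.exists_base_residue h (x := z / w) (by
      rw [map_div₀, hvw]; exact div_le_one_of_le₀ hzt zero_le)
    refine ⟨a, (val_map_le_one_iff a).mp ha, ?_⟩
    let z₁ := z - w * algebraMap F E a
    have hz₁ : valuation E z₁ ≤ unifVal E ^ (t + 1) := by
      have e : z₁ = w * (z / w - algebraMap F E a) := by simp only [z₁]; field_simp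
      rw [e, map_mul, hvw, pow_succ]
      exact mul_le_mul' le_rfl ((val_lt_one_iff _).mp hza)
    let r := z₁ * c (1 + w * algebraMap F E a)
    have hr : valuation E r ≤ unifVal E ^ (t + 1) := by
      simp only [r]
      rw [map_mul, hq.val_conj]
      refine (mul_le_of_le_one_right' ?_).trans hz₁
      refine (Valuation.map_add _ _ _).trans (max_le (by simp) ?_)
      rw [map_mul, hvw]
      exact mul_le_one' (pow_le_one₀ zero_le hp1.le) ha
    obtain ⟨S, hS⟩ := hq.of_fixed (x := r + c r) (by rw [map_add, hq.conj_conj, add_comm])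
    have hvS := hq.val_trace_le hS (b := ν ^ (t + 1)) (by
      rw [map_mul, hd, hνp]
      refine (mul_le_mul' hr le_rfl).trans ?_
      rw [← pow_add]; exact hpow (by omega))
    have e : algebraMap F E ((a ^ 2 + τ * a - c₀) * ν ^ t) = -(algebraMap F E S + z₁ * c z₁) := by
      have h1 := hq.norm_perturb w z₁ (algebraMap F E a)
      have h3 : w * algebraMap F E a + z₁ = z := by simp only [z₁]; ring
      rw [h3, ← hyz, hy, ← hS] at h1
      have h4 : (a ^ 2 + τ * a - c₀) * ν ^ t = ν ^ t * a ^ 2 + T * a + 1 - (1 + c₀ * ν ^ t) := by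
        rw [hTτ]; ring
      rw [h4, map_sub, h1]
      simp only [map_add, map_mul, map_one, AlgEquiv.commutes, ← hNw, hT, map_pow]
      ring
    have hle : valuation E (algebraMap F E ((a ^ 2 + τ * a - c₀) * ν ^ t))
        ≤ unifVal E ^ (2 * t + 1) := by
      rw [e, Valuation.map_neg]
      refine (Valuation.map_add _ _ _).trans (max_le ?_ ?_)
      · rw [hνp] at hvS; exact hvS.trans (hpow (by omega))
      · rw [map_mul, hq.val_conj]
        refine (mul_le_mul' hz₁ hz₁).trans ?_
        rw [← pow_add]; exact hpow (by omega)
    rw [map_mul, map_mul, hνp, pow_succ (unifVal E), mul_comm,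
      mul_le_mul_iff_right₀ (pow_pos hp0 _), ← val_lt_one_iff] at hle
    exact (val_map_lt_one_iff _).mp hle
  have hτF : valuation F τ ≤ 1 := (val_map_le_one_iff _).mp hτ1
  let τ' : 𝓀[F] := IsLocalRing.residue 𝒪[F] (⟨τ, hτF⟩ : 𝒪[F])
  have hs : Function.Surjective fun s : 𝓀[F] => s ^ 2 + τ' * s := by
    intro s
    obtain ⟨c₀, rfl⟩ := IsLocalRing.residue_surjective s
    obtain ⟨a, ha, hac⟩ := hsurj c₀ c₀.2
    refine ⟨IsLocalRing.residue 𝒪[F] (⟨a, ha⟩ : 𝒪[F]), ?_⟩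
    simp only [τ']
    rw [← map_pow, ← map_mul, ← map_add, residue_eq_iff]
    exact hac
  have hi := Finite.injective_iff_surjective.mpr hs
  have h0 : -τ' = 0 := hi (by simp only; ring)
  rw [neg_eq_zero, IsLocalRing.residue_eq_zero_iff, mem_maximalIdeal_iff] at h0
  exact hτ ((val_map_lt_one_iff _).mpr h0)

theorem exists_quadChar_eq_neg_one (h : valuation E δ < 1) :
    ∃ u : Fˣ, valuation F (u : F) = 1 ∧ quadChar F E u = -1 := by
  obtain ⟨u, hu, hN⟩ : ∃ u : F, valuation F u = 1 ∧ ∀ y : E, Algebra.norm F y ≠ u := by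
    rcases (val_two_le (K := F)).lt_or_eq with h2 | h2
    · exact hq.exists_not_norm_even h h2
    · exact hq.exists_not_norm_odd h h2
  have hu0 : u ≠ 0 := by rintro rfl; simp at hu
  refine ⟨Units.mk0 u hu0, hu, ?_⟩
  rw [quadChar, if_neg]
  rintro ⟨y, hy⟩
  exact hN y hy

end QuadFacts

end Norms

/-! ### Sums of products of spherical values -/

section Series

/-- A sequence grows at most like `n * M ^ n`. -/
def HasGrowth (M : ℝ) (x : ℕ → ℂ) : Prop := ∃ C : ℝ, ∀ n : ℕ, ‖x n‖ ≤ C * (n + 1) * M ^ n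

theorem HasGrowth.shift {M : ℝ} (hM : 0 ≤ M) {x : ℕ → ℂ} (h : HasGrowth M x) :
    HasGrowth M fun n => x (n + 1) := by
  obtain ⟨C, hC⟩ := h
  have hC0 : 0 ≤ C := by simpa using (norm_nonneg _).trans (hC 0)
  refine ⟨2 * C * M, fun n => (hC (n + 1)).trans ?_⟩
  have h1 : C * ((n + 1 : ℕ) + 1 : ℝ) ≤ 2 * C * (n + 1) := by push_cast; nlinarith
  calc C * ((n + 1 : ℕ) + 1 : ℝ) * M ^ (n + 1) ≤ 2 * C * (n + 1) * M ^ (n + 1) := by gcongr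
    _ = 2 * C * M * (n + 1) * M ^ n := by ring

theorem HasGrowth.summable {M M' t : ℝ} (hM : 0 ≤ M) (hM' : 0 ≤ M') (ht : 0 ≤ t)
    (hlt : t * (M * M') < 1) {x y : ℕ → ℂ} (hx : HasGrowth M x) (hy : HasGrowth M' y) :
    Summable fun n => (t : ℂ) ^ n * (x n * y n) := by
  obtain ⟨C, hC⟩ := hx
  obtain ⟨C', hC'⟩ := hy
  set u := t * (M * M') with hu
  have hu0 : 0 ≤ u := by positivity
  have hs : Summable fun n : ℕ => C * C' * ((n + 1 : ℝ) ^ 2 * u ^ n) := by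
    apply Summable.mul_left
    have h2 := summable_pow_mul_geometric_of_norm_lt_one (R := ℝ) 2 (r := u)
      (by rwa [Real.norm_of_nonneg hu0])
    have h1 := summable_pow_mul_geometric_of_norm_lt_one (R := ℝ) 1 (r := u)
      (by rwa [Real.norm_of_nonneg hu0])
    have h0 := summable_geometric_of_lt_one hu0 hlt
    refine ((h2.add (h1.mul_left 2)).add h0).congr fun n => ?_
    ring
  refine Summable.of_norm_bounded hs fun n => ?_
  have hC0 : 0 ≤ C := by simpa using (norm_nonneg _).trans (hC 0)
  have hC0' : 0 ≤ C' := by simpa using (norm_nonneg _).trans (hC' 0)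
  rw [norm_mul, norm_mul, norm_pow, Complex.norm_of_nonneg ht]
  calc t ^ n * (‖x n‖ * ‖y n‖)
      ≤ t ^ n * ((C * (n + 1) * M ^ n) * (C' * (n + 1) * M' ^ n)) := by
        gcongr
        · exact hC n
        · exact hC' n
    _ = C * C' * ((n + 1 : ℝ) ^ 2 * u ^ n) := by rw [hu, mul_pow, mul_pow]; ring

theorem hasGrowth_of_rec {β : ℂ} (hβ : β ≠ 0) {x : ℕ → ℂ}
    (hx : ∀ n, x (n + 2) = (β + β⁻¹) * x (n + 1) - x n) : HasGrowth (max ‖β‖ ‖β‖⁻¹) x := by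
  set M := max ‖β‖ ‖β‖⁻¹ with hM
  have hβ' : 0 < ‖β‖ := norm_pos_iff.mpr hβ
  have hM1 : 1 ≤ M := by
    rcases le_total 1 ‖β‖ with h | h
    · exact h.trans (le_max_left _ _)
    · exact ((one_le_inv₀ hβ').mpr h).trans (le_max_right _ _)
  have hu : ∀ n, x (n + 1) - β * x n = β⁻¹ ^ n * (x 1 - β * x 0) := by
    intro n
    induction n with
    | zero => simp
    | succ n ih =>
      rw [hx, pow_succ]
      linear_combination β⁻¹ * ih + x n * (inv_mul_cancel₀ hβ)
  set D := ‖x 1 - β * x 0‖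
  refine ⟨‖x 0‖ + D, fun n => ?_⟩
  have h2 : ‖x n‖ ≤ (‖x 0‖ + n * D) * M ^ n := by
    induction n with
    | zero => simp
    | succ n ih =>
      have e : x (n + 1) = β * x n + β⁻¹ ^ n * (x 1 - β * x 0) := by rw [← hu]; ring
      have h3 : ‖β⁻¹‖ ^ n ≤ M ^ (n + 1) := by
        rw [norm_inv]
        calc ‖β‖⁻¹ ^ n ≤ M ^ n := by gcongr; exact le_max_right _ _
          _ ≤ M ^ (n + 1) := pow_le_pow_right₀ hM1 n.le_succ
      calc ‖x (n + 1)‖ ≤ ‖β‖ * ‖x n‖ + ‖β⁻¹‖ ^ n * D := by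
            rw [e]; refine (norm_add_le _ _).trans ?_
            rw [norm_mul, norm_mul, norm_pow]
        _ ≤ M * ((‖x 0‖ + n * D) * M ^ n) + M ^ (n + 1) * D := by
            gcongr
            exact le_max_left _ _
        _ = (‖x 0‖ + (n + 1 : ℕ) * D) * M ^ (n + 1) := by push_cast; ring
  refine h2.trans ?_
  gcongr
  have h0 := norm_nonneg (x 0)
  have hD : 0 ≤ D := norm_nonneg _
  have hn : (0 : ℝ) ≤ n := n.cast_nonneg
  nlinarith

/-- The generating series of a product of two sequences with second order recurrences: the four
series `∑ tⁿ x_{n+i} y_{n+j}` with `i, j ≤ 1` solve a linear system. -/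
theorem tsum_rec_mul {β γ : ℂ} {t : ℝ} (hβ : β ≠ 0) (hγ : γ ≠ 0) (ht : 0 ≤ t)
    (hlt : t * (max ‖β‖ ‖β‖⁻¹ * max ‖γ‖ ‖γ‖⁻¹) < 1) {x y : ℕ → ℂ}
    (hx : ∀ n, x (n + 2) = (β + β⁻¹) * x (n + 1) - x n)
    (hy : ∀ n, y (n + 2) = (γ + γ⁻¹) * y (n + 1) - y n) (hx0 : x 0 = 1) (hy0 : y 0 = 1) :
    Summable (fun n => (t : ℂ) ^ n * (x n * y n)) ∧
    (1 - (t : ℂ) * (β * γ)) * (1 - (t : ℂ) * (β * γ⁻¹)) * (1 - (t : ℂ) * (β⁻¹ * γ)) *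
      (1 - (t : ℂ) * (β⁻¹ * γ⁻¹)) * ∑' n, (t : ℂ) ^ n * (x n * y n) =
    1 - t * (β + β⁻¹) * (γ + γ⁻¹) + t * (x 1 * y 1) * (1 - t ^ 2)
      + t ^ 2 * ((β + β⁻¹) ^ 2 + (γ + γ⁻¹) ^ 2 - (β + β⁻¹) * x 1 - (γ + γ⁻¹) * y 1 - 1)
      + t ^ 3 * ((β + β⁻¹) * y 1 + (γ + γ⁻¹) * x 1 - (β + β⁻¹) * (γ + γ⁻¹)) := by
  have hM : 0 ≤ max ‖β‖ ‖β‖⁻¹ := (norm_nonneg β).trans (le_max_left _ _)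
  have hM' : 0 ≤ max ‖γ‖ ‖γ‖⁻¹ := (norm_nonneg γ).trans (le_max_left _ _)
  have gx := hasGrowth_of_rec hβ hx
  have gy := hasGrowth_of_rec hγ hy
  have gx' := gx.shift hM
  have gy' := gy.shift hM'
  have sA := gx.summable hM hM' ht hlt gy
  have sB := gx'.summable hM hM' ht hlt gy
  have sC := gx.summable hM hM' ht hlt gy'
  have sD := gx'.summable hM hM' ht hlt gy'
  refine ⟨sA, ?_⟩
  set A := ∑' n, (t : ℂ) ^ n * (x n * y n) with hA
  set B := ∑' n, (t : ℂ) ^ n * (x (n + 1) * y n) with hB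
  set C := ∑' n, (t : ℂ) ^ n * (x n * y (n + 1)) with hC
  set D := ∑' n, (t : ℂ) ^ n * (x (n + 1) * y (n + 1)) with hD
  have eA : A = 1 + t * D := by
    rw [hA, sA.tsum_eq_zero_add, hD, ← tsum_mul_left, hx0, hy0]
    simp only [pow_succ]
    congr 1
    · simp
    · exact tsum_congr fun n => by ring
  have eB : B = x 1 + t * ((β + β⁻¹) * D - C) := by
    rw [hB, sB.tsum_eq_zero_add, hC, hD, ← tsum_mul_left, ← (sD.mul_left _).tsum_sub sC,
      ← tsum_mul_left, hy0]
    congr 1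
    · simp
    · exact tsum_congr fun n => by rw [hx]; ring
  have eC : C = y 1 + t * ((γ + γ⁻¹) * D - B) := by
    rw [hC, sC.tsum_eq_zero_add, hB, hD, ← tsum_mul_left, ← (sD.mul_left _).tsum_sub sB,
      ← tsum_mul_left, hx0]
    congr 1
    · simp
    · exact tsum_congr fun n => by rw [hy]; ring
  have eD : D = x 1 * y 1 +
      t * ((β + β⁻¹) * (γ + γ⁻¹) * D - (β + β⁻¹) * B - (γ + γ⁻¹) * C + A) := by
    have e := ((((sD.hasSum.mul_left ((β + β⁻¹) * (γ + γ⁻¹))).sub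
      (sB.hasSum.mul_left (β + β⁻¹))).sub (sC.hasSum.mul_left (γ + γ⁻¹))).add
        sA.hasSum).mul_left (t : ℂ)
    rw [← hA, ← hB, ← hC, ← hD] at e
    rw [← e.tsum_eq]
    conv_lhs => rw [hD, sD.tsum_eq_zero_add]
    congr 1
    · simp
    · exact tsum_congr fun n => by rw [hx, hy]; ring
  set a := β + β⁻¹ with ha
  set a' := γ + γ⁻¹ with ha'
  have hden : (1 - (t : ℂ) * (β * γ)) * (1 - (t : ℂ) * (β * γ⁻¹)) * (1 - (t : ℂ) * (β⁻¹ * γ)) *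
      (1 - (t : ℂ) * (β⁻¹ * γ⁻¹)) = 1 - a * a' * t + (a ^ 2 + a' ^ 2 - 2) * t ^ 2
        - a * a' * t ^ 3 + t ^ 4 := by
    rw [ha, ha']; field_simp; ring
  rw [hden]
  have hDD : (1 - a * a' * t + (a ^ 2 + a' ^ 2 - 2) * t ^ 2 - a * a' * t ^ 3 + t ^ 4) * D =
      (x 1 * y 1 + t) * (1 - t ^ 2) - t * (a * x 1 + a' * y 1) + t ^ 2 * (a * y 1 + a' * x 1) := by
    linear_combination (1 - (t : ℂ) ^ 2) * eD + t * (1 - (t : ℂ) ^ 2) * eA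
      - t * a * (eB - t * eC) - t * a' * (eC - t * eB)
  linear_combination
    (1 - a * a' * t + (a ^ 2 + a' ^ 2 - 2) * t ^ 2 - a * a' * t ^ 3 + (t : ℂ) ^ 4) * eA
    + t * hDD

/-- Spherical values of a group of rank one. The numbers `P k` are the masses of the sets of the
boundary points at distance at least `k` from a base point, `R` is the index of consecutive even
levels and `J` the index of an even level in the preceding odd one. -/
theorem rankOne_rec {R J b s : ℂ} (hb : b ≠ 0) (hR : R ≠ 0) {P φ : ℕ → ℂ}
    (h1 : 1 = s + P 1) (h2 : s = R * P 2) (hodd : ∀ l, P (2 * l + 1) = J * P (2 * l + 2))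
    (heven : ∀ l, P (2 * l + 2) = R * P (2 * l + 4)) (hφ0 : φ 0 = 1)
    (hφ : ∀ n, φ (n + 1) = b * φ n
      + (1 - b) * b⁻¹ ^ n * (P (2 * n + 1) + b⁻¹ * P (2 * n + 2))) :
    (R + J) * (φ 1 - b) = (1 - b) * (J + b⁻¹) ∧
    ∀ n, R * φ (n + 2) + φ n = (R * b + b⁻¹) * φ (n + 1) := by
  have hP2 : (R + J) * P 2 = 1 := by
    have := hodd 0
    simp only [mul_zero, zero_add] at this
    linear_combination -h1 - h2 - this
  have hP : ∀ l, P (2 * l + 2) = R⁻¹ ^ l * P 2 := by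
    intro l
    induction l with
    | zero => simp
    | succ l ih =>
      have h3 := heven l
      rw [show 2 * (l + 1) + 2 = 2 * l + 4 by ring, pow_succ]
      have : P (2 * l + 4) = R⁻¹ * P (2 * l + 2) := by rw [h3]; field_simp
      rw [this, ih]; ring
  have hstep : ∀ n, φ (n + 1) - b * φ n = (1 - b) * (J + b⁻¹) * P 2 * (b⁻¹ * R⁻¹) ^ n := by
    intro n
    rw [hφ, hodd, hP, mul_pow]; ring
  refine ⟨?_, fun n => ?_⟩
  · have := hstep 0
    rw [hφ0] at this
    simp only [zero_add, pow_zero, mul_one] at this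
    rw [this]
    linear_combination (1 - b) * (J + b⁻¹) * hP2
  · have e1 := hstep n
    have e2 := hstep (n + 1)
    rw [pow_succ] at e2
    have e3 : φ (n + 2) - b * φ (n + 1) = b⁻¹ * R⁻¹ * (φ (n + 1) - b * φ n) := by
      rw [e1, e2]; ring
    field_simp at e3 ⊢
    linear_combination e3

end Series

/-! ### Spherical functions of a group acting on isotropic rows -/

section RowModel

variable {F E : Type*} [Field F] [ValuativeRel F] [TopologicalSpace F]
  [IsNonarchimedeanLocalField F] [Field E] [ValuativeRel E] [TopologicalSpace E]
  [IsNonarchimedeanLocalField E] [Algebra F E] [ValuativeExtension F E]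
  {Γ : Type*} [Group Γ] [TopologicalSpace Γ]

/-- The largest valuation of an entry of the row `(x, y, z)`. -/
def rowVal (x y z : E) : ValueGroupWithZero E :=
  max (valuation E x) (max (valuation E y) (valuation E z))

/-- A group `Γ` with a map to isotropic rows `(X, Y, Z)`, on which a subgroup `K` acts through
integral lower unipotent matrices and a Weyl element, and on which the elements `m n` act by
`diag(ϖ⁻ⁿ, 1, (ϖᶜ)ⁿ)`. The unipotent matrices have bottom rows `(s, a, 1)` with `N s a`; the
pairs in `T` represent the integral ones modulo those with `s` divisible by the norm of `ϖ`, and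
the pairs in `T₁` represent those with `s` divisible by `ϖ`. -/
structure RowModel (c : E ≃ₐ[F] E) (δ : E) (K : Subgroup Γ) (R : Γ → ℂ → Prop)
    (X Y Z : Γ → E) (N : E → E → Prop) (T T₁ : Finset (E × E)) (m : ℕ → Γ) : Prop where
  ne_zero : ∀ g, X g ≠ 0 ∨ Y g ≠ 0 ∨ Z g ≠ 0
  isotropic : ∀ g, X g * c (Z g) - Z g * c (X g) = δ * (Y g * c (Y g))
  div_mem : ∀ g, Z g ≠ 0 → N (X g / Z g) (Y g / Z g)
  equivariant : ∀ b z, R b z → ∃ u : E, u ≠ 0 ∧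
    ∀ g, X (b * g) = u * X g ∧ Y (b * g) = u * Y g ∧ Z (b * g) = u * Z g
  smooth : ∀ k : ℕ, ∃ U ∈ 𝓝 (1 : Γ), ∀ u ∈ U, ∀ g,
    valuation E (X (g * u) - X g) ≤ unifVal E ^ k * rowVal (X g) (Y g) (Z g) ∧
    valuation E (Y (g * u) - Y g) ≤ unifVal E ^ k * rowVal (X g) (Y g) (Z g) ∧
    valuation E (Z (g * u) - Z g) ≤ unifVal E ^ k * rowVal (X g) (Y g) (Z g)
  unipotent : ∀ s a, N s a → valuation E s ≤ 1 → valuation E a ≤ 1 → ∃ κ ∈ K, ∀ g,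
    X (g * κ) = X g + δ * c a * Y g + s * Z g ∧ Y (g * κ) = Y g + a * Z g ∧ Z (g * κ) = Z g
  weyl : ∃ κ ∈ K, ∀ g, X (g * κ) = Z g ∧ Y (g * κ) = Y g ∧ Z (g * κ) = -X g
  torus : ∀ n g, X (g * m n) = (unif E : E)⁻¹ ^ n * X g ∧ Y (g * m n) = Y g ∧
    Z (g * m n) = c (unif E : E) ^ n * Z g
  heis : ∀ x y, N x y → x - c x = δ * (y * c y)
  scale_down : ∀ l x y, N x y → N (x / (unif E * c (unif E)) ^ l) (y / (unif E : E) ^ l)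
  scale_up : ∀ l x y, N x y → N ((unif E * c (unif E)) ^ l * x) ((unif E : E) ^ l * y)
  inv_mem : ∀ x y, N x y → N (-x + δ * c y * y) (-y)
  base : X 1 = 0 ∧ Y 1 = 0
  reps_mem : ∀ t ∈ T, N t.1 t.2 ∧ valuation E t.1 ≤ 1 ∧ valuation E t.2 ≤ 1
  reps_uniq : ∀ x y, N x y → valuation E x ≤ 1 →
    ∃! t, t ∈ T ∧ valuation E (x + δ * c t.2 * y + t.1) ≤ unifVal E ^ 2
  reps'_mem : ∀ t ∈ T₁, N t.1 t.2 ∧ valuation E t.1 ≤ unifVal E ∧ valuation E t.2 ≤ 1 ∧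
    ∀ y, valuation E y ≤ 1 → valuation E (δ * c t.2 * y) ≤ unifVal E
  reps'_uniq : ∀ x y, N x y → valuation E x ≤ unifVal E →
    ∃! t, t ∈ T₁ ∧ valuation E (x + δ * c t.2 * y + t.1) ≤ unifVal E ^ 2

theorem rowVal_le_iff {x y z : E} {γ : ValueGroupWithZero E} :
    rowVal x y z ≤ γ ↔ valuation E x ≤ γ ∧ valuation E y ≤ γ ∧ valuation E z ≤ γ := by
  rw [rowVal, max_le_iff, max_le_iff]

theorem rowVal_mul (u x y z : E) :
    rowVal (u * x) (u * y) (u * z) = valuation E u * rowVal x y z := by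
  simp only [rowVal, map_mul]
  rw [mul_max, mul_max]

theorem rowVal_pos {x y z : E} (h : x ≠ 0 ∨ y ≠ 0 ∨ z ≠ 0) : 0 < rowVal x y z := by
  have hv : ∀ {w : E}, w ≠ 0 → 0 < valuation E w := fun hw => zero_lt_iff.mpr (by simpa using hw)
  rcases h with h | h | h
  · exact (hv h).trans_le (le_max_left _ _)
  · exact (hv h).trans_le ((le_max_left _ _).trans (le_max_right _ _))
  · exact (hv h).trans_le ((le_max_right _ _).trans (le_max_right _ _))

theorem exists_rowVal_eq {x y z : E} (h : x ≠ 0 ∨ y ≠ 0 ∨ z ≠ 0) :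
    ∃ j : ℤ, rowVal x y z = unifVal E ^ j := by
  have h0 := rowVal_pos h
  have key : ∀ w : E, rowVal x y z = valuation E w → ∃ j : ℤ, rowVal x y z = unifVal E ^ j := by
    intro w hw
    have hw0 : w ≠ 0 := by rintro rfl; rw [hw, map_zero] at h0; exact lt_irrefl _ h0
    rw [hw]; exact exists_val_eq_zpow hw0
  rcases max_choice (valuation E x) (max (valuation E y) (valuation E z)) with h1 | h1
  · exact key x h1
  · rcases max_choice (valuation E y) (valuation E z) with h2 | h2
    · exact key y (h1.trans h2)
    · exact key z (h1.trans h2)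

theorem val_le_iff_of_sub_le {x y : E} {γ : ValueGroupWithZero E} (h : valuation E (y - x) ≤ γ) :
    valuation E y ≤ γ ↔ valuation E x ≤ γ := by
  refine ⟨fun hy => ?_, fun hx => ?_⟩
  · have e : x = y - (y - x) := by ring
    rw [e]; exact (Valuation.map_sub _ _ _).trans (max_le hy h)
  · have e : y = (y - x) + x := by ring
    rw [e]; exact (Valuation.map_add _ _ _).trans (max_le h hx)

/-- Integral lower unipotent matrices do not change the level of a row. -/
theorem rowVal_unipotent {c : E ≃ₐ[F] E} {δ : E} (hq : QuadFacts c δ) {s a : E}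
    (hs : valuation E s ≤ 1) (ha : valuation E a ≤ 1) (x y z : E) :
    rowVal (x + δ * c a * y + s * z) (y + a * z) z = rowVal x y z := by
  have hδ := hq.val_delta_le_one
  have hca : valuation E (c a) ≤ 1 := by rw [hq.val_conj]; exact ha
  have hδa : valuation E (δ * c a) ≤ 1 := by rw [map_mul]; exact mul_le_one' hδ hca
  have hmul : ∀ {u w : E} {γ : ValueGroupWithZero E}, valuation E u ≤ 1 → valuation E w ≤ γ →
      valuation E (u * w) ≤ γ := by
    intro u w γ hu hw
    rw [map_mul]; exact (mul_le_of_le_one_left' hu).trans hw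
  have hadd : ∀ {u w : E} {γ : ValueGroupWithZero E}, valuation E u ≤ γ → valuation E w ≤ γ →
      valuation E (u + w) ≤ γ := fun hu hw => (Valuation.map_add _ _ _).trans (max_le hu hw)
  have hsub : ∀ {u w : E} {γ : ValueGroupWithZero E}, valuation E u ≤ γ → valuation E w ≤ γ →
      valuation E (u - w) ≤ γ := fun hu hw => (Valuation.map_sub _ _ _).trans (max_le hu hw)
  apply le_antisymm
  · obtain ⟨hx, hy, hz⟩ := rowVal_le_iff.mp (le_refl (rowVal x y z))
    exact rowVal_le_iff.mpr ⟨hadd (hadd hx (hmul hδa hy)) (hmul hs hz), hadd hy (hmul ha hz), hz⟩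
  · obtain ⟨hx, hy, hz⟩ := rowVal_le_iff.mp
      (le_refl (rowVal (x + δ * c a * y + s * z) (y + a * z) z))
    have hy' : valuation E y ≤ rowVal (x + δ * c a * y + s * z) (y + a * z) z := by
      have := hsub hy (hmul ha hz)
      rwa [add_sub_cancel_right] at this
    refine rowVal_le_iff.mpr ⟨?_, hy', hz⟩
    have := hsub (hsub hx (hmul hs hz)) (hmul hδa hy')
    rwa [add_sub_cancel_right, add_sub_cancel_right] at this

namespace RowModel

variable {c : E ≃ₐ[F] E} {δ : E} {K : Subgroup Γ} {R : Γ → ℂ → Prop} {X Y Z : Γ → E}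
  {N : E → E → Prop} {T T₁ : Finset (E × E)} {m : ℕ → Γ}

theorem lev_pos (M : RowModel c δ K R X Y Z N T T₁ m) (g : Γ) : 0 < rowVal (X g) (Y g) (Z g) :=
  rowVal_pos (M.ne_zero g)

/-- The first and the last entry of an isotropic row are not both small. -/
theorem val_fst_of_lt (M : RowModel c δ K R X Y Z N T T₁ m) (hq : QuadFacts c δ) {g : Γ}
    (hZ : valuation E (Z g) < rowVal (X g) (Y g) (Z g)) :
    valuation E (X g) = rowVal (X g) (Y g) (Z g) := by
  set L := rowVal (X g) (Y g) (Z g) with hL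
  by_contra hX
  have hX' : valuation E (X g) < L := lt_of_le_of_ne (le_max_left _ _) hX
  have hY : valuation E (Y g) = L := by
    apply le_antisymm ((le_max_left _ _).trans (le_max_right _ _))
    by_contra hlt
    rw [not_le] at hlt
    have : L < L := by conv_lhs => rw [hL, rowVal]
                       exact max_lt hX' (max_lt hlt hZ)
    exact lt_irrefl _ this
  have hL0 : 0 < L := M.lev_pos g
  have hY0 : Y g ≠ 0 := by
    intro h0; rw [h0, map_zero] at hY; exact hL0.ne hY
  have hcY0 := hq.conj_ne_zero hY0
  obtain ⟨ν, -, hν⟩ := hq.exists_normUnif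
  have hx : valuation E (X g / Y g) ≤ unifVal E := by
    rw [← val_lt_one_iff, map_div₀, hY]; exact (div_lt_one₀ hL0).mpr hX'
  have hz : valuation E (Z g / Y g) ≤ unifVal E := by
    rw [← val_lt_one_iff, map_div₀, hY]; exact (div_lt_one₀ hL0).mpr hZ
  have h1 := hq.val_coeff_le (x := X g / Y g * c (Z g / Y g)) (a := 1) (b := ν) (by
    simp only [map_mul, map_div₀, hq.conj_conj, map_one]
    field_simp
    linear_combination M.isotropic g) (by
    rw [map_mul, hq.val_conj, hν, pow_two]; exact mul_le_mul' hx hz)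
  rw [map_one, map_one, hν] at h1
  exact absurd (pow_lt_one₀ zero_le (unifVal_lt_one E) two_ne_zero) (not_lt.mpr h1)

theorem val_lst_of_lt (M : RowModel c δ K R X Y Z N T T₁ m) (hq : QuadFacts c δ) {g : Γ}
    (hX : valuation E (X g) < rowVal (X g) (Y g) (Z g)) :
    valuation E (Z g) = rowVal (X g) (Y g) (Z g) := by
  by_contra hZ
  have := M.val_fst_of_lt hq (g := g)
    (lt_of_le_of_ne ((le_max_right _ _).trans (le_max_right _ _)) hZ)
  exact hX.ne this

/-- Row entries relative to a last entry of maximal valuation. -/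
theorem div_le_iff (M : RowModel c δ K R X Y Z N T T₁ m) {g : Γ}
    (hZ : valuation E (Z g) = rowVal (X g) (Y g) (Z g)) (x : E) (γ : ValueGroupWithZero E) :
    valuation E (x / Z g) ≤ γ ↔ valuation E x ≤ γ * rowVal (X g) (Y g) (Z g) := by
  rw [map_div₀, hZ, div_le_iff₀ (M.lev_pos g)]

theorem lst_ne_zero (M : RowModel c δ K R X Y Z N T T₁ m) {g : Γ}
    (hZ : valuation E (Z g) = rowVal (X g) (Y g) (Z g)) : Z g ≠ 0 := by
  intro h0
  rw [h0, map_zero] at hZ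
  exact (M.lev_pos g).ne (by rw [h0]; exact hZ)

/-- The level of a row after translation by `m n`, when the first entry is not too small. -/
theorem torus_lev_of_le (M : RowModel c δ K R X Y Z N T T₁ m) (hq : QuadFacts c δ) {n : ℕ} {g : Γ}
    {k : ℕ} (hk : k ≤ 2 * n) (hX : valuation E (X g) = unifVal E ^ k * rowVal (X g) (Y g) (Z g)) :
    rowVal (X (g * m n)) (Y (g * m n)) (Z (g * m n))
      = unifVal E ^ ((k : ℤ) - n) * rowVal (X g) (Y g) (Z g) := by
  obtain ⟨e1, e2, e3⟩ := M.torus n g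
  set L := rowVal (X g) (Y g) (Z g) with hL
  have hL0 : 0 < L := M.lev_pos g
  have hp0 := unifVal_ne_zero E
  have hπ : valuation E (unif E : E) = unifVal E := rfl
  obtain ⟨hx, hy, hz⟩ := rowVal_le_iff.mp (le_refl L)
  have vx : valuation E (X (g * m n)) = unifVal E ^ ((k : ℤ) - n) * L := by
    rw [e1, map_mul, map_pow, map_inv₀, hπ, hX, ← mul_assoc, zpow_sub₀ hp0, zpow_natCast,
      zpow_natCast, inv_pow, div_eq_mul_inv, mul_comm (unifVal E ^ k)]
  apply le_antisymm
  · refine rowVal_le_iff.mpr ⟨vx.le, ?_, ?_⟩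
    · rw [e2]
      by_cases hk0 : k = 0
      · refine hy.trans (le_mul_of_one_le_left' ?_)
        rw [← zpow_zero (unifVal E), unifVal_zpow_le_iff]; omega
      have hlt : valuation E (X g) < L := by
        rw [hX]; exact mul_lt_of_lt_one_left hL0 (pow_lt_one₀ zero_le (unifVal_lt_one E) hk0)
      have hZ := M.val_lst_of_lt hq hlt
      have hh := M.heis _ _ (M.div_mem g (M.lst_ne_zero hZ))
      obtain ⟨ν, -, hν⟩ := hq.exists_normUnif
      have hνp : valuation E (algebraMap F E (ν ^ (k / 2))) = (unifVal E ^ (k / 2)) ^ 2 := by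
        rw [map_pow, map_pow, hν, ← pow_mul, ← pow_mul, mul_comm]
      have h2 := hq.val_sq_le hh (b := ν ^ (k / 2)) (by
        rw [M.div_le_iff hZ, ← hL, hX, hνp, ← pow_mul]
        exact mul_le_mul' (pow_le_pow_of_le_one zero_le (unifVal_lt_one E).le (by omega)) le_rfl)
      rw [hνp, pow_le_pow_iff_left₀ zero_le zero_le two_ne_zero, M.div_le_iff hZ, ← hL] at h2
      refine h2.trans (mul_le_mul' ?_ le_rfl)
      rw [← zpow_natCast, unifVal_zpow_le_iff]; omega
    · rw [e3, map_mul, map_pow, hq.val_conj, hπ]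
      refine mul_le_mul' ?_ hz
      rw [← zpow_natCast, unifVal_zpow_le_iff]; omega
  · rw [← vx]; exact le_max_left _ _

theorem torus_lev_of_lt (M : RowModel c δ K R X Y Z N T T₁ m) (hq : QuadFacts c δ) {n : ℕ} {g : Γ}
    (hX : valuation E (X g) < unifVal E ^ (2 * n) * rowVal (X g) (Y g) (Z g)) :
    rowVal (X (g * m n)) (Y (g * m n)) (Z (g * m n))
      = unifVal E ^ n * rowVal (X g) (Y g) (Z g) := by
  obtain ⟨e1, e2, e3⟩ := M.torus n g
  set L := rowVal (X g) (Y g) (Z g) with hL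
  have hL0 : 0 < L := M.lev_pos g
  have hp0 := unifVal_ne_zero E
  have hp0' := unifVal_pos E
  have hπ : valuation E (unif E : E) = unifVal E := rfl
  have hlt : valuation E (X g) < L :=
    hX.trans_le (mul_le_of_le_one_left' (pow_le_one₀ zero_le (unifVal_lt_one E).le))
  have hZ := M.val_lst_of_lt hq hlt
  have vz : valuation E (Z (g * m n)) = unifVal E ^ n * L := by
    rw [e3, map_mul, map_pow, hq.val_conj, hπ, hZ]
  apply le_antisymm
  · refine rowVal_le_iff.mpr ⟨?_, ?_, vz.le⟩
    · rw [e1, map_mul, map_pow, map_inv₀, hπ, inv_pow, inv_mul_le_iff₀ (pow_pos hp0' n),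
        ← mul_assoc, ← pow_add, ← two_mul]
      exact hX.le
    · rw [e2]
      have hh := M.heis _ _ (M.div_mem g (M.lst_ne_zero hZ))
      obtain ⟨ν, -, hν⟩ := hq.exists_normUnif
      have hνp : valuation E (algebraMap F E (ν ^ n)) = (unifVal E ^ n) ^ 2 := by
        rw [map_pow, map_pow, hν, ← pow_mul, ← pow_mul, mul_comm]
      have h2 := hq.val_sq_le hh (b := ν ^ n) (by
        rw [M.div_le_iff hZ, ← hL, hνp, ← pow_mul, mul_comm n]; exact hX.le)
      rwa [hνp, pow_le_pow_iff_left₀ zero_le zero_le two_ne_zero, M.div_le_iff hZ, ← hL] at h2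
  · rw [← vz]; exact (le_max_right _ _).trans (le_max_right _ _)

end RowModel

end RowModel

section Spherical

variable {F E : Type*} [Field F] [ValuativeRel F] [TopologicalSpace F]
  [IsNonarchimedeanLocalField F] [Field E] [ValuativeRel E] [TopologicalSpace E]
  [IsNonarchimedeanLocalField E] [Algebra F E] [ValuativeExtension F E]
  {Γ : Type*} [Group Γ] [TopologicalSpace Γ]

/-- The product of an element of an induced representation with the indicator function of a set
that is left invariant under the inducing subgroup and smooth on the right. -/
def cutoff {R : Γ → ℂ → Prop} (f : inducedSpace R) (S : Set Γ)
    (h1 : ∀ b z, R b z → ∀ g, b * g ∈ S ↔ g ∈ S)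
    (h2 : ∃ U ∈ 𝓝 (1 : Γ), ∀ u ∈ U, ∀ g, g * u ∈ S ↔ g ∈ S) : inducedSpace R :=
  ⟨S.indicator f.1, by
    classical
    obtain ⟨f, hf1, U, hU, hf2⟩ := f
    obtain ⟨U', hU', h2⟩ := h2
    refine ⟨fun b z hb g => ?_, U ∩ U', Filter.inter_mem hU hU', fun u hu g => ?_⟩
    · simp only [Set.indicator_apply, h1 b z hb, hf1 b z hb, mul_ite, mul_zero]
    · simp only [Set.indicator_apply, h2 u hu.2, hf2 u hu.1]⟩

theorem val_lt_iff_of_sub_lt {x y : E} {γ : ValueGroupWithZero E} (h : valuation E (y - x) < γ) :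
    valuation E y < γ ↔ valuation E x < γ := by
  refine ⟨fun hy => ?_, fun hx => ?_⟩
  · have e : x = y - (y - x) := by ring
    rw [e]; exact (Valuation.map_sub _ _ _).trans_lt (max_lt hy h)
  · have e : y = (y - x) + x := by ring
    rw [e]; exact (Valuation.map_add _ _ _).trans_lt (max_lt h hx)

theorem rowVal_eq_of_close {x y z x' y' z' : E}
    (hx : valuation E (x' - x) < rowVal x y z) (hy : valuation E (y' - y) < rowVal x y z)
    (hz : valuation E (z' - z) < rowVal x y z) : rowVal x' y' z' = rowVal x y z := by
  obtain ⟨h1, h2, h3⟩ := rowVal_le_iff.mp (le_refl (rowVal x y z))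
  apply le_antisymm
  · rw [rowVal_le_iff, val_le_iff_of_sub_le hx.le, val_le_iff_of_sub_le hy.le,
      val_le_iff_of_sub_le hz.le]
    exact ⟨h1, h2, h3⟩
  · by_contra hlt
    have h4 : ∀ w w' : E, valuation E (w' - w) < rowVal x y z → valuation E w' ≤ rowVal x' y' z' →
        valuation E w < rowVal x y z := fun w w' h h' =>
      (val_lt_iff_of_sub_lt h).mp (h'.trans_lt (not_le.mp hlt))
    obtain ⟨h1', h2', h3'⟩ := rowVal_le_iff.mp (le_refl (rowVal x' y' z'))
    have : rowVal x y z < rowVal x y z :=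
      max_lt (h4 _ _ hx h1') (max_lt (h4 _ _ hy h2') (h4 _ _ hz h3'))
    exact lt_irrefl _ this

namespace RowModel

variable {c : E ≃ₐ[F] E} {δ : E} {K : Subgroup Γ} {R : Γ → ℂ → Prop} {X Y Z : Γ → E}
  {N : E → E → Prop} {T T₁ : Finset (E × E)} {m : ℕ → Γ}

/-- The rows whose first entry is divisible by `ϖ ^ k` relative to the largest entry. -/
def small (X Y Z : Γ → E) (k : ℕ) : Set Γ :=
  {g | valuation E (X g) ≤ unifVal E ^ k * rowVal (X g) (Y g) (Z g)}

/-- The rows whose last entry is a largest one. -/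
def big (X Y Z : Γ → E) : Set Γ := {g | ¬ valuation E (Z g) < rowVal (X g) (Y g) (Z g)}

theorem mem_big_iff {g : Γ} : g ∈ big X Y Z ↔ valuation E (Z g) = rowVal (X g) (Y g) (Z g) := by
  have h : valuation E (Z g) ≤ rowVal (X g) (Y g) (Z g) :=
    (le_max_right _ _).trans (le_max_right _ _)
  exact ⟨fun hg => le_antisymm h (not_lt.mp hg), fun hg => not_lt.mpr hg.ge⟩

theorem small_subset_big (M : RowModel c δ K R X Y Z N T T₁ m) (hq : QuadFacts c δ) {k : ℕ}
    (hk : k ≠ 0) {g : Γ} (hg : g ∈ small X Y Z k) : g ∈ big X Y Z :=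
  mem_big_iff.mpr (M.val_lst_of_lt hq (lt_of_le_of_lt hg
    (mul_lt_of_lt_one_left (M.lev_pos g) (pow_lt_one₀ zero_le (unifVal_lt_one E) hk))))

theorem smooth_lev (M : RowModel c δ K R X Y Z N T T₁ m) (k : ℕ) :
    ∃ U ∈ 𝓝 (1 : Γ), ∀ u ∈ U, ∀ g,
      valuation E (X (g * u) - X g) ≤ unifVal E ^ k * rowVal (X g) (Y g) (Z g) ∧
      valuation E (Z (g * u) - Z g) < rowVal (X g) (Y g) (Z g) ∧
      rowVal (X (g * u)) (Y (g * u)) (Z (g * u)) = rowVal (X g) (Y g) (Z g) := by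
  obtain ⟨U, hU, h⟩ := M.smooth (k + 1)
  refine ⟨U, hU, fun u hu g => ?_⟩
  obtain ⟨h1, h2, h3⟩ := h u hu g
  have hL := M.lev_pos g
  have hlt : unifVal E ^ (k + 1) * rowVal (X g) (Y g) (Z g) < rowVal (X g) (Y g) (Z g) :=
    mul_lt_of_lt_one_left hL (pow_lt_one₀ zero_le (unifVal_lt_one E) k.succ_ne_zero)
  refine ⟨h1.trans (mul_le_mul' ?_ le_rfl), h3.trans_lt hlt, rowVal_eq_of_close
    (h1.trans_lt hlt) (h2.trans_lt hlt) (h3.trans_lt hlt)⟩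
  exact pow_le_pow_of_le_one zero_le (unifVal_lt_one E).le k.le_succ

theorem small_left (M : RowModel c δ K R X Y Z N T T₁ m) (k : ℕ) (b : Γ) (z : ℂ) (hb : R b z)
    (g : Γ) : b * g ∈ small X Y Z k ↔ g ∈ small X Y Z k := by
  obtain ⟨u, hu, h⟩ := M.equivariant b z hb
  obtain ⟨h1, h2, h3⟩ := h g
  have hu' : 0 < valuation E u := zero_lt_iff.mpr (by simpa using hu)
  simp only [small, Set.mem_ofPred_eq]
  rw [h1, h2, h3, rowVal_mul, map_mul, mul_left_comm, mul_le_mul_iff_right₀ hu']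

theorem small_right (M : RowModel c δ K R X Y Z N T T₁ m) (k : ℕ) :
    ∃ U ∈ 𝓝 (1 : Γ), ∀ u ∈ U, ∀ g, g * u ∈ small X Y Z k ↔ g ∈ small X Y Z k := by
  obtain ⟨U, hU, h⟩ := M.smooth_lev k
  refine ⟨U, hU, fun u hu g => ?_⟩
  obtain ⟨h1, -, h3⟩ := h u hu g
  simp only [small, Set.mem_ofPred_eq]
  rw [h3]
  exact val_le_iff_of_sub_le h1

theorem big_left (M : RowModel c δ K R X Y Z N T T₁ m) (b : Γ) (z : ℂ) (hb : R b z)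
    (g : Γ) : b * g ∈ big X Y Z ↔ g ∈ big X Y Z := by
  obtain ⟨u, hu, h⟩ := M.equivariant b z hb
  obtain ⟨h1, h2, h3⟩ := h g
  have hu' : 0 < valuation E u := zero_lt_iff.mpr (by simpa using hu)
  simp only [big, Set.mem_ofPred_eq]
  rw [h1, h2, h3, rowVal_mul, map_mul, mul_lt_mul_iff_right₀ hu']

theorem big_right (M : RowModel c δ K R X Y Z N T T₁ m) :
    ∃ U ∈ 𝓝 (1 : Γ), ∀ u ∈ U, ∀ g, g * u ∈ big X Y Z ↔ g ∈ big X Y Z := by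
  obtain ⟨U, hU, h⟩ := M.smooth_lev 0
  refine ⟨U, hU, fun u hu g => ?_⟩
  obtain ⟨-, h2, h3⟩ := h u hu g
  simp only [big, Set.mem_ofPred_eq]
  rw [h3, not_iff_not]
  exact val_lt_iff_of_sub_lt h2

variable [IsTopologicalGroup Γ]

/-- The translates of the set `small (2 * l + 2)` by representatives of integral unipotent elements
tile a set `S`: a functional invariant under `K` gives each of them the same mass. -/
theorem card_mul_mass (M : RowModel c δ K R X Y Z N T T₁ m) (hq : QuadFacts c δ)
    {ℓ : inducedSpace R →ₗ[ℂ] ℂ} (hℓ : ∀ κ ∈ K, ∀ f, ℓ (rightRep R κ f) = ℓ f)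
    {f : inducedSpace R} (hf : ∀ g g', rowVal (X g) (Y g) (Z g) = rowVal (X g') (Y g') (Z g') →
      f.1 g = f.1 g') {W : Finset (E × E)}
    (hW : ∀ t ∈ W, N t.1 t.2 ∧ valuation E t.1 ≤ 1 ∧ valuation E t.2 ≤ 1) (l : ℕ) (S : Set Γ)
    (fS fk : inducedSpace R) (hfS : fS.1 = S.indicator f.1)
    (hfk : fk.1 = (small X Y Z (2 * l + 2)).indicator f.1) (hS : S ⊆ big X Y Z)
    (huniq : ∀ g ∈ S, ∃! t, t ∈ W ∧ valuation E (X g / Z g / (unif E * c (unif E)) ^ l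
      + δ * c t.2 * (Y g / Z g / (unif E : E) ^ l) + t.1) ≤ unifVal E ^ 2)
    (hnone : ∀ g ∈ big X Y Z, g ∉ S → ∀ t ∈ W, ¬ valuation E (X g / Z g / (unif E * c (unif E)) ^ l
      + δ * c t.2 * (Y g / Z g / (unif E : E) ^ l) + t.1) ≤ unifVal E ^ 2) :
    ℓ fS = W.card * ℓ fk := by
  classical
  have hπ0 : (unif E : E) ≠ 0 := Units.ne_zero _
  have hcπ0 := hq.conj_ne_zero hπ0
  have hvν : valuation E ((unif E * c (unif E) : E) ^ l) = unifVal E ^ (2 * l) := by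
    rw [map_pow, map_mul, hq.val_conj, pow_mul, pow_two]; rfl
  have hvπ : valuation E ((unif E : E) ^ l) = unifVal E ^ l := map_pow _ _ _
  have hple : ∀ n : ℕ, unifVal E ^ n ≤ 1 := fun n => pow_le_one₀ zero_le (unifVal_lt_one E).le
  have hel : ∀ t ∈ W, ∃ κ ∈ K, ∀ g, X (g * κ) = X g + δ * c ((unif E : E) ^ l * t.2) * Y g
      + (unif E * c (unif E)) ^ l * t.1 * Z g ∧ Y (g * κ) = Y g + (unif E : E) ^ l * t.2 * Z g ∧
      Z (g * κ) = Z g := by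
    intro t ht
    obtain ⟨h1, h2, h3⟩ := hW t ht
    refine M.unipotent _ _ (M.scale_up l _ _ h1) ?_ ?_
    · rw [map_mul, hvν]; exact mul_le_one' (hple _) h2
    · rw [map_mul, hvπ]; exact mul_le_one' (hple _) h3
  choose! κ hκK hκ using hel
  have hlev : ∀ t ∈ W, ∀ g, rowVal (X (g * κ t)) (Y (g * κ t)) (Z (g * κ t))
      = rowVal (X g) (Y g) (Z g) := by
    intro t ht g
    obtain ⟨h1, h2, h3⟩ := hW t ht
    obtain ⟨e1, e2, e3⟩ := hκ t ht g
    rw [e1, e2, e3]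
    apply rowVal_unipotent hq
    · rw [map_mul, hvν]; exact mul_le_one' (hple _) h2
    · rw [map_mul, hvπ]; exact mul_le_one' (hple _) h3
  have hmem_big : ∀ t ∈ W, ∀ g, g * κ t ∈ big X Y Z ↔ g ∈ big X Y Z := by
    intro t ht g
    rw [mem_big_iff, mem_big_iff, hlev t ht g, (hκ t ht g).2.2]
  have hmem : ∀ t ∈ W, ∀ g ∈ big X Y Z, (g * κ t ∈ small X Y Z (2 * l + 2) ↔
      valuation E (X g / Z g / (unif E * c (unif E)) ^ l
        + δ * c t.2 * (Y g / Z g / (unif E : E) ^ l) + t.1) ≤ unifVal E ^ 2) := by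
    intro t ht g hg
    rw [mem_big_iff] at hg
    have hZ0 := M.lst_ne_zero hg
    have e : X (g * κ t) / Z g = (unif E * c (unif E)) ^ l * (X g / Z g / (unif E * c (unif E)) ^ l
        + δ * c t.2 * (Y g / Z g / (unif E : E) ^ l) + t.1) := by
      rw [(hκ t ht g).1, map_mul, map_pow, mul_pow]
      field_simp
    simp only [small, Set.mem_ofPred_eq]
    rw [hlev t ht g, ← M.div_le_iff hg, e, map_mul, hvν, pow_add,
      mul_le_mul_iff_right₀ (pow_pos (unifVal_pos E) _)]
  have hsum : fS = ∑ t ∈ W, rightRep R (κ t) fk := by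
    apply Subtype.ext
    funext g
    have e1 : ((∑ t ∈ W, rightRep R (κ t) fk : inducedSpace R) : Γ → ℂ) g
        = ∑ t ∈ W, fk.1 (g * κ t) := by
      rw [AddSubmonoidClass.coe_finsetSum, Finset.sum_apply]; rfl
    rw [e1, hfS, hfk]
    have e2 : ∀ t ∈ W, (small X Y Z (2 * l + 2)).indicator f.1 (g * κ t)
        = if g * κ t ∈ small X Y Z (2 * l + 2) then f.1 g else 0 := by
      intro t ht
      rw [Set.indicator_apply, hf _ _ (hlev t ht g)]
    rw [Finset.sum_congr rfl e2]
    by_cases hg : g ∈ S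
    · obtain ⟨t, ⟨ht, hxt⟩, hu⟩ := huniq g hg
      rw [Set.indicator_of_mem hg, Finset.sum_eq_single t]
      · rw [if_pos ((hmem t ht g (hS hg)).mpr hxt)]
      · intro t' ht' hne
        rw [if_neg]
        exact fun h => hne (hu t' ⟨ht', (hmem t' ht' g (hS hg)).mp h⟩)
      · exact fun h => absurd ht h
    · rw [Set.indicator_of_notMem hg, Finset.sum_eq_zero]
      intro t ht
      rw [if_neg]
      intro h
      have hgb := (hmem_big t ht g).mp (M.small_subset_big hq (by omega) h)
      exact hnone g hgb hg t ht ((hmem t ht g hgb).mp h)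
  rw [hsum, map_sum, Finset.sum_congr rfl (fun t ht => hℓ (κ t) (hκK t ht) fk), Finset.sum_const,
    nsmul_eq_mul]

/-- The values of an invariant functional on the translates of a spherical vector satisfy a second
order recurrence. -/
theorem spherical_rec (M : RowModel c δ K R X Y Z N T T₁ m) (hq : QuadFacts c δ)
    {ℓ : inducedSpace R →ₗ[ℂ] ℂ} (hℓ : ∀ κ ∈ K, ∀ f, ℓ (rightRep R κ f) = ℓ f)
    {f : inducedSpace R} (hℓf : ℓ f = 1) {a b : ℂ} (hb : b ≠ 0)
    (hf : ∀ (g : Γ) (j : ℤ), rowVal (X g) (Y g) (Z g) = unifVal E ^ j → f.1 g = a * b ^ (-j))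
    (hT : (T.card : ℂ) ≠ 0) :
    ℓ (rightRep R (m 0) f) = 1 ∧
    ((T.card : ℂ) + T₁.card) * (ℓ (rightRep R (m 1) f) - b) = (1 - b) * (T₁.card + b⁻¹) ∧
    ∀ n, T.card * ℓ (rightRep R (m (n + 2)) f) + ℓ (rightRep R (m n) f)
      = (T.card * b + b⁻¹) * ℓ (rightRep R (m (n + 1)) f) := by
  classical
  have hf' : ∀ g g', rowVal (X g) (Y g) (Z g) = rowVal (X g') (Y g') (Z g') → f.1 g = f.1 g' := by
    intro g g' h
    obtain ⟨j, hj⟩ := exists_rowVal_eq (M.ne_zero g)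
    rw [hf g j hj, hf g' j (h ▸ hj)]
  let e : inducedSpace R := cutoff f (big X Y Z) M.big_left M.big_right
  let fk : ℕ → inducedSpace R := fun k =>
    cutoff f (small X Y Z k) (M.small_left k) (M.small_right k)
  have hfk : ∀ k g, (fk k).1 g = if g ∈ small X Y Z k then f.1 g else 0 := fun k g =>
    Set.indicator_apply _ _ _
  have hple : ∀ n : ℕ, unifVal E ^ n ≤ 1 := fun n => pow_le_one₀ zero_le (unifVal_lt_one E).le
  have hp0 := unifVal_ne_zero E
  have hvν : ∀ l : ℕ, valuation E ((unif E * c (unif E) : E) ^ l) = unifVal E ^ (2 * l) := by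
    intro l; rw [map_pow, map_mul, hq.val_conj, pow_mul, pow_two]; rfl
  have hδ := hq.val_delta_le_one
  -- dividing the first entry by a power of the norm of `ϖ`
  have hdiv : ∀ (l j : ℕ), ∀ g ∈ big X Y Z,
      (valuation E (X g / Z g / (unif E * c (unif E)) ^ l) ≤ unifVal E ^ j ↔
        g ∈ small X Y Z (2 * l + j)) := by
    intro l j g hg
    rw [mem_big_iff] at hg
    rw [map_div₀, hvν, div_le_iff₀ (pow_pos (unifVal_pos E) _), ← pow_add, M.div_le_iff hg,
      add_comm j]
    rfl
  have hN : ∀ (l : ℕ), ∀ g ∈ big X Y Z, N (X g / Z g / (unif E * c (unif E)) ^ l)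
      (Y g / Z g / (unif E : E) ^ l) := fun l g hg =>
    M.scale_down l _ _ (M.div_mem g (M.lst_ne_zero (mem_big_iff.mp hg)))
  -- a pair whose product with an integral one is integral is itself integral
  have hback : ∀ x y s r : E, N x y → N s r → valuation E r ≤ 1 →
      valuation E (x + δ * c r * y + s) ≤ unifVal E ^ 2 → valuation E y ≤ 1 := by
    intro x y s r hxy hsr hr h
    have h1 := hq.val_snd_le_one (hq.heis_mul (M.heis _ _ hxy) (M.heis _ _ hsr))
      (h.trans (hple 2))
    have e : y = (y + r) - r := by ring
    rw [e]; exact (Valuation.map_sub _ _ _).trans (max_le h1 hr)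
  have hback' : ∀ (x y s r : E) (γ : ValueGroupWithZero E), unifVal E ^ 2 ≤ γ →
      valuation E s ≤ γ → valuation E (δ * c r * y) ≤ γ →
      valuation E (x + δ * c r * y + s) ≤ unifVal E ^ 2 → valuation E x ≤ γ := by
    intro x y s r γ hγ hs hm h
    have e : x = (x + δ * c r * y + s) - s - δ * c r * y := by ring
    rw [e]
    exact (Valuation.map_sub _ _ _).trans (max_le ((Valuation.map_sub _ _ _).trans
      (max_le (h.trans hγ) hs)) hm)
  have hT' : ∀ x y, N x y → ∀ t ∈ T, valuation E (x + δ * c t.2 * y + t.1) ≤ unifVal E ^ 2 →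
      valuation E x ≤ 1 := by
    intro x y hxy t ht h
    obtain ⟨h1, h2, h3⟩ := M.reps_mem t ht
    refine hback' _ _ _ _ 1 (hple 2) h2 ?_ h
    rw [map_mul, map_mul, hq.val_conj]
    exact mul_le_one' (mul_le_one' hδ h3) (hback _ _ _ _ hxy h1 h3 h)
  have hT₁' : ∀ x y, N x y → ∀ t ∈ T₁, valuation E (x + δ * c t.2 * y + t.1) ≤ unifVal E ^ 2 →
      valuation E x ≤ unifVal E := by
    intro x y hxy t ht h
    obtain ⟨h1, h2, h3, h4⟩ := M.reps'_mem t ht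
    refine hback' _ _ _ _ _ ?_ h2 (h4 _ (hback _ _ _ _ hxy h1 h3 h)) h
    rw [pow_two]; exact mul_le_of_le_one_right' (unifVal_lt_one E).le
  have hsb : ∀ {k : ℕ}, k ≠ 0 → small X Y Z k ⊆ big X Y Z := fun hk g hg =>
    M.small_subset_big hq hk hg
  -- the Weyl element exchanges the rows outside `big` with those in `small 1`
  have hmass1 : (1 : ℂ) = ℓ e + ℓ (fk 1) := by
    obtain ⟨κ, hκK, hκ⟩ := M.weyl
    have hsplit : f = e + rightRep R κ (fk 1) := by
      apply Subtype.ext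
      funext g
      change f.1 g = (big X Y Z).indicator f.1 g + (fk 1).1 (g * κ)
      obtain ⟨e1, e2, e3⟩ := hκ g
      have hlev : rowVal (X (g * κ)) (Y (g * κ)) (Z (g * κ)) = rowVal (X g) (Y g) (Z g) := by
        rw [e1, e2, e3]
        simp only [rowVal, Valuation.map_neg]
        rw [max_left_comm, max_comm, max_assoc, max_comm (valuation E (Y g))]
        rw [max_left_comm, max_comm (valuation E (Z g))]
      have hmem : g * κ ∈ small X Y Z 1 ↔ g ∉ big X Y Z := by
        obtain ⟨j, hj⟩ := exists_rowVal_eq (M.ne_zero g)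
        simp only [small, big, Set.mem_ofPred_eq, not_not]
        rw [hlev, e1, hj, val_lt_zpow_iff, zpow_add_one₀ hp0, pow_one, mul_comm]
      rw [hfk, Set.indicator_apply, hf' _ _ hlev]
      by_cases hg : g ∈ big X Y Z
      · rw [if_pos hg, if_neg (fun h => hmem.mp h hg), add_zero]
      · rw [if_neg hg, if_pos (hmem.mpr hg), zero_add]
    rw [← hℓf, ← hℓ κ hκK (fk 1), ← map_add, ← hsplit]
  have hmass2 : ℓ e = T.card * ℓ (fk 2) := by
    refine M.card_mul_mass hq hℓ hf' M.reps_mem 0 (big X Y Z) e (fk 2) rfl rfl le_rfl ?_ ?_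
    · intro g hg
      refine M.reps_uniq _ _ (hN 0 g hg) ?_
      rw [pow_zero, div_one, M.div_le_iff (mem_big_iff.mp hg), one_mul]
      exact le_max_left _ _
    · exact fun g hg hg' => absurd hg hg'
  have hodd : ∀ l, ℓ (fk (2 * l + 1)) = T₁.card * ℓ (fk (2 * l + 2)) := by
    intro l
    refine M.card_mul_mass hq hℓ hf' (fun t ht => ?_) l _ (fk (2 * l + 1)) (fk (2 * l + 2)) rfl rfl
      (hsb (by omega)) ?_ ?_
    · obtain ⟨h1, h2, h3, -⟩ := M.reps'_mem t ht
      exact ⟨h1, h2.trans (unifVal_lt_one E).le, h3⟩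
    · intro g hg
      have hgb := hsb (by omega) hg
      refine M.reps'_uniq _ _ (hN l g hgb) ?_
      simpa using (hdiv l 1 g hgb).mpr hg
    · intro g hgb hg t ht h
      refine hg ((hdiv l 1 g hgb).mp ?_)
      simpa using hT₁' _ _ (hN l g hgb) t ht h
  have heven : ∀ l, ℓ (fk (2 * l + 2)) = T.card * ℓ (fk (2 * l + 4)) := by
    intro l
    refine M.card_mul_mass hq hℓ hf' M.reps_mem (l + 1) _ (fk (2 * l + 2)) (fk (2 * l + 4)) rfl rfl
      (hsb (by omega)) ?_ ?_
    · intro g hg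
      have hgb := hsb (by omega) hg
      refine M.reps_uniq _ _ (hN (l + 1) g hgb) ?_
      simpa using (hdiv (l + 1) 0 g hgb).mpr hg
    · intro g hgb hg t ht h
      refine hg ((hdiv (l + 1) 0 g hgb).mp ?_)
      simpa using hT' _ _ (hN (l + 1) g hgb) t ht h
  -- the values of the translates of the spherical vector
  have hval1 : ∀ (n : ℕ) (g : Γ) (k : ℕ), k ≤ 2 * n →
      valuation E (X g) = unifVal E ^ k * rowVal (X g) (Y g) (Z g) →
      f.1 (g * m n) = f.1 g * b ^ ((n : ℤ) - k) := by
    intro n g k hk h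
    obtain ⟨j, hj⟩ := exists_rowVal_eq (M.ne_zero g)
    have h1 := M.torus_lev_of_le hq hk h
    rw [hj, ← zpow_add₀ hp0] at h1
    rw [hf g j hj, hf _ _ h1, mul_assoc, ← zpow_add₀ hb]
    congr 2; ring
  have hval2 : ∀ (n : ℕ), ∀ g ∈ small X Y Z (2 * n), f.1 (g * m n) = f.1 g * b ^ (-(n : ℤ)) := by
    intro n g h
    rcases lt_or_eq_of_le (show valuation E (X g) ≤ _ from h) with h | h
    · obtain ⟨j, hj⟩ := exists_rowVal_eq (M.ne_zero g)
      have h1 := M.torus_lev_of_lt hq h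
      rw [hj, ← zpow_natCast, ← zpow_add₀ hp0] at h1
      rw [hf g j hj, hf _ _ h1, mul_assoc, ← zpow_add₀ hb]
      congr 2; ring
    · rw [hval1 n g (2 * n) le_rfl h]
      congr 2; push_cast; ring
  have hmono : ∀ {k k' : ℕ}, k ≤ k' → small X Y Z k' ⊆ small X Y Z k := fun hk g hg =>
    (show valuation E (X g) ≤ _ from hg).trans
      (mul_le_mul' (pow_le_pow_of_le_one zero_le (unifVal_lt_one E).le hk) le_rfl)
  have hφ0 : ℓ (rightRep R (m 0) f) = 1 := by
    have : rightRep R (m 0) f = f := by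
      apply Subtype.ext
      funext g
      change f.1 (g * m 0) = f.1 g
      rw [hval2 0 g]
      · simp
      · simp only [small, Set.mem_ofPred_eq, mul_zero, pow_zero, one_mul]; exact le_max_left _ _
    rw [this, hℓf]
  refine ⟨hφ0, rankOne_rec (P := fun k => ℓ (fk k)) (φ := fun n => ℓ (rightRep R (m n) f))
    hb hT hmass1 hmass2 hodd heven hφ0 fun n => ?_⟩
  -- replacing `m n` by `m (n + 1)` multiplies the value at `g` by `b`, unless the first entry of the
  -- row of `g` is divisible by `ϖ ^ (2 * n + 1)`
  have hstep : rightRep R (m (n + 1)) f = b • rightRep R (m n) f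
      + ((1 - b) * b⁻¹ ^ n) • (fk (2 * n + 1) + b⁻¹ • fk (2 * n + 2)) := by
    apply Subtype.ext
    funext g
    change f.1 (g * m (n + 1)) = b * f.1 (g * m n)
      + ((1 - b) * b⁻¹ ^ n) * ((fk (2 * n + 1)).1 g + b⁻¹ * (fk (2 * n + 2)).1 g)
    rw [hfk, hfk]
    have hbz : ∀ k : ℕ, b ^ (-(k : ℤ)) = b⁻¹ ^ k := by
      intro k; rw [zpow_neg, zpow_natCast, inv_pow]
    by_cases h2 : g ∈ small X Y Z (2 * n + 2)
    · rw [if_pos h2, if_pos (hmono (by omega) h2), hval2 n g (hmono (by omega) h2),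
        hval2 (n + 1) g h2, hbz, hbz, pow_succ]
      field_simp
      ring
    rw [if_neg h2]
    obtain ⟨j, hj⟩ := exists_rowVal_eq (M.ne_zero g)
    have hX0 : X g ≠ 0 := by
      intro h0
      apply h2
      simp only [small, Set.mem_ofPred_eq]
      rw [h0, map_zero]; exact zero_le
    obtain ⟨i, hi⟩ := exists_val_eq_zpow hX0
    have hiL : valuation E (X g) ≤ rowVal (X g) (Y g) (Z g) := le_max_left _ _
    rw [hi, hj, unifVal_zpow_le_iff] at hiL
    obtain ⟨k, hk⟩ : ∃ k : ℕ, i = k + j := ⟨(i - j).toNat, by omega⟩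
    have hXk : valuation E (X g) = unifVal E ^ k * rowVal (X g) (Y g) (Z g) := by
      rw [hi, hj, hk, zpow_add₀ hp0, zpow_natCast]
    have hmem : ∀ k', g ∈ small X Y Z k' ↔ k' ≤ k := by
      intro k'
      simp only [small, Set.mem_ofPred_eq]
      rw [hi, hj, ← zpow_natCast, ← zpow_add₀ hp0, unifVal_zpow_le_iff]
      omega
    rw [hmem] at h2 ⊢
    rw [hval1 (n + 1) g k (by omega) hXk]
    by_cases h1 : 2 * n + 1 ≤ k
    · obtain rfl : k = 2 * n + 1 := by omega
      rw [if_pos le_rfl, hval2 n g ((hmem _).mpr (by omega)),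
        show ((n + 1 : ℕ) : ℤ) - ((2 * n + 1 : ℕ) : ℤ) = -(n : ℤ) by push_cast; ring, hbz]
      ring
    · rw [if_neg h1, hval1 n g k (by omega) hXk,
        show ((n + 1 : ℕ) : ℤ) - (k : ℤ) = ((n : ℤ) - k) + 1 by push_cast; ring,
        zpow_add_one₀ hb]
      ring
  rw [hstep]
  simp only [map_add, map_smul, smul_eq_mul]

end RowModel

end Spherical

section Coefficients

variable {F E : Type*} [Field F] [ValuativeRel F] [TopologicalSpace F]
  [IsNonarchimedeanLocalField F] [Field E] [ValuativeRel E] [TopologicalSpace E]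
  [IsNonarchimedeanLocalField E] [Algebra F E] [ValuativeExtension F E]
  {Γ : Type*} [Group Γ] [TopologicalSpace Γ]

namespace RowModel

variable {c : E ≃ₐ[F] E} {δ : E} {K : Subgroup Γ} {R : Γ → ℂ → Prop} {X Y Z : Γ → E}
  {N : E → E → Prop} {T T₁ : Finset (E × E)} {m : ℕ → Γ}

/-- The Iwasawa decomposition: `K` moves every row to a multiple of `(0, 0, 1)`. -/
theorem exists_iwasawa (M : RowModel c δ K R X Y Z N T T₁ m) (hq : QuadFacts c δ) (g : Γ) :
    ∃ κ ∈ K, X (g * κ) = 0 ∧ Y (g * κ) = 0 ∧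
      valuation E (Z (g * κ)) = rowVal (X g) (Y g) (Z g) := by
  have key : ∀ g, g ∈ big X Y Z → ∃ κ ∈ K, X (g * κ) = 0 ∧ Y (g * κ) = 0 ∧
      valuation E (Z (g * κ)) = rowVal (X g) (Y g) (Z g) := by
    intro g hg
    rw [mem_big_iff] at hg
    have hZ0 := M.lst_ne_zero hg
    have hN := M.div_mem g hZ0
    have hx : valuation E (X g / Z g) ≤ 1 := by
      rw [M.div_le_iff hg, one_mul]; exact le_max_left _ _
    have hy : valuation E (Y g / Z g) ≤ 1 := by
      rw [M.div_le_iff hg, one_mul]; exact (le_max_left _ _).trans (le_max_right _ _)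
    obtain ⟨κ, hκ, h⟩ := M.unipotent _ _ (M.inv_mem _ _ hN) (by
      refine (Valuation.map_add _ _ _).trans (max_le (by rwa [Valuation.map_neg]) ?_)
      rw [map_mul, map_mul, hq.val_conj]
      exact mul_le_one' (mul_le_one' hq.val_delta_le_one hy) hy) (by rwa [Valuation.map_neg])
    obtain ⟨h1, h2, h3⟩ := h g
    refine ⟨κ, hκ, ?_, ?_, ?_⟩
    · rw [h1, map_neg]; field_simp; ring
    · rw [h2]; field_simp; ring
    · rw [h3, hg]
  by_cases hg : g ∈ big X Y Z
  · exact key g hg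
  · obtain ⟨w, hw, h⟩ := M.weyl
    obtain ⟨h1, h2, h3⟩ := h g
    have hX := M.val_fst_of_lt hq (not_not.mp hg)
    have hlev : rowVal (X (g * w)) (Y (g * w)) (Z (g * w)) = rowVal (X g) (Y g) (Z g) := by
      rw [h1, h2, h3]
      simp only [rowVal, Valuation.map_neg]
      rw [max_left_comm, max_comm, max_assoc, max_comm (valuation E (Y g))]
      rw [max_left_comm, max_comm (valuation E (Z g))]
    obtain ⟨κ, hκ, e1, e2, e3⟩ := key (g * w) (mem_big_iff.mpr (by
      rw [hlev, h3, Valuation.map_neg, hX]))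
    rw [mul_assoc] at e1 e2 e3
    exact ⟨w * κ, K.mul_mem hw hκ, e1, e2, e3.trans hlev⟩

/-- An element of an induced representation that is constant on a conjugate of `K` is invariant
under that conjugate. -/
theorem conj_invariant (M : RowModel c δ K R X Y Z N T T₁ m) (hq : QuadFacts c δ) {b : ℂ}
    (hup : ∀ g, X g = 0 → Y g = 0 → ∀ j : ℤ, valuation E (Z g) = unifVal E ^ j → R g (b ^ (-j)))
    {h₀ : Γ} {f : inducedSpace R} (hf : ∀ κ ∈ K, f.1 (h₀ * κ * h₀⁻¹) = 1) :
    ∀ κ ∈ K, ∀ g, f.1 (g * κ * h₀⁻¹) = f.1 (g * h₀⁻¹) := by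
  have hup' : ∀ g, X g = 0 → Y g = 0 → ∃ z, R g z := by
    intro g h1 h2
    have h3 : Z g ≠ 0 := by
      rcases M.ne_zero g with h | h | h
      · exact absurd h1 h
      · exact absurd h2 h
      · exact h
    obtain ⟨j, hj⟩ := exists_val_eq_zpow h3
    exact ⟨_, hup g h1 h2 j hj⟩
  obtain ⟨κ₀, hκ₀, e1, e2, -⟩ := M.exists_iwasawa hq h₀
  obtain ⟨z₀, hz₀⟩ := hup' _ e1 e2
  -- the inverse of an upper triangular element is upper triangular
  obtain ⟨z₁, hz₁⟩ : ∃ z, R (h₀ * κ₀)⁻¹ z := by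
    obtain ⟨u, hu, h⟩ := M.equivariant _ _ hz₀
    obtain ⟨h1, h2, -⟩ := h (h₀ * κ₀)⁻¹
    rw [mul_inv_cancel, M.base.1] at h1
    rw [mul_inv_cancel, M.base.2] at h2
    exact hup' _ ((mul_eq_zero.mp h1.symm).resolve_left hu)
      ((mul_eq_zero.mp h2.symm).resolve_left hu)
  -- `f` is given at `h₀ K h₀⁻¹` only; the Iwasawa decompositions of `g` and of `h₀` reach the rest
  have key : ∀ g, ∃ z, ∀ κ ∈ K, f.1 (g * κ * h₀⁻¹) = z := by
    intro g
    obtain ⟨κ₁, hκ₁, i1, i2, -⟩ := M.exists_iwasawa hq g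
    obtain ⟨z, hz⟩ := hup' _ i1 i2
    refine ⟨z * (z₁ * 1), fun κ hκ => ?_⟩
    have e : g * κ * h₀⁻¹ = (g * κ₁) * ((h₀ * κ₀)⁻¹ * (h₀ * (κ₀ * κ₁⁻¹ * κ) * h₀⁻¹)) := by group
    rw [e, f.2.1 _ z hz, f.2.1 _ z₁ hz₁,
      hf _ (K.mul_mem (K.mul_mem hκ₀ (K.inv_mem hκ₁)) hκ)]
  intro κ hκ g
  obtain ⟨z, hz⟩ := key g
  have h1 := hz 1 K.one_mem
  rw [mul_one] at h1
  rw [hz κ hκ, h1]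

/-- A vector invariant under `K` depends only on the level of the bottom row. -/
theorem value_eq (M : RowModel c δ K R X Y Z N T T₁ m) (hq : QuadFacts c δ) {b : ℂ}
    (hup : ∀ g, X g = 0 → Y g = 0 → ∀ j : ℤ, valuation E (Z g) = unifVal E ^ j → R g (b ^ (-j)))
    {f : inducedSpace R} (hf : ∀ κ ∈ K, ∀ g, f.1 (g * κ) = f.1 g) (g : Γ) (j : ℤ)
    (hj : rowVal (X g) (Y g) (Z g) = unifVal E ^ j) : f.1 g = f.1 1 * b ^ (-j) := by
  obtain ⟨κ, hκ, e1, e2, e3⟩ := M.exists_iwasawa hq g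
  rw [← hf κ hκ g, ← mul_one (g * κ), f.2.1 _ _ (hup _ e1 e2 j (e3.trans hj)), mul_comm]

variable [IsTopologicalGroup Γ]

/-- The spherical matrix coefficient of a principal series, for a conjugate of `K`. -/
theorem exists_spherical {R' : Γ → ℂ → Prop} {m' : ℕ → Γ} (M : RowModel c δ K R X Y Z N T T₁ m)
    (M' : RowModel c δ K R' X Y Z N T T₁ m') (hq : QuadFacts c δ) {b b' : ℂ} (hb : b ≠ 0)
    (hup : ∀ g, X g = 0 → Y g = 0 → ∀ j : ℤ, valuation E (Z g) = unifVal E ^ j → R g (b ^ (-j)))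
    (hup' : ∀ g, X g = 0 → Y g = 0 → ∀ j : ℤ, valuation E (Z g) = unifVal E ^ j → R' g (b' ^ (-j)))
    {h₀ : Γ} {f : inducedSpace R} {f₁ : inducedSpace R'}
    (hf : ∀ κ ∈ K, f.1 (h₀ * κ * h₀⁻¹) = 1) (hf₁ : ∀ κ ∈ K, f₁.1 (h₀ * κ * h₀⁻¹) = 1)
    {B : inducedSpace R →ₗ[ℂ] inducedSpace R' →ₗ[ℂ] ℂ} (hB : IsInvariantPairing B)
    (hB1 : B f f₁ = 1) (hT : (T.card : ℂ) ≠ 0) : ∃ φ : ℕ → ℂ, φ 0 = 1 ∧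
    ((T.card : ℂ) + T₁.card) * (φ 1 - b) = (1 - b) * (T₁.card + b⁻¹) ∧
    (∀ n, T.card * φ (n + 2) + φ n = (T.card * b + b⁻¹) * φ (n + 1)) ∧
    ∀ n, ∀ κ₁ ∈ K, ∀ κ₂ ∈ K, matCoeff B f f₁ (h₀ * (κ₁ * m n * κ₂) * h₀⁻¹) = φ n := by
  let fs : inducedSpace R := rightRep R h₀⁻¹ f
  let fs₁ : inducedSpace R' := rightRep R' h₀⁻¹ f₁
  have hfs : ∀ κ ∈ K, rightRep R κ fs = fs := fun κ hκ =>
    Subtype.ext (funext fun g => M.conj_invariant hq hup hf κ hκ g)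
  have hfs₁ : ∀ κ ∈ K, rightRep R' κ fs₁ = fs₁ := fun κ hκ =>
    Subtype.ext (funext fun g => M'.conj_invariant hq hup' hf₁ κ hκ g)
  let ℓ : inducedSpace R →ₗ[ℂ] ℂ := B.flip fs₁
  have hℓ : ∀ κ ∈ K, ∀ F, ℓ (rightRep R κ F) = ℓ F := by
    intro κ hκ F
    change B (rightRep R κ F) fs₁ = B F fs₁
    conv_lhs => rw [← hfs₁ κ hκ]
    exact hB κ F fs₁
  have hℓf : ℓ fs = 1 := (hB h₀⁻¹ f f₁).trans hB1
  obtain ⟨h0, h1, h2⟩ := M.spherical_rec hq hℓ hℓf (a := fs.1 1) hb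
    (M.value_eq hq hup fun κ hκ g => congrFun (congrArg Subtype.val (hfs κ hκ)) g) hT
  refine ⟨fun n => ℓ (rightRep R (m n) fs), h0, h1, h2, fun n κ₁ hκ₁ κ₂ hκ₂ => ?_⟩
  have e : matCoeff B f f₁ (h₀ * (κ₁ * m n * κ₂) * h₀⁻¹)
      = B (rightRep R h₀⁻¹ (rightRep R (h₀ * (κ₁ * m n * κ₂) * h₀⁻¹) f)) (rightRep R' h₀⁻¹ f₁) :=
    (hB h₀⁻¹ _ _).symm
  have e2 : rightRep R h₀⁻¹ (rightRep R (h₀ * (κ₁ * m n * κ₂) * h₀⁻¹) f)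
      = rightRep R κ₁ (rightRep R (m n) (rightRep R κ₂ fs)) := by
    simp only [fs, ← Module.End.mul_apply, ← map_mul]
    congr 2; group
  rw [e, e2, hfs κ₂ hκ₂]
  exact hℓ κ₁ hκ₁ _

end RowModel

end Coefficients

/-! ### Matrices in unitary groups -/

section UnitaryEntries

variable {F E : Type*} [Field F] [ValuativeRel F] [TopologicalSpace F]
  [IsNonarchimedeanLocalField F] [Field E] [ValuativeRel E] [TopologicalSpace E]
  [IsNonarchimedeanLocalField E] [Algebra F E] [ValuativeExtension F E]
  {n : Type*} [Fintype n] [DecidableEq n]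

/-- The entries of an element of a matrix group. -/
def entry {U : Subgroup (GL n E)} (g : U) (i j : n) : E := ((g : GL n E) : Matrix n n E) i j

theorem entry_mul {U : Subgroup (GL n E)} (g h : U) (i j : n) :
    entry (g * h) i j = ∑ k, entry g i k * entry h k j := Matrix.mul_apply

theorem entry_one {U : Subgroup (GL n E)} (i j : n) :
    entry (1 : U) i j = (1 : Matrix n n E) i j := rfl

theorem entry_ext {U : Subgroup (GL n E)} {g h : U} (H : ∀ i j, entry g i j = entry h i j) :
    g = h :=
  Subtype.ext (Units.ext (Matrix.ext H))

variable {c : E ≃ₐ[F] E} {T : Matrix n n E}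

theorem unitary_det (hT : T.det ≠ 0) {A : Matrix n n E} (h : (A.map c).transpose * T * A = T) :
    c A.det * A.det = 1 := by
  have h1 := congrArg Matrix.det h
  rw [Matrix.det_mul, Matrix.det_mul, Matrix.det_transpose] at h1
  have h2 : (A.map c).det = c A.det := (AlgEquiv.map_det c A).symm
  rw [h2] at h1
  apply mul_right_cancel₀ hT
  linear_combination h1

/-- The element of a unitary group given by a matrix that preserves the form. -/
def unitaryMk (A : Matrix n n E) (hT : T.det ≠ 0) (h : (A.map c).transpose * T * A = T) :
    unitaryGp c T :=
  ⟨Matrix.GeneralLinearGroup.mkOfDetNeZero A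
    (fun h0 => by have := unitary_det hT h; rw [h0, mul_zero] at this; exact zero_ne_one this), h⟩

/-- The rows of a unitary matrix are unitary for the inverse form. -/
theorem unitary_row {S : Matrix n n E} (hST : S * T = 1) (g : unitaryGp c T) :
    ((g : GL n E) : Matrix n n E) * S * (((g : GL n E) : Matrix n n E).map c).transpose = S := by
  have h1 : ((((g : GL n E) : Matrix n n E).map c).transpose * T) * ((g : GL n E) : Matrix n n E)
    = T := g.2
  have h2 : (S * (((g : GL n E) : Matrix n n E).map c).transpose * T)
      * ((g : GL n E) : Matrix n n E) = 1 := by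
    rw [← hST, Matrix.mul_assoc, Matrix.mul_assoc, ← Matrix.mul_assoc _ T, h1]
  have h3 := mul_eq_one_comm.mp h2
  have h4 := mul_eq_one_comm.mp hST
  calc _ = (((g : GL n E) : Matrix n n E) * (S * (((g : GL n E) : Matrix n n E).map c).transpose
        * T)) * S := by simp only [Matrix.mul_assoc, h4, Matrix.mul_one]
    _ = S := by rw [h3, Matrix.one_mul]

theorem mem_integralPts_iff (hc : ∀ x, valuation E (c x) = valuation E x) (hT : T.det ≠ 0)
    (g : unitaryGp c T) : g ∈ integralPts (unitaryGp c T) ↔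
      ∀ i j, valuation E (entry g i j) ≤ 1 := by
  rw [integralPts, Subgroup.mem_subgroupOf, MonoidHom.mem_range]
  constructor
  · rintro ⟨A, hA⟩ i j
    have : entry g i j = ((A : Matrix n n 𝒪[E]) i j : 𝒪[E]) := by
      unfold entry; rw [← hA]; rfl
    rw [this]
    exact ((A : Matrix n n 𝒪[E]) i j).2
  · intro h
    let A : Matrix n n 𝒪[E] := fun i j => ⟨entry g i j, h i j⟩
    have hA : A.map (algebraMap 𝒪[E] E) = ((g : GL n E) : Matrix n n E) := rfl
    have hdet : IsUnit A.det := by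
      rw [isUnit_integer_iff]
      have h1 : ((A.det : 𝒪[E]) : E) = ((g : GL n E) : Matrix n n E).det := by
        rw [← hA]; exact RingHom.map_det (algebraMap 𝒪[E] E) A
      have h2 := congrArg (valuation E) (unitary_det hT g.2)
      rw [map_mul, hc, map_one, ← pow_two] at h2
      rw [h1]
      exact (pow_eq_one_iff_of_nonneg zero_le two_ne_zero).mp h2
    refine ⟨Matrix.nonsingInvUnit A hdet, ?_⟩
    apply Units.ext
    exact hA

theorem val_sub_le_mem_nhds (a : E) {γ : ValueGroupWithZero E} (hγ : γ ≠ 0) :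
    {x | valuation E (x - a) ≤ γ} ∈ 𝓝 a := by
  rw [IsValuativeTopology.mem_nhds_iff]
  refine ⟨Units.mk0 γ hγ, ?_⟩
  rintro _ ⟨x, hx, rfl⟩
  simp only [Set.mem_ofPred_eq, Units.val_mk0, add_sub_cancel_left] at hx ⊢
  exact hx.le

theorem continuous_entry {U : Subgroup (GL n E)} (i j : n) :
    Continuous fun g : U => entry g i j := by
  have h : Continuous fun g : U => ((g : GL n E) : Matrix n n E) :=
    Units.continuous_val.comp continuous_subtype_val
  exact h.matrix_elem i j

theorem exists_nhds_one (U : Subgroup (GL n E)) (k : ℕ) : ∃ V ∈ 𝓝 (1 : U), ∀ u ∈ V, ∀ i j,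
    valuation E (entry u i j - (1 : Matrix n n E) i j) ≤ unifVal E ^ k := by
  refine ⟨⋂ i, ⋂ j, {u : U | valuation E (entry u i j - (1 : Matrix n n E) i j) ≤ unifVal E ^ k},
    ?_, fun u hu i j => Set.mem_iInter.mp (Set.mem_iInter.mp hu i) j⟩
  refine Filter.iInter_mem.mpr fun i => Filter.iInter_mem.mpr fun j => ?_
  exact (continuous_entry i j).continuousAt.preimage_mem_nhds
    (val_sub_le_mem_nhds _ (pow_ne_zero _ (unifVal_ne_zero E)))

/-- Right translation by an element close to `1` changes a row by little. -/
theorem val_row_sub_le {U : Subgroup (GL n E)} {u : U} {γ L : ValueGroupWithZero E}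
    (hu : ∀ i j, valuation E (entry u i j - (1 : Matrix n n E) i j) ≤ γ) (g : U) (i j : n)
    (hg : ∀ k, valuation E (entry g i k) ≤ L) :
    valuation E (entry (g * u) i j - entry g i j) ≤ γ * L := by
  have e : entry (g * u) i j - entry g i j
      = ∑ k, entry g i k * (entry u k j - (1 : Matrix n n E) k j) := by
    simp only [entry_mul, mul_sub, Finset.sum_sub_distrib]
    congr 1
    simp [Matrix.one_apply]
  rw [e]
  refine Valuation.map_sum_le _ fun k _ => ?_
  rw [map_mul, mul_comm]
  exact mul_le_mul' (hu k j) (hg k)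

end UnitaryEntries

/-! ### The two unitary groups -/

section Models

variable {F E : Type*} [Field F] [ValuativeRel F] [TopologicalSpace F]
  [IsNonarchimedeanLocalField F] [Field E] [ValuativeRel E] [TopologicalSpace E]
  [IsNonarchimedeanLocalField E] [Algebra F E] [ValuativeExtension F E]
  {c : E ≃ₐ[F] E} {δ : E}

theorem det_form2 (hδ : δ ≠ 0) : (form2 δ).det ≠ 0 := by
  rw [form2, Matrix.det_fin_two_of]; simpa using hδ

theorem det_form3 (hδ : δ ≠ 0) : (form3 δ).det ≠ 0 := by
  rw [form3, Matrix.det_fin_three]; simpa using hδ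

theorem mul2 {U : Subgroup (GL (Fin 2) E)} (g h : U) (i j : Fin 2) :
    entry (g * h) i j = entry g i 0 * entry h 0 j + entry g i 1 * entry h 1 j := by
  rw [entry_mul, Fin.sum_univ_two]

theorem mul3 {U : Subgroup (GL (Fin 3) E)} (g h : U) (i j : Fin 3) :
    entry (g * h) i j = entry g i 0 * entry h 0 j + entry g i 1 * entry h 1 j
      + entry g i 2 * entry h 2 j := by
  rw [entry_mul, Fin.sum_univ_three]

theorem row2 (hδ : δ ≠ 0) (g : U2 c δ) (i j : Fin 2) :
    entry g i 1 * c (entry g j 0) - entry g i 0 * c (entry g j 1)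
      = !![0, -1; 1, 0] i j := by
  have hS : (!![0, -δ⁻¹; δ⁻¹, 0] : Matrix (Fin 2) (Fin 2) E) * form2 δ = 1 := by
    ext i j
    fin_cases i <;> fin_cases j <;> simp [form2, Matrix.mul_apply, Fin.sum_univ_two, hδ]
  have h := congrFun (congrFun (unitary_row hS g) i) j
  simp only [Matrix.mul_apply, Fin.sum_univ_two, Matrix.transpose_apply, Matrix.map_apply] at h
  change (entry g i 0 * _ + entry g i 1 * _) * c (entry g j 0)
    + (entry g i 0 * _ + entry g i 1 * _) * c (entry g j 1) = _ at h
  apply mul_left_cancel₀ (inv_ne_zero hδ)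
  have e : δ⁻¹ * !![0, -1; 1, 0] i j = (!![0, -δ⁻¹; δ⁻¹, 0] : Matrix (Fin 2) (Fin 2) E) i j := by
    fin_cases i <;> fin_cases j <;> simp
  rw [e, ← h]
  simp
  ring

/-- The bottom row of an element of `U3` is isotropic for the inverse form. -/
theorem row3 (hδ : δ ≠ 0) (g : U3 c δ) : entry g 2 0 * c (entry g 2 2)
    - entry g 2 2 * c (entry g 2 0) = δ * (entry g 2 1 * c (entry g 2 1)) := by
  have hS : (!![0, 0, -δ⁻¹; 0, 1, 0; δ⁻¹, 0, 0] : Matrix (Fin 3) (Fin 3) E) * form3 δ = 1 := by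
    ext i j
    fin_cases i <;> fin_cases j <;> simp [form3, Matrix.mul_apply, Fin.sum_univ_three, hδ]
  have h := congrFun (congrFun (unitary_row hS g) 2) 2
  simp only [Matrix.mul_apply, Fin.sum_univ_three, Matrix.transpose_apply, Matrix.map_apply] at h
  change (entry g 2 0 * _ + entry g 2 1 * _ + entry g 2 2 * _) * c (entry g 2 0)
    + (entry g 2 0 * _ + entry g 2 1 * _ + entry g 2 2 * _) * c (entry g 2 1)
    + (entry g 2 0 * _ + entry g 2 1 * _ + entry g 2 2 * _) * c (entry g 2 2) = _ at h
  simp at h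
  field_simp at h
  linear_combination -h

/-- The condition for a `3 × 3` matrix to preserve the form. -/
theorem form3_iff (A : Matrix (Fin 3) (Fin 3) E) :
    (A.map c).transpose * form3 δ * A = form3 δ ↔ ∀ i j,
      c (A 0 i) * δ * A 2 j + c (A 1 i) * A 1 j - c (A 2 i) * δ * A 0 j = form3 δ i j := by
  rw [← Matrix.ext_iff]
  refine forall_congr' fun i => forall_congr' fun j => ?_
  have : ((A.map c).transpose * form3 δ * A) i j
      = c (A 0 i) * δ * A 2 j + c (A 1 i) * A 1 j - c (A 2 i) * δ * A 0 j := by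
    simp [Matrix.mul_apply, Fin.sum_univ_three, form3]; ring
  rw [this]

theorem form2_iff (A : Matrix (Fin 2) (Fin 2) E) :
    (A.map c).transpose * form2 δ * A = form2 δ ↔ ∀ i j,
      c (A 0 i) * δ * A 1 j - c (A 1 i) * δ * A 0 j = form2 δ i j := by
  rw [← Matrix.ext_iff]
  refine forall_congr' fun i => forall_congr' fun j => ?_
  have : ((A.map c).transpose * form2 δ * A) i j
      = c (A 0 i) * δ * A 1 j - c (A 1 i) * δ * A 0 j := by
    simp [Matrix.mul_apply, Fin.sum_univ_two, form2]; ring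
  rw [this]

theorem rel3 (g : U3 c δ) (i j : Fin 3) : c (entry g 0 i) * δ * entry g 2 j
    + c (entry g 1 i) * entry g 1 j - c (entry g 2 i) * δ * entry g 0 j = form3 δ i j :=
  (form3_iff _).mp g.2 i j

theorem rel2 (g : U2 c δ) (i j : Fin 2) : c (entry g 0 i) * δ * entry g 1 j
    - c (entry g 1 i) * δ * entry g 0 j = form2 δ i j :=
  (form2_iff _).mp g.2 i j

end Models

section Models

variable {F E : Type*} [Field F] [ValuativeRel F] [TopologicalSpace F]
  [IsNonarchimedeanLocalField F] [Field E] [ValuativeRel E] [TopologicalSpace E]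
  [IsNonarchimedeanLocalField E] [Algebra F E] [ValuativeExtension F E]
  {c : E ≃ₐ[F] E} {δ : E}

theorem entry_iota (h : U2 c δ) (i j : Fin 3) : entry (iota c δ h) i j
    = !![entry h 0 0, 0, entry h 0 1; 0, 1, 0; entry h 1 0, 0, entry h 1 1] i j := rfl

theorem smooth_row {n : Type*} [Fintype n] [DecidableEq n] (U : Subgroup (GL n E)) (k : ℕ) :
    ∃ V ∈ 𝓝 (1 : U), ∀ u ∈ V, ∀ (g : U) (i : n) (L : ValueGroupWithZero E),
      (∀ j, valuation E (entry g i j) ≤ L) →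
      ∀ j, valuation E (entry (g * u) i j - entry g i j) ≤ unifVal E ^ k * L := by
  obtain ⟨V, hV, h⟩ := exists_nhds_one U k
  exact ⟨V, hV, fun u hu g i L hL j => val_row_sub_le (h u hu) g i j hL⟩

variable (hq : QuadFacts c δ)

include hq

theorem bottom_ne_zero3 (g : U3 c δ) : entry g 2 0 ≠ 0 ∨ entry g 2 1 ≠ 0 ∨ entry g 2 2 ≠ 0 := by
  by_contra! h
  have h1 := unitary_det (det_form3 hq.delta_ne) g.2
  rw [Matrix.det_eq_zero_of_row_eq_zero (A := ((g : GL (Fin 3) E) : Matrix (Fin 3) (Fin 3) E)) 2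
    (fun j => by fin_cases j; exacts [h.1, h.2.1, h.2.2]), mul_zero] at h1
  exact zero_ne_one h1

theorem bottom_ne_zero2 (g : U2 c δ) : entry g 1 0 ≠ 0 ∨ entry g 1 1 ≠ 0 := by
  by_contra! h
  have h1 := unitary_det (det_form2 hq.delta_ne) g.2
  rw [Matrix.det_eq_zero_of_row_eq_zero (A := ((g : GL (Fin 2) E) : Matrix (Fin 2) (Fin 2) E)) 1
    (fun j => by fin_cases j; exacts [h.1, h.2]), mul_zero] at h1
  exact zero_ne_one h1

theorem exists_lower3 {s a : E} (h : s - c s = δ * (a * c a)) : ∃ κ : U3 c δ, ∀ i j,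
    entry κ i j = !![1, 0, 0; δ * c a, 1, 0; s, a, 1] i j := by
  refine ⟨unitaryMk !![1, 0, 0; δ * c a, 1, 0; s, a, 1] (det_form3 hq.delta_ne) ?_,
    fun i j => rfl⟩
  rw [form3_iff]
  intro i j
  fin_cases i <;> fin_cases j <;> simp [form3, hq.conj_conj, hq.conj_delta]
  · linear_combination δ * h
  · ring

theorem exists_weyl3 : ∃ κ : U3 c δ, ∀ i j, entry κ i j = !![0, 0, -1; 0, 1, 0; 1, 0, 0] i j := by
  refine ⟨unitaryMk !![0, 0, -1; 0, 1, 0; 1, 0, 0] (det_form3 hq.delta_ne) ?_, fun i j => rfl⟩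
  rw [form3_iff]
  intro i j
  fin_cases i <;> fin_cases j <;> simp [form3]

theorem exists_lower2 (s : F) : ∃ κ : U2 c δ, ∀ i j,
    entry κ i j = !![1, 0; algebraMap F E s, 1] i j := by
  refine ⟨unitaryMk !![1, 0; algebraMap F E s, 1] (det_form2 hq.delta_ne) ?_, fun i j => rfl⟩
  rw [form2_iff]
  intro i j
  fin_cases i <;> fin_cases j <;> simp [form2, mul_comm]

theorem exists_weyl2 : ∃ κ : U2 c δ, ∀ i j, entry κ i j = !![0, -1; 1, 0] i j := by
  refine ⟨unitaryMk !![0, -1; 1, 0] (det_form2 hq.delta_ne) ?_, fun i j => rfl⟩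
  rw [form2_iff]
  intro i j
  fin_cases i <;> fin_cases j <;> simp [form2]

theorem exists_diag2 {α : E} (hα : α ≠ 0) : ∃ κ : U2 c δ, ∀ i j,
    entry κ i j = !![α, 0; 0, (c α)⁻¹] i j := by
  have h0 := hq.conj_ne_zero hα
  refine ⟨unitaryMk !![α, 0; 0, (c α)⁻¹] (det_form2 hq.delta_ne) ?_, fun i j => rfl⟩
  rw [form2_iff]
  intro i j
  fin_cases i <;> fin_cases j <;> simp [form2, hq.conj_conj] <;> field_simp

/-- The torus element `diag(ϖ⁻ⁿ, (ϖᶜ)ⁿ)`. -/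
def torusElt (n : ℕ) : U2 c δ :=
  (exists_diag2 hq (pow_ne_zero n (inv_ne_zero (Units.ne_zero (unif E))))).choose

theorem entry_torusElt (n : ℕ) (i j : Fin 2) : entry (torusElt hq n) i j
    = !![(unif E : E)⁻¹ ^ n, 0; 0, c (unif E : E) ^ n] i j := by
  rw [torusElt, (exists_diag2 hq (pow_ne_zero n (inv_ne_zero
    (Units.ne_zero (unif E))))).choose_spec i j]
  simp

/-! ### The row model of the unitary group in three variables -/

theorem rowModel3 : ∃ T T₁ : Finset (E × E), T.card = resCard E ^ 2 ∧
    T₁.card = resCard F ∧ ∀ χ : Eˣ →* ℂˣ,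
    RowModel c δ (integralPts (U3 c δ)) (borelRel3 c δ χ) (fun g => entry g 2 0)
      (fun g => entry g 2 1) (fun g => entry g 2 2) (fun x y => x - c x = δ * (y * c y)) T T₁
      (fun n => iota c δ (torusElt hq n)) := by
  obtain ⟨T, hT, hTm, hTu⟩ := hq.exists_heis_reps
  obtain ⟨T₁, hT₁, hT₁m, hT₁u⟩ := hq.exists_heis_half_reps
  have hπ : (unif E : E) ≠ 0 := Units.ne_zero _
  have hcπ := hq.conj_ne_zero hπ
  have hdet := det_form3 hq.delta_ne
  refine ⟨T, T₁, hT, hT₁, fun χ => ?_⟩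
  refine
    { ne_zero := bottom_ne_zero3 hq
      isotropic := fun g => row3 hq.delta_ne g
      div_mem := fun g hg => ?_
      equivariant := ?_
      smooth := fun k => ?_
      unipotent := fun s a h hs ha => ?_
      weyl := ?_
      torus := fun n g => ?_
      heis := fun x y h => h
      scale_down := fun l x y h => ?_
      scale_up := fun l x y h => ?_
      inv_mem := fun x y h => ?_
      base := ⟨rfl, rfl⟩
      reps_mem := fun t ht => ⟨(hTm t ht).2.2, (hTm t ht).1, (hTm t ht).2.1⟩
      reps_uniq := fun x y h hx => hTu x y hx h
      reps'_mem := fun t ht =>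
        ⟨(hT₁m t ht).2.2.1, (hT₁m t ht).1, (hT₁m t ht).2.1, (hT₁m t ht).2.2.2⟩
      reps'_uniq := fun x y h hx => hT₁u x y hx h }
  · have hcg := hq.conj_ne_zero hg
    have h := row3 hq.delta_ne g
    simp only [map_div₀]
    field_simp
    linear_combination h
  · rintro b z ⟨α, g₀, m, u, hm, hu, rfl, -⟩
    have hα := hq.conj_ne_zero (Units.ne_zero α)
    refine ⟨(c (α : E))⁻¹, inv_ne_zero hα, ?_⟩
    have e : ∀ (g : U3 c δ) (j : Fin 3), entry (m * u * g) 2 j = (c (α : E))⁻¹ * entry g 2 j := by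
      intro g j
      have hm' : ∀ j, entry m 2 j = Matrix.diagonal ![(α : E), (g₀ : E), (c (α : E))⁻¹] 2 j :=
        fun j => congrFun (congrFun hm 2) j
      have hu' : ∀ j, entry u 2 j = (1 : Matrix (Fin 3) (Fin 3) E) 2 j :=
        fun j => hu 2 j (by fin_cases j <;> decide)
      rw [mul_assoc, mul3, mul3 u g 2, hm', hm', hm', hu', hu', hu']
      simp
    exact fun g => ⟨e g 0, e g 1, e g 2⟩
  · obtain ⟨V, hV, h⟩ := smooth_row (U3 c δ) k
    refine ⟨V, hV, fun u hu g => ?_⟩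
    have h1 := h u hu g 2 (rowVal (entry g 2 0) (entry g 2 1) (entry g 2 2)) (by
      obtain ⟨a1, a2, a3⟩ := rowVal_le_iff.mp
        (le_refl (rowVal (entry g 2 0) (entry g 2 1) (entry g 2 2)))
      intro j; fin_cases j; exacts [a1, a2, a3])
    exact ⟨h1 0, h1 1, h1 2⟩
  · obtain ⟨κ, hκ⟩ := exists_lower3 hq h
    refine ⟨κ, (mem_integralPts_iff hq.val_conj hdet κ).mpr fun i j => ?_, fun g => ?_⟩
    · have hδa : valuation E (δ * c a) ≤ 1 := by
        rw [map_mul, hq.val_conj]; exact mul_le_one' hq.val_delta_le_one ha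
      rw [hκ]
      fin_cases i <;> fin_cases j <;> simp [hs, ha, -map_mul, hδa]
    · simp only [mul3, hκ]
      refine ⟨?_, ?_, ?_⟩ <;> simp <;> ring
  · obtain ⟨κ, hκ⟩ := exists_weyl3 hq
    refine ⟨κ, (mem_integralPts_iff hq.val_conj hdet κ).mpr fun i j => ?_, fun g => ?_⟩
    · rw [hκ]
      fin_cases i <;> fin_cases j <;> simp
    · simp only [mul3, hκ]
      refine ⟨?_, ?_, ?_⟩ <;> simp
  · simp only [mul3, entry_iota, entry_torusElt]
    refine ⟨?_, ?_, ?_⟩ <;> simp [mul_comm]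
  · simp only [map_div₀, map_pow, map_mul, hq.conj_conj]
    field_simp
    linear_combination ((unif E : E) ^ l * c (unif E : E) ^ l) * h
  · simp only [map_pow, map_mul, hq.conj_conj, mul_pow]
    linear_combination ((unif E : E) ^ l * c (unif E : E) ^ l) * h
  · simp only [map_add, map_neg, map_mul, hq.conj_conj, hq.conj_delta]
    linear_combination -h

/-- Elements with bottom row `(0, 0, z)` lie in the Borel subgroup, and act on the principal
series through a power of `χ(ϖ) / q_E`. -/
theorem borelRel3_of_bottom {χ : Eˣ →* ℂˣ} (hχ : IsUnram fun x => (χ x : ℂ)) (g : U3 c δ)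
    (h0 : entry g 2 0 = 0) (h1 : entry g 2 1 = 0) (j : ℤ)
    (hj : valuation E (entry g 2 2) = unifVal E ^ j) :
    borelRel3 c δ χ g (((χ (unif E) : ℂ) / resCard E) ^ (-j)) := by
  have hδ := hq.delta_ne
  have h2 : entry g 2 2 ≠ 0 := by
    rcases bottom_ne_zero3 hq g with h | h | h
    exacts [absurd h0 h, absurd h1 h, h]
  have hc2 := hq.conj_ne_zero h2
  have r00 := rel3 g 0 0
  have r02 := rel3 g 0 2
  have r11 := rel3 g 1 1
  rw [h0] at r00 r02
  rw [h1] at r11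
  simp [form3] at r00 r02 r11
  rw [r00] at r02
  have hg00 : c (entry g 0 0) * entry g 2 2 = 1 := by
    apply mul_left_cancel₀ hδ
    simp at r02
    linear_combination r02
  have hg00' : entry g 0 0 * c (entry g 2 2) = 1 := by
    have := congrArg c hg00
    rwa [map_mul, hq.conj_conj, map_one] at this
  have hg0 : entry g 0 0 ≠ 0 := left_ne_zero_of_mul_eq_one hg00'
  have hg1 : entry g 1 1 ≠ 0 := right_ne_zero_of_mul_eq_one r11
  have hinv : (c (entry g 0 0))⁻¹ = entry g 2 2 := inv_eq_of_mul_eq_one_right hg00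
  have hm : ((Matrix.diagonal ![entry g 0 0, entry g 1 1, entry g 2 2]).map c).transpose * form3 δ
      * Matrix.diagonal ![entry g 0 0, entry g 1 1, entry g 2 2] = form3 δ := by
    rw [form3_iff]
    intro i j
    fin_cases i <;> fin_cases j <;> simp [form3, r11]
    · linear_combination δ * hg00
    · linear_combination δ * hg00'
  let m : U3 c δ := unitaryMk _ (det_form3 hδ) hm
  have hme : ∀ i j, entry m i j
    = Matrix.diagonal ![entry g 0 0, entry g 1 1, entry g 2 2] i j := fun i j => rfl
  have hmul : ∀ i j, entry g i j = entry (m * (m⁻¹ * g)) i j := by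
    intro i j; rw [mul_inv_cancel_left]
  have hval : valuation E (entry g 0 0) = unifVal E ^ (-j) := by
    have := congrArg (valuation E) hg00'
    rw [map_mul, hq.val_conj, hj, map_one] at this
    rw [zpow_neg]; exact eq_inv_of_mul_eq_one_left this
  refine ⟨Units.mk0 _ hg0, Units.mk0 _ hg1, m, m⁻¹ * g, ?_, ?_, (mul_inv_cancel_left _ _).symm, ?_⟩
  · simp only [Units.val_mk0, hinv]; rfl
  · intro i j hij
    change entry (m⁻¹ * g) i j = _
    have e := hmul i j
    rw [mul3 m] at e
    simp only [hme] at e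
    fin_cases i <;> fin_cases j <;> simp at hij <;> simp [h0, h1, r00, h2, hg0, hg1] at e ⊢ <;>
      exact e
  · rw [isUnram_apply hχ (x := Units.mk0 _ hg0) hval, Units.val_mk0, absv_eq_zpow hval, neg_neg,
      div_zpow, zpow_neg (resCard E : ℂ), div_inv_eq_mul]
    push_cast
    rfl

/-! ### The row model of the unitary group in two variables -/

theorem rowModel2 : ∃ T T₁ : Finset (E × E), T.card = resCard E ∧
    T₁.card = halfIndex F δ ∧ ∀ ρ : Eˣ →* ℂˣ,
    RowModel c δ (integralPts (U2 c δ)) (borelRel2 c δ ρ) (fun g => entry g 1 0)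
      (fun _ => 0) (fun g => entry g 1 1) (fun x y => y = 0 ∧ c x = x) T T₁ (torusElt hq) := by
  classical
  obtain ⟨C, hC, hC1, hCr⟩ := hq.exists_residue_reps_sq
  obtain ⟨C', hC', hC1', hCr'⟩ := hq.exists_half_reps
  have hπ : (unif E : E) ≠ 0 := Units.ne_zero _
  have hcπ := hq.conj_ne_zero hπ
  have hdet := det_form2 hq.delta_ne
  have hinj : Function.Injective fun a : F => ((algebraMap F E a, 0) : E × E) := fun a b h =>
    (algebraMap F E).injective (Prod.ext_iff.mp h).1
  have huniq : ∀ (C : Finset F) (γ : ValueGroupWithZero E),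
      (∀ t : F, valuation E (algebraMap F E t) ≤ γ →
      ∃! a, a ∈ C ∧ valuation E (algebraMap F E (t + a)) ≤ unifVal E ^ 2) → ∀ x y : E,
      (y = 0 ∧ c x = x) → valuation E x ≤ γ →
      ∃! t, t ∈ C.image (fun a : F => ((algebraMap F E a, 0) : E × E)) ∧
        valuation E (x + δ * c t.2 * y + t.1) ≤ unifVal E ^ 2 := by
    rintro C γ h x y ⟨rfl, hx⟩ hxγ
    obtain ⟨t, rfl⟩ := hq.of_fixed hx
    obtain ⟨a, ⟨ha, hta⟩, hu⟩ := h t hxγ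
    refine ⟨(algebraMap F E a, 0), ⟨Finset.mem_image_of_mem _ ha, ?_⟩, ?_⟩
    · simpa using hta
    · rintro s ⟨hs, hs2⟩
      obtain ⟨b, hb, rfl⟩ := Finset.mem_image.mp hs
      rw [hu b ⟨hb, by simpa using hs2⟩]
  refine ⟨C.image fun a => (algebraMap F E a, 0), C'.image fun a => (algebraMap F E a, 0),
    by rw [Finset.card_image_of_injective _ hinj, hC],
    by rw [Finset.card_image_of_injective _ hinj, hC'], fun ρ => ?_⟩
  have hrow : ∀ g : U2 c δ, entry g 1 1 * c (entry g 1 0) - entry g 1 0 * c (entry g 1 1) = 0 :=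
    fun g => by simpa using row2 hq.delta_ne g 1 1
  refine
    { ne_zero := fun g => (bottom_ne_zero2 hq g).imp_right Or.inr
      isotropic := fun g => by linear_combination -hrow g
      div_mem := fun g hg => ⟨zero_div _, ?_⟩
      equivariant := ?_
      smooth := fun k => ?_
      unipotent := ?_
      weyl := ?_
      torus := fun n g => ?_
      heis := ?_
      scale_down := ?_
      scale_up := ?_
      inv_mem := ?_
      base := ⟨rfl, rfl⟩
      reps_mem := fun t ht => ?_
      reps_uniq := fun x y h hx => huniq C 1 hCr x y h hx
      reps'_mem := fun t ht => ?_
      reps'_uniq := fun x y h hx => huniq C' _ hCr' x y h hx }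
  · have hcg := hq.conj_ne_zero hg
    have h := hrow g
    simp only [map_div₀]
    field_simp
    linear_combination h
  · rintro b z ⟨α, y, hb, -⟩
    have hα := hq.conj_ne_zero (Units.ne_zero α)
    refine ⟨(c (α : E))⁻¹, inv_ne_zero hα, ?_⟩
    have hb' : ∀ j, entry b 1 j = (!![(α : E), 0; 0, (c (α : E))⁻¹] * !![1, algebraMap F E y; 0, 1]
      : Matrix (Fin 2) (Fin 2) E) 1 j := fun j => congrFun (congrFun hb 1) j
    intro g
    simp [mul2, hb']
  · obtain ⟨V, hV, h⟩ := smooth_row (U2 c δ) k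
    refine ⟨V, hV, fun u hu g => ?_⟩
    have h1 := h u hu g 1 (rowVal (entry g 1 0) 0 (entry g 1 1)) (by
      obtain ⟨a1, a2, a3⟩ := rowVal_le_iff.mp (le_refl (rowVal (entry g 1 0) 0 (entry g 1 1)))
      intro j; fin_cases j; exacts [a1, a3])
    exact ⟨h1 0, by simp, h1 1⟩
  · rintro s a ⟨rfl, hs⟩ hs1 -
    obtain ⟨t, rfl⟩ := hq.of_fixed hs
    obtain ⟨κ, hκ⟩ := exists_lower2 hq t
    refine ⟨κ, (mem_integralPts_iff hq.val_conj hdet κ).mpr fun i j => ?_, fun g => ?_⟩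
    · rw [hκ]
      fin_cases i <;> fin_cases j <;> simp [hs1]
    · simp [mul2, hκ, mul_comm]
  · obtain ⟨κ, hκ⟩ := exists_weyl2 hq
    refine ⟨κ, (mem_integralPts_iff hq.val_conj hdet κ).mpr fun i j => ?_, fun g => ?_⟩
    · rw [hκ]
      fin_cases i <;> fin_cases j <;> simp
    · simp [mul2, hκ]
  · simp [mul2, entry_torusElt, mul_comm]
  · rintro x y ⟨rfl, hx⟩
    simp [hx]
  · rintro l x y ⟨rfl, hx⟩
    refine ⟨zero_div _, ?_⟩
    simp only [map_div₀, map_pow, map_mul, hq.conj_conj, hx, mul_comm]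
  · rintro l x y ⟨rfl, hx⟩
    refine ⟨mul_zero _, ?_⟩
    simp only [map_pow, map_mul, hq.conj_conj, hx, mul_comm]
  · rintro x y ⟨rfl, hx⟩
    simp [hx]
  · obtain ⟨a, ha, rfl⟩ := Finset.mem_image.mp ht
    exact ⟨by simp, hC1 a ha, by simp⟩
  · obtain ⟨a, ha, rfl⟩ := Finset.mem_image.mp ht
    exact ⟨by simp, hC1' a ha, by simp, by simp⟩

theorem borelRel2_of_bottom {ρ : Eˣ →* ℂˣ} (hρ : IsUnram fun x => (ρ x : ℂ)) (g : U2 c δ)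
    (h0 : entry g 1 0 = 0) (j : ℤ) (hj : valuation E (entry g 1 1) = unifVal E ^ j) :
    borelRel2 c δ ρ g (((ρ (unif E) : ℂ) / (Real.sqrt (resCard E) : ℝ)) ^ (-j)) := by
  have hδ := hq.delta_ne
  have r01 := rel2 g 0 1
  rw [h0] at r01
  simp [form2] at r01
  have hg00 : c (entry g 0 0) * entry g 1 1 = 1 := by
    apply mul_left_cancel₀ hδ
    linear_combination r01
  have hg00' : entry g 0 0 * c (entry g 1 1) = 1 := by
    have := congrArg c hg00
    rwa [map_mul, hq.conj_conj, map_one] at this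
  have hg0 : entry g 0 0 ≠ 0 := left_ne_zero_of_mul_eq_one hg00'
  have hcg0 := hq.conj_ne_zero hg0
  have hinv : (c (entry g 0 0))⁻¹ = entry g 1 1 := inv_eq_of_mul_eq_one_right hg00
  have hval : valuation E (entry g 0 0) = unifVal E ^ (-j) := by
    have := congrArg (valuation E) hg00'
    rw [map_mul, hq.val_conj, hj, map_one] at this
    rw [zpow_neg]; exact eq_inv_of_mul_eq_one_left this
  obtain ⟨y, hy⟩ := hq.of_fixed (x := entry g 0 1 / entry g 0 0) (by
    have := row2 hδ g 0 0
    simp at this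
    rw [map_div₀, div_eq_div_iff hcg0 hg0]
    linear_combination -this)
  refine ⟨Units.mk0 _ hg0, y, ?_, ?_⟩
  · ext i j
    change entry g i j = _
    simp only [Units.val_mk0, hinv, hy]
    fin_cases i <;> fin_cases j <;> simp [Matrix.mul_apply, Fin.sum_univ_two, h0]
    field_simp
  · have hQ : (0 : ℝ) ≤ resCard E := Nat.cast_nonneg _
    have hsq : Real.sqrt ((resCard E : ℝ) ^ j) = Real.sqrt (resCard E) ^ j := by
      rw [Real.sqrt_eq_iff_mul_self_eq (zpow_nonneg hQ j) (zpow_nonneg (Real.sqrt_nonneg _) j),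
        ← mul_zpow, Real.mul_self_sqrt hQ]
    rw [isUnram_apply hρ (x := Units.mk0 _ hg0) hval, Units.val_mk0, absv_eq_zpow hval, neg_neg,
      hsq, div_zpow, zpow_neg ((Real.sqrt (resCard E) : ℝ) : ℂ), div_inv_eq_mul]
    push_cast
    rfl

end Models

/-! ### Double cosets in the unitary group in two variables -/

section Cartan

variable {F E : Type*} [Field F] [ValuativeRel F] [TopologicalSpace F]
  [IsNonarchimedeanLocalField F] [Field E] [ValuativeRel E] [TopologicalSpace E]
  [IsNonarchimedeanLocalField E] [Algebra F E] [ValuativeExtension F E]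
  {c : E ≃ₐ[F] E} {δ : E}

/-- The largest valuation of an entry of the row with index `i`. -/
def rowSup (h : U2 c δ) (i : Fin 2) : ValueGroupWithZero E :=
  max (valuation E (entry h i 0)) (valuation E (entry h i 1))

theorem rowSup_le_iff {h : U2 c δ} {i : Fin 2} {γ : ValueGroupWithZero E} :
    rowSup h i ≤ γ ↔ ∀ j, valuation E (entry h i j) ≤ γ := by
  rw [rowSup, max_le_iff, Fin.forall_fin_two]

theorem le_rowSup (h : U2 c δ) (i j : Fin 2) : valuation E (entry h i j) ≤ rowSup h i :=
  rowSup_le_iff.mp le_rfl j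

theorem exists_eq_rowSup (h : U2 c δ) (i : Fin 2) :
    ∃ j, valuation E (entry h i j) = rowSup h i := by
  rcases max_choice (valuation E (entry h i 0)) (valuation E (entry h i 1)) with h1 | h1
  exacts [⟨0, h1.symm⟩, ⟨1, h1.symm⟩]

variable (hq : QuadFacts c δ)

include hq

theorem mem_integralPts2_iff (g : U2 c δ) : g ∈ integralPts (U2 c δ) ↔
    rowSup g 0 ≤ 1 ∧ rowSup g 1 ≤ 1 := by
  rw [mem_integralPts_iff hq.val_conj (det_form2 hq.delta_ne), rowSup_le_iff, rowSup_le_iff,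
    Fin.forall_fin_two]

theorem rowSup_mul {κ : U2 c δ} (hκ : κ ∈ integralPts (U2 c δ)) (h : U2 c δ) (i : Fin 2) :
    rowSup (h * κ) i = rowSup h i := by
  have key : ∀ κ ∈ integralPts (U2 c δ), ∀ h : U2 c δ, rowSup (h * κ) i ≤ rowSup h i := by
    intro κ hκ h
    rw [mem_integralPts_iff hq.val_conj (det_form2 hq.delta_ne)] at hκ
    refine rowSup_le_iff.mpr fun j => ?_
    rw [mul2]
    refine (Valuation.map_add _ _ _).trans (max_le ?_ ?_) <;> rw [map_mul]
    · exact (mul_le_of_le_one_right' (hκ 0 j)).trans (le_rowSup h i 0)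
    · exact (mul_le_of_le_one_right' (hκ 1 j)).trans (le_rowSup h i 1)
  refine le_antisymm (key κ hκ h) ?_
  have := key κ⁻¹ (Subgroup.inv_mem _ hκ) (h * κ)
  rwa [mul_inv_cancel_right] at this

theorem one_le_rowSup_mul (h : U2 c δ) : 1 ≤ rowSup h 0 * rowSup h 1 := by
  have h1 : entry h 0 0 * c (entry h 1 1) - entry h 0 1 * c (entry h 1 0) = 1 := by
    have := row2 hq.delta_ne h 0 1
    simp at this
    linear_combination -this
  rw [← map_one (valuation E), ← h1]
  refine (Valuation.map_sub _ _ _).trans (max_le ?_ ?_) <;> rw [map_mul, hq.val_conj] <;>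
    exact mul_le_mul' (le_rowSup _ _ _) (le_rowSup _ _ _)

theorem rowSup_pos (h : U2 c δ) (i : Fin 2) : 0 < rowSup h i := by
  rw [zero_lt_iff]
  intro h0
  have h1 := one_le_rowSup_mul hq h
  fin_cases i <;> simp_all

/-- The lower triangular unipotent matrix with entry `s`. -/
def low2 (s : F) : U2 c δ := (exists_lower2 hq s).choose

theorem entry_low2 (s : F) (i j : Fin 2) :
    entry (low2 hq s) i j = !![1, 0; algebraMap F E s, 1] i j :=
  (exists_lower2 hq s).choose_spec i j

theorem low2_mem {s : F} (hs : valuation E (algebraMap F E s) ≤ 1) :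
    low2 hq s ∈ integralPts (U2 c δ) := by
  rw [mem_integralPts_iff hq.val_conj (det_form2 hq.delta_ne)]
  intro i j
  rw [entry_low2]
  fin_cases i <;> fin_cases j <;> simp [hs]

theorem low2_mul_low2 (s t : F) : low2 hq s * low2 hq t = low2 hq (s + t) :=
  entry_ext fun i j => by
    simp only [mul2, entry_low2]
    fin_cases i <;> fin_cases j <;> simp

theorem low2_zero : low2 hq 0 = 1 :=
  entry_ext fun i j => by
    rw [entry_low2, entry_one]
    fin_cases i <;> fin_cases j <;> simp

theorem entry_low2_mul (s : F) (h : U2 c δ) (j : Fin 2) :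
    entry (low2 hq s * h) 0 j = entry h 0 j ∧
      entry (low2 hq s * h) 1 j = entry h 1 j + algebraMap F E s * entry h 0 j := by
  simp [mul2, entry_low2, add_comm]

theorem rowSup_low2_mul (s : F) (h : U2 c δ) : rowSup (low2 hq s * h) 0 = rowSup h 0 := by
  simp only [rowSup, entry_low2_mul]

/-- The bottom row is, up to a small error, a multiple of the top row by an element `t` of the
base field. -/
theorem exists_ratio (h : U2 c δ) : ∃ t : F, ∀ a : F, ∀ θ, (rowSup h 0)⁻¹ ≤ θ →
    (rowSup (low2 hq a * h) 1 ≤ θ ↔ valuation E (algebraMap F E (t + a)) * rowSup h 0 ≤ θ) := by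
  obtain ⟨j₀, hj₀⟩ := exists_eq_rowSup h 0
  have hpos := rowSup_pos hq h 0
  have h0 : entry h 0 j₀ ≠ 0 := by
    intro h0; rw [h0, map_zero] at hj₀; exact hpos.ne hj₀
  have hc0 := hq.conj_ne_zero h0
  have hδ := hq.delta_ne
  obtain ⟨t, ht⟩ := hq.of_fixed (x := entry h 1 j₀ / entry h 0 j₀) (by
    have h1 := rel2 h j₀ j₀
    have h2 : form2 δ j₀ j₀ = 0 := by fin_cases j₀ <;> simp [form2]
    rw [map_div₀, div_eq_div_iff hc0 h0]
    apply mul_left_cancel₀ hδ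
    linear_combination -h2 - h1)
  have hct : c (algebraMap F E t) = algebraMap F E t := c.commutes t
  have e0 : entry h 1 j₀ = algebraMap F E t * entry h 0 j₀ := by rw [ht]; field_simp
  -- the error is controlled by the form
  have hsmall : ∀ j, valuation E (entry h 1 j - algebraMap F E t * entry h 0 j)
      ≤ (rowSup h 0)⁻¹ := by
    intro j
    have h1 := rel2 h j₀ j
    rw [e0, map_mul, hct] at h1
    have h2 : δ * (c (entry h 0 j₀) * (entry h 1 j - algebraMap F E t * entry h 0 j))
        = form2 δ j₀ j := by linear_combination h1
    have h3 : valuation E (form2 δ j₀ j) ≤ valuation E δ := by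
      fin_cases j₀ <;> fin_cases j <;> simp [form2]
    rw [← h2, map_mul, map_mul, hq.val_conj, hj₀] at h3
    have h4 := le_of_mul_le_mul_left (h3.trans_eq (mul_one _).symm) hq.val_delta_pos
    rwa [← one_div, le_div_iff₀ hpos, mul_comm]
  refine ⟨t, fun a θ hθ => ?_⟩
  have e : ∀ j, entry (low2 hq a * h) 1 j = algebraMap F E (t + a) * entry h 0 j
      + (entry h 1 j - algebraMap F E t * entry h 0 j) := by
    intro j; rw [(entry_low2_mul hq a h j).2, map_add]; ring
  rw [rowSup_le_iff]
  constructor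
  · intro H
    have := H j₀
    rwa [e, e0, sub_self, add_zero, map_mul, hj₀] at this
  · intro H j
    rw [e]
    refine (Valuation.map_add _ _ _).trans (max_le ?_ ((hsmall j).trans hθ))
    rw [map_mul]
    exact (mul_le_mul' le_rfl (le_rowSup _ _ _)).trans H

/-- The elements with top row of level `γ` and bottom row of level at most `θ`. -/
def strip (c : E ≃ₐ[F] E) (δ : E) (γ θ : ValueGroupWithZero E) : Set (U2 c δ) :=
  {h | rowSup h 0 = γ ∧ rowSup h 1 ≤ θ}

/-- The narrowest strip is a single coset of the integral points. -/
theorem mem_strip_inv_iff (n : ℕ) (h : U2 c δ) :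
    h ∈ strip c δ (unifVal E ^ n)⁻¹ (unifVal E ^ n) ↔
      (torusElt hq n)⁻¹ * h ∈ integralPts (U2 c δ) := by
  have hp := pow_pos (unifVal_pos E) n
  have hπ : valuation E (unif E : E) = unifVal E := rfl
  set g := (torusElt hq n)⁻¹ * h with hg
  have hh : h = torusElt hq n * g := by rw [hg, mul_inv_cancel_left]
  have h0 : rowSup h 0 = (unifVal E ^ n)⁻¹ * rowSup g 0 := by
    rw [hh, rowSup, rowSup, mul_max]
    simp [mul2, entry_torusElt, hπ]
  have h1 : rowSup h 1 = unifVal E ^ n * rowSup g 1 := by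
    rw [hh, rowSup, rowSup, mul_max]
    simp [mul2, entry_torusElt, hπ, hq.val_conj]
  change rowSup h 0 = _ ∧ rowSup h 1 ≤ _ ↔ _
  rw [mem_integralPts2_iff hq, h0, h1, mul_le_iff_le_one_right hp,
    mul_eq_left₀ (inv_pos.mpr hp).ne']
  refine and_congr_left fun hb => ⟨fun h => h.le, fun h => le_antisymm h ?_⟩
  exact (one_le_rowSup_mul hq g).trans (mul_le_of_le_one_right' hb)

/-- The elements whose largest entry has valuation `p⁻ⁿ`. -/
def shell (c : E ≃ₐ[F] E) (δ : E) (n : ℕ) : Set (U2 c δ) :=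
  {h | max (rowSup h 0) (rowSup h 1) = (unifVal E ^ n)⁻¹}

theorem exists_mem_shell (h : U2 c δ) : ∃ n, h ∈ shell c δ n := by
  have h1 := one_le_rowSup_mul hq h
  set L := max (rowSup h 0) (rowSup h 1) with hL
  have hL1 : 1 ≤ L := by
    by_contra hlt
    rw [not_le] at hlt
    have : rowSup h 0 * rowSup h 1 ≤ L * L := mul_le_mul' (le_max_left _ _) (le_max_right _ _)
    exact absurd (h1.trans this) (not_le.mpr (mul_lt_one_of_lt_of_le hlt hlt.le))
  have : ∃ j : ℤ, L = unifVal E ^ j := by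
    have hv : ∀ i, ∃ j : ℤ, rowSup h i = unifVal E ^ j := by
      intro i
      obtain ⟨j, hj⟩ := exists_eq_rowSup h i
      rw [← hj]
      exact exists_val_eq_zpow fun h0 => by
        rw [h0, map_zero] at hj; exact (rowSup_pos hq h i).ne hj
    rcases max_choice (rowSup h 0) (rowSup h 1) with h2 | h2 <;> rw [hL, h2] <;> exact hv _
  obtain ⟨j, hj⟩ := this
  have hj0 : j ≤ 0 := by rw [← unifVal_zpow_le_iff (K := E), zpow_zero, ← hj]; exact hL1
  refine ⟨(-j).toNat, ?_⟩
  change L = _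
  rw [hj, ← zpow_natCast, Int.toNat_of_nonneg (by omega), zpow_neg, inv_inv]

theorem shell_unique {h : U2 c δ} {n k : ℕ} (hn : h ∈ shell c δ n) (hk : h ∈ shell c δ k) :
    n = k := by
  have h1 : (unifVal E ^ n)⁻¹ = (unifVal E ^ k)⁻¹ := hn.symm.trans hk
  have h2 := inv_injective h1
  rw [← zpow_natCast, ← zpow_natCast, unifVal_zpow_inj] at h2
  exact_mod_cast h2

/-- The Weyl element. -/
def weyl2 : U2 c δ := (exists_weyl2 hq).choose

theorem entry_weyl2 (i j : Fin 2) : entry (weyl2 hq) i j = !![0, -1; 1, 0] i j :=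
  (exists_weyl2 hq).choose_spec i j

theorem weyl2_mem : weyl2 hq ∈ integralPts (U2 c δ) := by
  rw [mem_integralPts_iff hq.val_conj (det_form2 hq.delta_ne)]
  intro i j
  rw [entry_weyl2]
  fin_cases i <;> fin_cases j <;> simp

theorem rowSup_weyl2_mul (h : U2 c δ) :
    rowSup (weyl2 hq * h) 0 = rowSup h 1 ∧ rowSup (weyl2 hq * h) 1 = rowSup h 0 := by
  simp [rowSup, mul2, entry_weyl2]

theorem exists_cartan_of_strip {n : ℕ} {h : U2 c δ}
    (hh : h ∈ strip c δ (unifVal E ^ n)⁻¹ (unifVal E ^ n)⁻¹) :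
    ∃ κ₁ ∈ integralPts (U2 c δ), ∃ κ₂ ∈ integralPts (U2 c δ), h = κ₁ * torusElt hq n * κ₂ := by
  obtain ⟨h0, h1⟩ := hh
  have hp := pow_pos (unifVal_pos E) n
  have hp1 : unifVal E ^ n ≤ 1 := pow_le_one₀ zero_le (unifVal_lt_one E).le
  obtain ⟨t, ht⟩ := exists_ratio hq h
  rw [h0, inv_inv] at ht
  have ht1 := (ht 0 (unifVal E ^ n)⁻¹ (hp1.trans ((one_le_inv₀ hp).mpr hp1))).mp (by
    rwa [low2_zero, one_mul])
  rw [add_zero, mul_le_iff_le_one_left (inv_pos.mpr hp)] at ht1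
  have h2 : low2 hq (-t) * h ∈ strip c δ (unifVal E ^ n)⁻¹ (unifVal E ^ n) :=
    ⟨(rowSup_low2_mul hq _ h).trans h0, (ht (-t) _ le_rfl).mpr (by simp)⟩
  rw [mem_strip_inv_iff hq] at h2
  refine ⟨low2 hq t, low2_mem hq ht1, _, h2, ?_⟩
  rw [mul_assoc, mul_inv_cancel_left, ← mul_assoc, low2_mul_low2, add_neg_cancel, low2_zero,
    one_mul]

/-- The Cartan decomposition. -/
theorem exists_cartan {n : ℕ} {h : U2 c δ} (hh : h ∈ shell c δ n) :
    ∃ κ₁ ∈ integralPts (U2 c δ), ∃ κ₂ ∈ integralPts (U2 c δ), h = κ₁ * torusElt hq n * κ₂ := by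
  have hh' : max (rowSup h 0) (rowSup h 1) = (unifVal E ^ n)⁻¹ := hh
  rcases max_choice (rowSup h 0) (rowSup h 1) with h1 | h1
  · exact exists_cartan_of_strip hq ⟨h1.symm.trans hh', (le_max_right _ _).trans hh'.le⟩
  · obtain ⟨e0, e1⟩ := rowSup_weyl2_mul hq h
    obtain ⟨κ₁, hκ₁, κ₂, hκ₂, e⟩ := exists_cartan_of_strip hq (n := n) (h := weyl2 hq * h)
      ⟨e0.trans (h1.symm.trans hh'), e1.trans_le ((le_max_left _ _).trans hh'.le)⟩
    refine ⟨(weyl2 hq)⁻¹ * κ₁, Subgroup.mul_mem _ (Subgroup.inv_mem _ (weyl2_mem hq)) hκ₁, κ₂, hκ₂,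
      ?_⟩
    rw [mul_assoc, mul_assoc, ← mul_assoc κ₁, ← e, inv_mul_cancel_left]

theorem shell_zero : shell c δ 0 = (integralPts (U2 c δ) : Set (U2 c δ)) := by
  ext h
  change max (rowSup h 0) (rowSup h 1) = _ ↔ _
  rw [SetLike.mem_coe, mem_integralPts2_iff hq, ← max_le_iff, pow_zero, inv_one]
  refine ⟨fun h => h.le, fun h' => le_antisymm h' ?_⟩
  obtain ⟨n, hn⟩ := exists_mem_shell hq h
  have hn' : max (rowSup h 0) (rowSup h 1) = (unifVal E ^ n)⁻¹ := hn
  rw [hn']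
  exact (one_le_inv₀ (pow_pos (unifVal_pos E) n)).mpr (pow_le_one₀ zero_le (unifVal_lt_one E).le)

end Cartan

/-! ### Volumes of double cosets -/

/-- The integral of a function that is constant on the pieces of a countable partition. -/
theorem integral_of_partition {X : Type*} [MeasurableSpace X] {ν : Measure X} {S : ℕ → Set X}
    (hS : ∀ n, MeasurableSet (S n)) (hdisj : Pairwise (Function.onFun Disjoint S))
    (hcov : ⋃ n, S n = Set.univ) (hfin : ∀ n, ν (S n) ≠ ⊤) {g : X → ℂ} {a : ℕ → ℂ}
    (hg : ∀ n, ∀ x ∈ S n, g x = a n) (hs : Summable fun n => (ν.real (S n) : ℂ) * a n) :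
    Integrable g ν ∧ ∫ x, g x ∂ν = ∑' n, (ν.real (S n) : ℂ) * a n := by
  have hint : ∀ n, IntegrableOn g (S n) ν := fun n =>
    (integrableOn_congr_fun (hg n) (hS n)).mpr (integrableOn_const (hfin n))
  have hval : ∀ n, ∫ x in S n, g x ∂ν = (ν.real (S n) : ℂ) * a n := by
    intro n
    rw [setIntegral_congr_fun (hS n) (hg n), setIntegral_const, Complex.real_smul]
  have hnorm : ∀ n, ∫ x in S n, ‖g x‖ ∂ν = ‖(ν.real (S n) : ℂ) * a n‖ := by
    intro n
    rw [setIntegral_congr_fun (g := fun _ => ‖a n‖) (hS n) (fun x hx => by simp only [hg n x hx]),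
      setIntegral_const, norm_mul, Complex.norm_real, Real.norm_of_nonneg measureReal_nonneg,
      smul_eq_mul]
  have h1 : IntegrableOn g (⋃ n, S n) ν :=
    integrableOn_iUnion_of_summable_integral_norm hint (by simpa only [hnorm] using hs.norm)
  have h2 := integral_iUnion hS hdisj h1
  rw [hcov, setIntegral_univ] at h2
  rw [hcov, integrableOn_univ] at h1
  exact ⟨h1, by rw [h2]; exact tsum_congr hval⟩

/-- A set that is a disjoint union of finitely many left translates of another one. -/
theorem measure_eq_card_mul {Γ : Type*} [Group Γ] [MeasurableSpace Γ] [MeasurableMul Γ]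
    {μ : Measure Γ} [μ.IsMulLeftInvariant] {ι : Type*} {C : Finset ι} {g : ι → Γ} {A B : Set Γ}
    (hB : MeasurableSet B) (h1 : ∀ h ∈ A, ∃! a, a ∈ C ∧ g a * h ∈ B)
    (h2 : ∀ a ∈ C, ∀ h, g a * h ∈ B → h ∈ A) : μ A = C.card * μ B := by
  have e : A = ⋃ a ∈ C, (fun h => g a * h) ⁻¹' B := by
    ext h
    simp only [Set.mem_iUnion, Set.mem_preimage, exists_prop]
    exact ⟨fun hh => (h1 h hh).exists, fun ⟨a, ha, hh⟩ => h2 a ha h hh⟩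
  rw [e, measure_biUnion_finset]
  · simp only [measure_preimage_mul, Finset.sum_const, nsmul_eq_mul]
  · intro a ha b hb hab
    refine Set.disjoint_left.mpr fun h hha hhb => hab ?_
    exact (h1 h (h2 a ha h hha)).unique ⟨ha, hha⟩ ⟨hb, hhb⟩
  · exact fun a _ => (measurable_const_mul (g a)) hB

section Volume

variable {F E : Type*} [Field F] [ValuativeRel F] [TopologicalSpace F]
  [IsNonarchimedeanLocalField F] [Field E] [ValuativeRel E] [TopologicalSpace E]
  [IsNonarchimedeanLocalField E] [Algebra F E] [ValuativeExtension F E]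
  {c : E ≃ₐ[F] E} {δ : E} (hq : QuadFacts c δ)

include hq

theorem integralPts2_mem_nhds : (integralPts (U2 c δ) : Set (U2 c δ)) ∈ 𝓝 1 := by
  obtain ⟨V, hV, h⟩ := exists_nhds_one (U2 c δ) 0
  refine Filter.mem_of_superset hV fun u hu => ?_
  rw [SetLike.mem_coe, mem_integralPts_iff hq.val_conj (det_form2 hq.delta_ne)]
  intro i j
  have h1 := h u hu i j
  rw [pow_zero] at h1
  rw [val_le_iff_of_sub_le h1]
  fin_cases i <;> fin_cases j <;> simp

theorem isOpen_of_rowSup (P : ValueGroupWithZero E → ValueGroupWithZero E → Prop) :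
    IsOpen {h : U2 c δ | P (rowSup h 0) (rowSup h 1)} := by
  rw [isOpen_iff_mem_nhds]
  intro h hh
  have h1 : (fun x => h⁻¹ * x) ⁻¹' (integralPts (U2 c δ) : Set (U2 c δ)) ∈ 𝓝 h :=
    (continuous_const_mul h⁻¹).continuousAt.preimage_mem_nhds (by
      rw [inv_mul_cancel]; exact integralPts2_mem_nhds hq)
  refine Filter.mem_of_superset h1 fun x hx => ?_
  have e : x = h * (h⁻¹ * x) := by rw [mul_inv_cancel_left]
  change P (rowSup x 0) (rowSup x 1)
  rw [e, rowSup_mul hq hx, rowSup_mul hq hx]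
  exact hh

variable [MeasurableSpace (U2 c δ)] [BorelSpace (U2 c δ)]

theorem measurableSet_strip (γ θ : ValueGroupWithZero E) : MeasurableSet (strip c δ γ θ) :=
  (isOpen_of_rowSup hq fun x y => x = γ ∧ y ≤ θ).measurableSet

theorem measurableSet_shell (n : ℕ) : MeasurableSet (shell c δ n) :=
  (isOpen_of_rowSup hq fun x y => max x y = (unifVal E ^ n)⁻¹).measurableSet

variable {μ : Measure (U2 c δ)} [μ.IsMulLeftInvariant]

/-- Dividing a strip into translates of a narrower one. -/
theorem measure_strip {n l : ℕ} (hl : l + 1 ≤ n) {C : Finset F} {θ : ValueGroupWithZero E}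
    (hθ : unifVal E ^ 2 ≤ θ) (hC : ∀ a ∈ C, valuation E (algebraMap F E a) ≤ θ)
    (hC1 : ∀ t : F, valuation E (algebraMap F E t) ≤ θ →
      ∃! a, a ∈ C ∧ valuation E (algebraMap F E (t + a)) ≤ unifVal E ^ 2) :
    μ (strip c δ (unifVal E ^ n)⁻¹ (θ * unifVal E ^ (2 * l) * (unifVal E ^ n)⁻¹))
      = C.card * μ (strip c δ (unifVal E ^ n)⁻¹
          (unifVal E ^ (2 * (l + 1)) * (unifVal E ^ n)⁻¹)) := by
  obtain ⟨ν, -, hν⟩ := hq.exists_normUnif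
  have hp := pow_pos (unifVal_pos E) n
  have hγ : 0 < (unifVal E ^ n)⁻¹ := inv_pos.mpr hp
  have hνl : valuation E (algebraMap F E (ν ^ l)) = unifVal E ^ (2 * l) := by
    rw [map_pow, map_pow, hν, ← pow_mul]
  have hνpos : 0 < unifVal E ^ (2 * l) := pow_pos (unifVal_pos E) _
  have hνl0 : ν ^ l ≠ 0 := by
    intro h0; rw [h0, map_zero, map_zero] at hνl; exact hνpos.ne hνl
  have hsplit : unifVal E ^ (2 * (l + 1)) = unifVal E ^ 2 * unifVal E ^ (2 * l) := by
    rw [← pow_add]; congr 1; ring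
  have hle : unifVal E ^ (2 * (l + 1)) * (unifVal E ^ n)⁻¹
      ≤ θ * unifVal E ^ (2 * l) * (unifVal E ^ n)⁻¹ := by
    rw [hsplit]; exact mul_le_mul' (mul_le_mul' hθ le_rfl) le_rfl
  have hsm : ((unifVal E ^ n)⁻¹)⁻¹ ≤ unifVal E ^ (2 * (l + 1)) * (unifVal E ^ n)⁻¹ := by
    rw [inv_inv, ← div_eq_mul_inv, le_div_iff₀ hp, ← pow_add]
    exact pow_le_pow_of_le_one zero_le (unifVal_lt_one E).le (by omega)
  refine measure_eq_card_mul (g := fun a => low2 hq (ν ^ l * a)) (measurableSet_strip hq _ _) ?_ ?_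
  · rintro h ⟨h0, h1⟩
    obtain ⟨t, ht⟩ := exists_ratio hq h
    rw [h0] at ht
    have ht1 := (ht 0 _ (hsm.trans hle)).mp (by rwa [low2_zero, one_mul])
    rw [add_zero, mul_le_mul_iff_left₀ hγ] at ht1
    obtain ⟨a, ha, hau⟩ := hC1 (t / ν ^ l) (by
      rw [map_div₀, map_div₀, hνl]; exact (div_le_iff₀ hνpos).mpr ht1)
    have key : ∀ a, valuation E (algebraMap F E (t / ν ^ l + a)) ≤ unifVal E ^ 2 ↔
        low2 hq (ν ^ l * a) * h ∈ strip c δ (unifVal E ^ n)⁻¹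
          (unifVal E ^ (2 * (l + 1)) * (unifVal E ^ n)⁻¹) := by
      intro a
      have e : t + ν ^ l * a = (t / ν ^ l + a) * ν ^ l := by field_simp
      change _ ↔ rowSup _ 0 = _ ∧ rowSup _ 1 ≤ _
      rw [rowSup_low2_mul, ht _ _ hsm, mul_le_mul_iff_left₀ hγ, e, map_mul, map_mul, hνl, hsplit,
        mul_le_mul_iff_left₀ hνpos]
      exact ⟨fun h' => ⟨h0, h'⟩, fun h' => h'.2⟩
    exact ⟨a, ⟨ha.1, (key a).mp ha.2⟩, fun b hb => hau b ⟨hb.1, (key b).mpr hb.2⟩⟩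
  · rintro a ha h ⟨h0, h1⟩
    rw [rowSup_low2_mul] at h0
    refine ⟨h0, rowSup_le_iff.mpr fun j => ?_⟩
    have e : entry h 1 j = entry (low2 hq (ν ^ l * a) * h) 1 j
        - algebraMap F E (ν ^ l * a) * entry h 0 j := by
      rw [(entry_low2_mul hq _ h j).2]; ring
    rw [e]
    refine (Valuation.map_sub _ _ _).trans (max_le ((le_rowSup _ _ _).trans (h1.trans hle)) ?_)
    rw [map_mul, map_mul, map_mul, hνl, ← h0, mul_comm (unifVal E ^ (2 * l))]
    exact mul_le_mul' (mul_le_mul' (hC a ha) le_rfl) (le_rowSup _ _ _)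

theorem measure_strip_pow (hμ : μ (integralPts (U2 c δ) : Set (U2 c δ)) = 1) (n d : ℕ) : ∀ l,
    l + d = n → μ (strip c δ (unifVal E ^ n)⁻¹ (unifVal E ^ (2 * l) * (unifVal E ^ n)⁻¹))
      = (resCard E : ENNReal) ^ d := by
  have hp := pow_pos (unifVal_pos E) n
  induction d with
  | zero =>
    intro l hl
    obtain rfl : l = n := by omega
    rw [two_mul, pow_add, mul_assoc, mul_inv_cancel₀ hp.ne', mul_one, pow_zero]
    have e : strip c δ (unifVal E ^ l)⁻¹ (unifVal E ^ l)
        = (fun h => (torusElt hq l)⁻¹ * h) ⁻¹' (integralPts (U2 c δ) : Set (U2 c δ)) := by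
      ext h; exact mem_strip_inv_iff hq l h
    rw [e, measure_preimage_mul, hμ]
  | succ d ih =>
    intro l hl
    obtain ⟨C, hC, hC1, hCr⟩ := hq.exists_residue_reps_sq
    have := measure_strip (μ := μ) hq (n := n) (l := l) (by omega) (θ := 1)
      (pow_le_one₀ zero_le (unifVal_lt_one E).le) hC1 hCr
    rw [one_mul] at this
    rw [this, ih (l + 1) (by omega), hC, pow_succ']

theorem measure_shell (hμ : μ (integralPts (U2 c δ) : Set (U2 c δ)) = 1) (n : ℕ) :
    μ (shell c δ (n + 1))
      = ((resCard E : ENNReal) + halfIndex F δ) * (resCard E : ENNReal) ^ n := by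
  have hp := pow_pos (unifVal_pos E) (n + 1)
  have hγ : 0 < (unifVal E ^ (n + 1))⁻¹ := inv_pos.mpr hp
  obtain ⟨C, hC, hC1, hCr⟩ := hq.exists_half_reps
  have h0 := measure_strip_pow hq hμ (n + 1) (n + 1) 0 (by omega)
  have h2 := measure_strip_pow hq hμ (n + 1) n 1 (by omega)
  have h1 := measure_strip (μ := μ) hq (n := n + 1) (l := 0) (by omega) (θ := unifVal E)
    (by rw [pow_two]; exact mul_le_of_le_one_right' (unifVal_lt_one E).le) hC1 hCr
  rw [zero_add, h2, hC] at h1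
  rw [mul_zero, pow_zero, mul_one] at h1
  rw [mul_zero, pow_zero, one_mul] at h0
  have hlt : ∀ h : U2 c δ, rowSup h 0 < (unifVal E ^ (n + 1))⁻¹ ↔
      rowSup h 0 ≤ unifVal E * (unifVal E ^ (n + 1))⁻¹ := by
    intro h
    obtain ⟨j, hj⟩ := exists_eq_rowSup h 0
    have hne : entry h 0 j ≠ 0 := fun h0 => by
      rw [h0, map_zero] at hj; exact (rowSup_pos hq h 0).ne hj
    obtain ⟨k, hk⟩ := exists_val_eq_zpow hne
    have e : unifVal E * (unifVal E ^ (n + 1))⁻¹ = unifVal E ^ (1 - ((n + 1 : ℕ) : ℤ)) := by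
      rw [zpow_sub₀ (unifVal_ne_zero E), zpow_one, zpow_natCast, div_eq_mul_inv]
    rw [← hj, hk, e, ← zpow_natCast, ← zpow_neg, unifVal_zpow_lt_iff, unifVal_zpow_le_iff]
    omega
  -- either the top row is a largest one, or it is smaller and the Weyl element exchanges the rows
  have e : shell c δ (n + 1) = strip c δ (unifVal E ^ (n + 1))⁻¹ (unifVal E ^ (n + 1))⁻¹ ∪
      (fun h => weyl2 hq * h) ⁻¹'
        strip c δ (unifVal E ^ (n + 1))⁻¹ (unifVal E * (unifVal E ^ (n + 1))⁻¹) := by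
    ext h
    obtain ⟨w0, w1⟩ := rowSup_weyl2_mul hq h
    change max _ _ = _ ↔ (_ = _ ∧ _ ≤ _) ∨
      (rowSup (weyl2 hq * h) 0 = _ ∧ rowSup (weyl2 hq * h) 1 ≤ _)
    rw [w0, w1, ← hlt]
    constructor
    · intro hm
      rcases eq_or_lt_of_le ((le_max_left (rowSup h 0) (rowSup h 1)).trans hm.le) with h' | h'
      · exact Or.inl ⟨h', (le_max_right _ _).trans hm.le⟩
      · refine Or.inr ⟨?_, h'⟩
        rcases max_choice (rowSup h 0) (rowSup h 1) with h'' | h''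
        · exact absurd (h''.symm.trans hm) h'.ne
        · exact h''.symm.trans hm
    · rintro (⟨h', h''⟩ | ⟨h', h''⟩)
      · rw [h', max_eq_left h'']
      · rw [h', max_eq_right h''.le]
  rw [e, measure_union, measure_preimage_mul, h0, h1]
  · ring
  · refine Set.disjoint_left.mpr fun h ha hb => ?_
    have hb' : rowSup (weyl2 hq * h) 1 ≤ _ := hb.2
    rw [(rowSup_weyl2_mul hq h).2, ← hlt] at hb'
    exact hb'.ne ha.1
  · exact (measurable_const_mul _) (measurableSet_strip hq _ _)

end Volume

/-! ### Evaluation of the series of double coset contributions -/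

theorem one_sub_mul_ne_zero {t : ℝ} {z : ℂ} {M : ℝ} (ht : 0 ≤ t) (hz : ‖z‖ ≤ M) (h : t * M < 1) :
    1 - (t : ℂ) * z ≠ 0 := by
  intro h0
  have h1 : ‖(t : ℂ) * z‖ = 1 := by rw [← sub_eq_zero.mp h0, norm_one]
  rw [norm_mul, Complex.norm_real, Real.norm_of_nonneg ht] at h1
  exact absurd (h1.symm.le.trans (mul_le_mul_of_nonneg_left hz ht)) (not_le.mpr h)

theorem one_le_max_norm {z : ℂ} (hz : z ≠ 0) : 1 ≤ max ‖z‖ ‖z‖⁻¹ := by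
  rcases le_total 1 ‖z‖ with h | h
  · exact h.trans (le_max_left _ _)
  · exact ((one_le_inv₀ (norm_pos_iff.mpr hz)).mpr h).trans (le_max_right _ _)

/-- The nonvanishing of the factors in the range of convergence. -/
theorem factors_ne_zero {β γ : ℂ} {t : ℝ} (hβ : β ≠ 0) (hγ : γ ≠ 0) (ht : 0 ≤ t)
    (hlt : t * (max ‖β‖ ‖β‖⁻¹ * max ‖γ‖ ‖γ‖⁻¹) < 1) :
    (1 - (t : ℂ) * (β * γ) ≠ 0 ∧ 1 - (t : ℂ) * (β * γ⁻¹) ≠ 0 ∧ 1 - (t : ℂ) * (β⁻¹ * γ) ≠ 0 ∧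
      1 - (t : ℂ) * (β⁻¹ * γ⁻¹) ≠ 0) ∧ 1 - (t : ℂ) * γ ≠ 0 ∧ 1 - (t : ℂ) * γ⁻¹ ≠ 0 ∧ t < 1 := by
  have h1 := one_le_max_norm hβ
  have h2 := one_le_max_norm hγ
  have a1 : ‖β‖ ≤ max ‖β‖ ‖β‖⁻¹ := le_max_left _ _
  have a2 : ‖β⁻¹‖ ≤ max ‖β‖ ‖β‖⁻¹ := by rw [norm_inv]; exact le_max_right _ _
  have b1 : ‖γ‖ ≤ max ‖γ‖ ‖γ‖⁻¹ := le_max_left _ _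
  have b2 : ‖γ⁻¹‖ ≤ max ‖γ‖ ‖γ‖⁻¹ := by rw [norm_inv]; exact le_max_right _ _
  have key : ∀ {x y : ℂ}, ‖x‖ ≤ max ‖β‖ ‖β‖⁻¹ → ‖y‖ ≤ max ‖γ‖ ‖γ‖⁻¹ →
      1 - (t : ℂ) * (x * y) ≠ 0 := by
    intro x y hx hy
    refine one_sub_mul_ne_zero ht ?_ hlt
    rw [norm_mul]
    exact mul_le_mul hx hy (norm_nonneg _) (zero_le_one.trans h1)
  have k1 : ‖(1 : ℂ)‖ ≤ max ‖β‖ ‖β‖⁻¹ := by rwa [norm_one]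
  refine ⟨⟨key a1 b1, key a1 b2, key a2 b1, key a2 b2⟩, ?_, ?_, ?_⟩
  · simpa using key k1 b1
  · simpa using key k1 b2
  · refine lt_of_le_of_lt ?_ hlt
    exact le_mul_of_one_le_right ht (one_le_mul_of_one_le_of_one_le h1 h2)

/-- The series of double coset contributions, in terms of the normalized spherical functions
`x n = Qⁿ φ n` and `y n = t⁻ⁿ φ' n`, where `t = 1 / √Q`; only `x 1`, `y 1` and the sum `S` of
`tⁿ x n y n` enter. -/
theorem tsum_shells {Q q J : ℕ} (hQ : 0 < Q) {β γ : ℂ} (hβ : β ≠ 0) (hγ : γ ≠ 0) {t : ℝ}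
    (ht : 0 < t) (htQ : (t : ℂ) ^ 2 * Q = 1)
    (hlt : t * (max ‖β‖ ‖β‖⁻¹ * max ‖γ‖ ‖γ‖⁻¹) < 1) {φ φ' : ℕ → ℂ} (h0 : φ 0 = 1) (h0' : φ' 0 = 1)
    (h1 : ((Q : ℂ) ^ 2 + q) * (φ 1 - β / Q) = (1 - β / Q) * (q + (β / Q)⁻¹))
    (h1' : ((Q : ℂ) + J) * (φ' 1 - t * γ) = (1 - t * γ) * (J + (t * γ)⁻¹))
    (h2 : ∀ n, (Q : ℂ) ^ 2 * φ (n + 2) + φ n = ((Q : ℂ) ^ 2 * (β / Q) + (β / Q)⁻¹) * φ (n + 1))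
    (h2' : ∀ n, Q * φ' (n + 2) + φ' n = (Q * (t * γ) + (t * γ)⁻¹) * φ' (n + 1))
    {vol : ℕ → ℝ} (hv0 : vol 0 = 1) (hv : ∀ n, vol (n + 1) = ((Q : ℝ) + J) * Q ^ n) :
    Summable (fun n => (vol n : ℂ) * (φ n * φ' n)) ∧ ∃ x y S : ℂ,
      (1 + (t : ℂ) ^ 4 * q) * (x - β) = (1 - t ^ 2 * β) * (q * t ^ 2 + β⁻¹) ∧
      (1 + (t : ℂ) ^ 2 * J) * (y - γ) = (1 - t * γ) * (J * t + γ⁻¹) ∧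
      (1 - (t : ℂ) * (β * γ)) * (1 - (t : ℂ) * (β * γ⁻¹)) * (1 - (t : ℂ) * (β⁻¹ * γ)) *
        (1 - (t : ℂ) * (β⁻¹ * γ⁻¹)) * S =
      1 - t * (β + β⁻¹) * (γ + γ⁻¹) + t * (x * y) * (1 - t ^ 2)
        + t ^ 2 * ((β + β⁻¹) ^ 2 + (γ + γ⁻¹) ^ 2 - (β + β⁻¹) * x - (γ + γ⁻¹) * y - 1)
        + t ^ 3 * ((β + β⁻¹) * y + (γ + γ⁻¹) * x - (β + β⁻¹) * (γ + γ⁻¹)) ∧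
      ∑' n, (vol n : ℂ) * (φ n * φ' n) = 1 + (1 + (t : ℂ) ^ 2 * J) * (S - 1) := by
  have hQ0 : (Q : ℂ) ≠ 0 := Nat.cast_ne_zero.mpr hQ.ne'
  have ht0 : (t : ℂ) ≠ 0 := Complex.ofReal_ne_zero.mpr ht.ne'
  have hQt : (Q : ℂ) = ((t : ℂ) ^ 2)⁻¹ := eq_inv_of_mul_eq_one_right htQ
  set x : ℕ → ℂ := fun n => (Q : ℂ) ^ n * φ n with hx
  set y : ℕ → ℂ := fun n => (t : ℂ)⁻¹ ^ n * φ' n with hy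
  have hxr : ∀ n, x (n + 2) = (β + β⁻¹) * x (n + 1) - x n := by
    intro n
    have := h2 n
    simp only [hx]
    have e : (Q : ℂ) ^ 2 * φ (n + 2) = Q * (β + β⁻¹) * φ (n + 1) - φ n := by
      field_simp at this ⊢
      linear_combination this
    rw [pow_add, mul_assoc, e]; ring
  have hyr : ∀ n, y (n + 2) = (γ + γ⁻¹) * y (n + 1) - y n := by
    intro n
    have := h2' n
    rw [hQt] at this
    simp only [hy]
    have e : (t : ℂ)⁻¹ ^ 2 * φ' (n + 2) = (t : ℂ)⁻¹ * (γ + γ⁻¹) * φ' (n + 1) - φ' n := by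
      field_simp at this ⊢
      linear_combination this
    rw [pow_add, mul_assoc, e]; ring
  obtain ⟨hs, hsum⟩ := tsum_rec_mul hβ hγ ht.le hlt hxr hyr (by simp [hx, h0]) (by simp [hy, h0'])
  have hterm : ∀ n, (vol (n + 1) : ℂ) * (φ (n + 1) * φ' (n + 1))
      = (1 + (t : ℂ) ^ 2 * J) * ((t : ℂ) ^ (n + 1) * (x (n + 1) * y (n + 1))) := by
    intro n
    have e : (t : ℂ) ^ (n + 1) * (t : ℂ)⁻¹ ^ (n + 1) = 1 := by
      rw [← mul_pow, mul_inv_cancel₀ ht0, one_pow]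
    rw [hv]
    push_cast
    calc _ = ((Q : ℂ) + J) * Q ^ n * (φ (n + 1) * φ' (n + 1)) *
          ((t : ℂ) ^ (n + 1) * (t : ℂ)⁻¹ ^ (n + 1)) := by rw [e, mul_one]
      _ = ((Q : ℂ) + ((t : ℂ) ^ 2 * Q) * J) * Q ^ n * (φ (n + 1) * φ' (n + 1)) *
          ((t : ℂ) ^ (n + 1) * (t : ℂ)⁻¹ ^ (n + 1)) := by rw [htQ, one_mul]
      _ = _ := by simp only [hx, hy]; ring
  have hs1 : Summable fun n => (vol (n + 1) : ℂ) * (φ (n + 1) * φ' (n + 1)) := by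
    simp only [hterm]
    exact ((summable_nat_add_iff 1).mpr hs).mul_left _
  have hs2 := (summable_nat_add_iff (f := fun n => (vol n : ℂ) * (φ n * φ' n)) 1).mp hs1
  refine ⟨hs2, x 1, y 1, _, ?_, ?_, hsum, ?_⟩
  · simp only [hx, pow_one]
    rw [hQt] at h1 ⊢
    field_simp at h1 ⊢
    linear_combination h1
  · simp only [hy, pow_one]
    rw [hQt] at h1'
    field_simp at h1' ⊢
    linear_combination h1'
  · rw [hs2.tsum_eq_zero_add, hs.tsum_eq_zero_add]
    simp only [hterm]
    rw [tsum_mul_left]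
    simp [hv0, h0, h0', hx, hy]

/-- The value of the series when `q_E = q_F²`, with `t = 1 / q_F`. -/
theorem value_unramified {t : ℝ} {β γ x y S : ℂ} (hβ : β ≠ 0) (hγ : γ ≠ 0) (ht0 : 0 < t)
    (hx : (1 + (t : ℂ) ^ 3) * (x - β) = (1 - t ^ 2 * β) * (t + β⁻¹))
    (hy : (1 + (t : ℂ)) * (y - γ) = (1 - t * γ) * (1 + γ⁻¹))
    (hD : (1 - (t : ℂ) * (β * γ)) * (1 - (t : ℂ) * (β * γ⁻¹)) * (1 - (t : ℂ) * (β⁻¹ * γ)) *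
        (1 - (t : ℂ) * (β⁻¹ * γ⁻¹)) * S =
      1 - t * (β + β⁻¹) * (γ + γ⁻¹) + t * (x * y) * (1 - t ^ 2)
        + t ^ 2 * ((β + β⁻¹) ^ 2 + (γ + γ⁻¹) ^ 2 - (β + β⁻¹) * x - (γ + γ⁻¹) * y - 1)
        + t ^ 3 * ((β + β⁻¹) * y + (γ + γ⁻¹) * x - (β + β⁻¹) * (γ + γ⁻¹))) :
    (1 + (1 + (t : ℂ)) * (S - 1)) * ((1 - (t : ℂ) * (β * γ)) * (1 - (t : ℂ) * (β * γ⁻¹)) *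
      (1 - (t : ℂ) * (β⁻¹ * γ)) * (1 - (t : ℂ) * (β⁻¹ * γ⁻¹))) * (1 + (t : ℂ) ^ 3) =
    (1 - (t : ℂ) ^ 2) * (1 - t ^ 2 * β) * (1 - t ^ 2 * β⁻¹) * (1 + t * β) * (1 + t * β⁻¹) := by
  have n1 : (1 + (t : ℂ)) ≠ 0 := by exact_mod_cast (by positivity : (1 + t : ℝ) ≠ 0)
  have n3 : (1 + (t : ℂ) ^ 3) ≠ 0 := by exact_mod_cast (by positivity : (1 + t ^ 3 : ℝ) ≠ 0)
  have ex : x = β + (1 - t ^ 2 * β) * (t + β⁻¹) / (1 + (t : ℂ) ^ 3) := by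
    field_simp at hx ⊢; linear_combination hx
  have ey : y = γ + (1 - t * γ) * (1 + γ⁻¹) / (1 + (t : ℂ)) := by
    field_simp at hy ⊢; linear_combination hy
  have e : (1 + (1 + (t : ℂ)) * (S - 1)) * ((1 - (t : ℂ) * (β * γ)) * (1 - (t : ℂ) * (β * γ⁻¹)) *
      (1 - (t : ℂ) * (β⁻¹ * γ)) * (1 - (t : ℂ) * (β⁻¹ * γ⁻¹))) =
    - t * ((1 - (t : ℂ) * (β * γ)) * (1 - (t : ℂ) * (β * γ⁻¹)) *
      (1 - (t : ℂ) * (β⁻¹ * γ)) * (1 - (t : ℂ) * (β⁻¹ * γ⁻¹))) + (1 + (t : ℂ)) *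
      (1 - t * (β + β⁻¹) * (γ + γ⁻¹) + t * (x * y) * (1 - t ^ 2)
        + t ^ 2 * ((β + β⁻¹) ^ 2 + (γ + γ⁻¹) ^ 2 - (β + β⁻¹) * x - (γ + γ⁻¹) * y - 1)
        + t ^ 3 * ((β + β⁻¹) * y + (γ + γ⁻¹) * x - (β + β⁻¹) * (γ + γ⁻¹))) := by
    linear_combination (1 + (t : ℂ)) * hD
  rw [e, ex, ey]
  clear e ex ey hD hx hy
  field_simp
  ring

/-- The value of the series when `q_E = q_F`, with `t = 1 / √q_F`. -/
theorem value_ramified {t : ℝ} {β γ x y S : ℂ} (hβ : β ≠ 0) (hγ : γ ≠ 0) (ht0 : 0 < t)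
    (hx : (1 + (t : ℂ) ^ 2) * (x - β) = (1 - t ^ 2 * β) * (1 + β⁻¹))
    (hy : (1 + (t : ℂ) ^ 2) * (y - γ) = (1 - t * γ) * (t + γ⁻¹))
    (hD : (1 - (t : ℂ) * (β * γ)) * (1 - (t : ℂ) * (β * γ⁻¹)) * (1 - (t : ℂ) * (β⁻¹ * γ)) *
        (1 - (t : ℂ) * (β⁻¹ * γ⁻¹)) * S =
      1 - t * (β + β⁻¹) * (γ + γ⁻¹) + t * (x * y) * (1 - t ^ 2)
        + t ^ 2 * ((β + β⁻¹) ^ 2 + (γ + γ⁻¹) ^ 2 - (β + β⁻¹) * x - (γ + γ⁻¹) * y - 1)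
        + t ^ 3 * ((β + β⁻¹) * y + (γ + γ⁻¹) * x - (β + β⁻¹) * (γ + γ⁻¹))) :
    (1 + (1 + (t : ℂ) ^ 2) * (S - 1)) * ((1 - (t : ℂ) * (β * γ)) * (1 - (t : ℂ) * (β * γ⁻¹)) *
      (1 - (t : ℂ) * (β⁻¹ * γ)) * (1 - (t : ℂ) * (β⁻¹ * γ⁻¹))) * (1 + (t : ℂ) ^ 2) =
    (1 - (t : ℂ) ^ 2) * (1 - t ^ 2 * β) * (1 - t ^ 2 * β⁻¹) * (1 + t * γ) * (1 + t * γ⁻¹) := by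
  have n2 : (1 + (t : ℂ) ^ 2) ≠ 0 := by exact_mod_cast (by positivity : (1 + t ^ 2 : ℝ) ≠ 0)
  have ex : x = β + (1 - t ^ 2 * β) * (1 + β⁻¹) / (1 + (t : ℂ) ^ 2) := by
    field_simp at hx ⊢; linear_combination hx
  have ey : y = γ + (1 - t * γ) * (t + γ⁻¹) / (1 + (t : ℂ) ^ 2) := by
    field_simp at hy ⊢; linear_combination hy
  have e : (1 + (1 + (t : ℂ) ^ 2) * (S - 1)) * ((1 - (t : ℂ) * (β * γ)) *
      (1 - (t : ℂ) * (β * γ⁻¹)) * (1 - (t : ℂ) * (β⁻¹ * γ)) * (1 - (t : ℂ) * (β⁻¹ * γ⁻¹))) =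
    - t ^ 2 * ((1 - (t : ℂ) * (β * γ)) * (1 - (t : ℂ) * (β * γ⁻¹)) *
      (1 - (t : ℂ) * (β⁻¹ * γ)) * (1 - (t : ℂ) * (β⁻¹ * γ⁻¹))) + (1 + (t : ℂ) ^ 2) *
      (1 - t * (β + β⁻¹) * (γ + γ⁻¹) + t * (x * y) * (1 - t ^ 2)
        + t ^ 2 * ((β + β⁻¹) ^ 2 + (γ + γ⁻¹) ^ 2 - (β + β⁻¹) * x - (γ + γ⁻¹) * y - 1)
        + t ^ 3 * ((β + β⁻¹) * y + (γ + γ⁻¹) * x - (β + β⁻¹) * (γ + γ⁻¹))) := by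
    linear_combination (1 + (t : ℂ) ^ 2) * hD
  rw [e, ex, ey]
  clear e ex ey hD hx hy
  field_simp
  ring

/-! ### Evaluation of the `L`-factors -/

section LFactors

variable {F E : Type*} [Field F] [ValuativeRel F] [TopologicalSpace F]
  [IsNonarchimedeanLocalField F] [Field E] [ValuativeRel E] [TopologicalSpace E]
  [IsNonarchimedeanLocalField E] [Algebra F E] [ValuativeExtension F E]
  {c : E ≃ₐ[F] E} {δ : E}

theorem charL_of_isUnram {K : Type*} [Field K] [ValuativeRel K] [TopologicalSpace K]
    [IsNonarchimedeanLocalField K] {ψ : Kˣ → ℂ} (hψ : IsUnram ψ) (s : ℂ) :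
    charL ψ s = (1 - ψ (unif K) * (resCard K : ℂ) ^ (-s))⁻¹ := if_pos hψ

theorem charL_of_not_isUnram {K : Type*} [Field K] [ValuativeRel K] [TopologicalSpace K]
    [IsNonarchimedeanLocalField K] {ψ : Kˣ → ℂ} (hψ : ¬ IsUnram ψ) (s : ℂ) :
    charL ψ s = 1 := if_neg hψ

theorem isUnram_one {K : Type*} [Field K] [ValuativeRel K] : IsUnram fun _ : Kˣ => (1 : ℂ) :=
  fun _ _ => rfl

theorem isUnram_mul {K : Type*} [Field K] [ValuativeRel K] {ψ ψ' : Kˣ → ℂ} (h : IsUnram ψ)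
    (h' : IsUnram ψ') : IsUnram fun x => ψ x * ψ' x := fun u hu => by
  simp only [h u hu, h' u hu, mul_one]

theorem isUnram_inv {χ : Eˣ →* ℂˣ} (h : IsUnram fun x => (χ x : ℂ)) :
    IsUnram fun x => (χ⁻¹ x : ℂ) := fun u hu => by
  have h1 : (χ u : ℂ) = 1 := h u hu
  simp [h1]

theorem isUnram_resChar {χ : Eˣ →* ℂˣ} (h : IsUnram fun x => (χ x : ℂ)) :
    IsUnram (resChar F χ) := fun u hu => h _ ((val_map_eq_one_iff (u : F)).mpr hu)

theorem resChar_unif {χ : Eˣ →* ℂˣ} (h : IsUnram fun x => (χ x : ℂ)) {k : ℕ}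
    (hk : valuation E (algebraMap F E (unif F)) = unifVal E ^ k) :
    resChar F χ (unif F) = (χ (unif E) : ℂ) ^ k := by
  have := isUnram_apply h (x := Units.map (algebraMap F E).toMonoidHom (unif F)) (n := k)
    (by rw [zpow_natCast]; exact hk)
  rw [zpow_natCast] at this
  exact this

theorem prodL_half {χ ρ : Eˣ →* ℂˣ} (hχ : IsUnram fun x => (χ x : ℂ))
    (hρ : IsUnram fun x => (ρ x : ℂ)) {β γ t : ℂ} (hβ : (χ (unif E) : ℂ) = β)
    (hγ : (ρ (unif E) : ℂ) = γ) (ht : (resCard E : ℂ) ^ (-(1 / 2) : ℂ) = t) :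
    prodL χ ρ (1 / 2) = ((1 - t * (β * γ)) * (1 - t * (β * γ⁻¹)) * (1 - t * (β⁻¹ * γ)) *
      (1 - t * (β⁻¹ * γ⁻¹)) * (1 - t * γ) * (1 - t * γ⁻¹))⁻¹ := by
  have hχ' := isUnram_inv hχ
  have hρ' := isUnram_inv hρ
  have hm : ∀ {ψ ψ' : Eˣ →* ℂˣ}, IsUnram (fun x => (ψ x : ℂ)) → IsUnram (fun x => (ψ' x : ℂ)) →
      IsUnram fun x => ((ψ * ψ') x : ℂ) := fun h h' => by
    simpa using isUnram_mul h h'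
  rw [prodL, charL_of_isUnram (hm hχ hρ), charL_of_isUnram (hm hχ hρ'),
    charL_of_isUnram (hm hχ' hρ), charL_of_isUnram (hm hχ' hρ'), charL_of_isUnram hρ,
    charL_of_isUnram hρ', ht]
  simp only [MonoidHom.mul_apply, MonoidHom.inv_apply, Units.val_mul, Units.val_inv_eq_inv_val, hβ,
    hγ, ← mul_inv, mul_comm _ t]

theorem quadChar_sq (x : Fˣ) : quadChar F E x ^ 2 = 1 := by
  unfold quadChar; split_ifs <;> norm_num

theorem quadChar_cube (x : Fˣ) : quadChar F E x ^ 3 = quadChar F E x := by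
  rw [pow_succ, quadChar_sq, one_mul]

theorem prod_charL_quadChar : ∏ i ∈ Finset.Icc (1 : ℕ) 3,
      charL (fun x : Fˣ => quadChar F E x ^ i) (i : ℂ)
    = charL (quadChar F E) 1 * charL (fun _ : Fˣ => 1) 2 * charL (quadChar F E) 3 := by
  have e : Finset.Icc (1 : ℕ) 3 = {1, 2, 3} := by decide
  rw [e]
  simp [quadChar_sq, quadChar_cube, mul_assoc]

theorem cpow_neg_half {Q : ℂ} {t : ℝ} (ht0 : 0 < t) (hQ : Q = ((t : ℂ) ^ 2)⁻¹) :
    Q ^ (-(1 / 2) : ℂ) = t := by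
  have : Q = ((((t ^ 2)⁻¹ : ℝ)) : ℂ) := by rw [hQ]; push_cast; rfl
  rw [this, show (-(1 / 2) : ℂ) = ((-(1 / 2) : ℝ) : ℂ) by push_cast; rfl,
    ← Complex.ofReal_cpow (by positivity)]
  congr 1
  rw [← Real.rpow_natCast, ← Real.rpow_neg ht0.le, ← Real.rpow_mul ht0.le]
  norm_num

theorem unramified_ratio {D g₁ g₂ a k B₁ B₂ C₁ C₂ e : ℂ} (hk : k ≠ 0) (ha : a ≠ 0) (h₁ : g₁ ≠ 0)
    (h₂ : g₂ ≠ 0) : (D * g₁ * g₂)⁻¹ / ((k * a)⁻¹ * a⁻¹ * B₁⁻¹ * B₂⁻¹ * C₁⁻¹ * C₂⁻¹ *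
      (k⁻¹ * a⁻¹ * g₁⁻¹ * g₂⁻¹)) * (a⁻¹ * (k * a)⁻¹ * e⁻¹)
    = k * a * B₁ * B₂ * C₁ * C₂ / (D * e) := by
  simp only [div_eq_mul_inv, mul_inv, inv_inv]
  field_simp

theorem ramified_ratio {D g₁ g₂ a k B₁ B₂ C₁ C₂ : ℂ} (hk : k ≠ 0) (ha : a ≠ 0) (h₁ : g₁ ≠ 0)
    (h₂ : g₂ ≠ 0) : (D * g₁ * g₂)⁻¹ / (k⁻¹ * 1 * B₁⁻¹ * B₂⁻¹ * 1 * 1 *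
      (k⁻¹ * 1 * (g₁ * C₁)⁻¹ * (g₂ * C₂)⁻¹)) * (1 * (k * a)⁻¹ * 1)
    = k * B₁ * B₂ * C₁ * C₂ / (D * a) := by
  simp only [div_eq_mul_inv, mul_inv, inv_inv]
  field_simp

variable (hq : QuadFacts c δ)

include hq

/-- The ratio of `L`-values in the unramified case, with `t = 1 / q_F`. -/
theorem scrL_of_unit (h : valuation E δ = 1) {χ ρ : Eˣ →* ℂˣ} (hχ : IsUnram fun x => (χ x : ℂ))
    (hρ : IsUnram fun x => (ρ x : ℂ)) {β γ : ℂ} (hβ : (χ (unif E) : ℂ) = β)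
    (hγ : (ρ (unif E) : ℂ) = γ) {t : ℝ} (ht0 : 0 < t) (ht1 : t < 1) (ht : t * resCard F = 1)
    (h1 : 1 - (t : ℂ) * γ ≠ 0) (h2 : 1 - (t : ℂ) * γ⁻¹ ≠ 0) :
    scrL F χ ρ = ((1 - (t : ℂ) ^ 2) * (1 - t ^ 2 * β) * (1 - t ^ 2 * β⁻¹) * (1 + t * β) *
      (1 + t * β⁻¹)) / ((1 - t * (β * γ)) * (1 - t * (β * γ⁻¹)) * (1 - t * (β⁻¹ * γ)) *
      (1 - t * (β⁻¹ * γ⁻¹)) * (1 + t ^ 3)) := by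
  have hqF : (resCard F : ℂ) = (t : ℂ)⁻¹ := by
    refine eq_inv_of_mul_eq_one_right ?_
    exact_mod_cast ht
  have hQ : (resCard E : ℂ) = ((t : ℂ) ^ 2)⁻¹ := by
    rw [hq.resCard_of_unit h]; push_cast; rw [hqF, inv_pow]
  have hhalf := cpow_neg_half ht0 hQ
  have hval : valuation E (algebraMap F E (unif F)) = unifVal E ^ 1 := by
    rw [hq.unif_base_of_unit h, pow_one]
  have hu := hq.isUnram_quadChar h
  have hχ' := isUnram_inv hχ
  have hρ' := isUnram_inv hρ
  have c1 := resChar_unif hχ hval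
  have c2 := resChar_unif hχ' hval
  have c3 := resChar_unif hρ hval
  have c4 := resChar_unif hρ' hval
  have t0 : (t : ℂ) ≠ 0 := Complex.ofReal_ne_zero.mpr ht0.ne'
  have n1 : 1 + (t : ℂ) ≠ 0 := by exact_mod_cast (by positivity : (1 + t : ℝ) ≠ 0)
  have n2 : 1 - (t : ℂ) ≠ 0 := by
    rw [sub_ne_zero]; exact_mod_cast ht1.ne'
  have n3 : 1 - (t : ℂ) ^ 2 ≠ 0 := by
    rw [show 1 - (t : ℂ) ^ 2 = (1 + t) * (1 - t) by ring]; exact mul_ne_zero n1 n2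
  rw [scrL, prodL_half hχ hρ hβ hγ hhalf, prod_charL_quadChar, adL2, adL3,
    charL_of_isUnram isUnram_one, charL_of_isUnram isUnram_one, charL_of_isUnram isUnram_one,
    charL_of_isUnram hu, charL_of_isUnram hu, charL_of_isUnram hχ, charL_of_isUnram hχ',
    charL_of_isUnram (isUnram_mul hu (isUnram_resChar hχ)),
    charL_of_isUnram (isUnram_mul hu (isUnram_resChar hχ')),
    charL_of_isUnram (isUnram_resChar hρ), charL_of_isUnram (isUnram_resChar hρ'),
    c1, c2, c3, c4, hq.quadChar_unif h]
  simp only [MonoidHom.inv_apply, Units.val_inv_eq_inv_val, hβ, hγ, pow_one]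
  have p2 : (resCard F : ℂ) ^ (-2 : ℂ) = (t : ℂ) ^ 2 := by
    rw [Complex.cpow_neg, show (2 : ℂ) = ((2 : ℕ) : ℂ) by norm_num, Complex.cpow_natCast, hqF,
      inv_pow, inv_inv]
  have p3 : (resCard F : ℂ) ^ (-3 : ℂ) = (t : ℂ) ^ 3 := by
    rw [Complex.cpow_neg, show (3 : ℂ) = ((3 : ℕ) : ℂ) by norm_num, Complex.cpow_natCast, hqF,
      inv_pow, inv_inv]
  rw [p2, p3, Complex.cpow_neg_one, Complex.cpow_neg_one, hQ, hqF, inv_inv, inv_inv]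
  rw [show 1 - γ * (t : ℂ) = 1 - t * γ by ring, show 1 - γ⁻¹ * (t : ℂ) = 1 - t * γ⁻¹ by ring,
    show 1 - β * (t : ℂ) ^ 2 = 1 - t ^ 2 * β by ring,
    show 1 - β⁻¹ * (t : ℂ) ^ 2 = 1 - t ^ 2 * β⁻¹ by ring,
    show 1 - -1 * β * (t : ℂ) = 1 + t * β by ring,
    show 1 - -1 * β⁻¹ * (t : ℂ) = 1 + t * β⁻¹ by ring,
    show 1 - -1 * (t : ℂ) = 1 + t by ring, show 1 - -1 * (t : ℂ) ^ 3 = 1 + t ^ 3 by ring,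
    one_mul, one_mul, show 1 - (t : ℂ) ^ 2 = (1 - t) * (1 + t) by ring]
  generalize (1 - t * (β * γ)) * (1 - t * (β * γ⁻¹)) * (1 - t * (β⁻¹ * γ)) *
    (1 - t * (β⁻¹ * γ⁻¹)) = D at *
  exact unramified_ratio n2 n1 h1 h2

/-- In the ramified case twisting by the quadratic character destroys unramifiedness. -/
theorem not_isUnram_of_lt (h : valuation E δ < 1) {ψ : Fˣ → ℂ} (hψ : IsUnram ψ) :
    ¬ IsUnram fun x => quadChar F E x * ψ x := by
  intro H
  obtain ⟨u, hu, hε⟩ := hq.exists_quadChar_eq_neg_one h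
  have : quadChar F E u * ψ u = 1 := H u hu
  rw [hε, hψ u hu] at this
  norm_num at this

/-- The ratio of `L`-values in the ramified case, with `t = 1 / √q_F`. -/
theorem scrL_of_lt (h : valuation E δ < 1) {χ ρ : Eˣ →* ℂˣ} (hχ : IsUnram fun x => (χ x : ℂ))
    (hρ : IsUnram fun x => (ρ x : ℂ)) {β γ : ℂ} (hβ : (χ (unif E) : ℂ) = β)
    (hγ : (ρ (unif E) : ℂ) = γ) {t : ℝ} (ht0 : 0 < t) (ht1 : t < 1) (ht : t ^ 2 * resCard F = 1)
    (h1 : 1 - (t : ℂ) * γ ≠ 0) (h2 : 1 - (t : ℂ) * γ⁻¹ ≠ 0) :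
    scrL F χ ρ = ((1 - (t : ℂ) ^ 2) * (1 - t ^ 2 * β) * (1 - t ^ 2 * β⁻¹) * (1 + t * γ) *
      (1 + t * γ⁻¹)) / ((1 - t * (β * γ)) * (1 - t * (β * γ⁻¹)) * (1 - t * (β⁻¹ * γ)) *
      (1 - t * (β⁻¹ * γ⁻¹)) * (1 + t ^ 2)) := by
  have hqF : (resCard F : ℂ) = ((t : ℂ) ^ 2)⁻¹ := by
    refine eq_inv_of_mul_eq_one_right ?_
    exact_mod_cast ht
  have hQ : (resCard E : ℂ) = ((t : ℂ) ^ 2)⁻¹ := by rw [hq.resCard_of_lt h, hqF]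
  have hhalf := cpow_neg_half ht0 hQ
  have hval := hq.unif_base_of_lt h
  have hn : ¬ IsUnram (quadChar F E) := by simpa using not_isUnram_of_lt hq h isUnram_one
  have hχ' := isUnram_inv hχ
  have hρ' := isUnram_inv hρ
  have c3 := resChar_unif hρ hval
  have c4 := resChar_unif hρ' hval
  have n1 : 1 + (t : ℂ) ^ 2 ≠ 0 := by exact_mod_cast (by positivity : (1 + t ^ 2 : ℝ) ≠ 0)
  have n2 : 1 - (t : ℂ) ^ 2 ≠ 0 := by
    rw [sub_ne_zero]; exact_mod_cast (pow_lt_one₀ ht0.le ht1 two_ne_zero).ne'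
  rw [scrL, prodL_half hχ hρ hβ hγ hhalf, prod_charL_quadChar, adL2, adL3,
    charL_of_isUnram isUnram_one, charL_of_isUnram isUnram_one, charL_of_isUnram isUnram_one,
    charL_of_not_isUnram hn, charL_of_not_isUnram hn, charL_of_isUnram hχ, charL_of_isUnram hχ',
    charL_of_not_isUnram (not_isUnram_of_lt hq h (isUnram_resChar hχ)),
    charL_of_not_isUnram (not_isUnram_of_lt hq h (isUnram_resChar hχ')),
    charL_of_isUnram (isUnram_resChar hρ), charL_of_isUnram (isUnram_resChar hρ'), c3, c4]
  simp only [MonoidHom.inv_apply, Units.val_inv_eq_inv_val, hβ, hγ]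
  have p2 : (resCard F : ℂ) ^ (-2 : ℂ) = (t : ℂ) ^ 4 := by
    rw [Complex.cpow_neg, show (2 : ℂ) = ((2 : ℕ) : ℂ) by norm_num, Complex.cpow_natCast, hqF,
      inv_pow, inv_inv, ← pow_mul]
  rw [p2, Complex.cpow_neg_one, Complex.cpow_neg_one, hQ, hqF, inv_inv]
  rw [show 1 - γ ^ 2 * (t : ℂ) ^ 2 = (1 - t * γ) * (1 + t * γ) by ring,
    show 1 - γ⁻¹ ^ 2 * (t : ℂ) ^ 2 = (1 - t * γ⁻¹) * (1 + t * γ⁻¹) by ring,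
    show 1 - β * (t : ℂ) ^ 2 = 1 - t ^ 2 * β by ring,
    show 1 - β⁻¹ * (t : ℂ) ^ 2 = 1 - t ^ 2 * β⁻¹ by ring,
    one_mul, show 1 - 1 * (t : ℂ) ^ 4 = (1 - t ^ 2) * (1 + t ^ 2) by ring]
  generalize (1 - t * (β * γ)) * (1 - t * (β * γ⁻¹)) * (1 - t * (β⁻¹ * γ)) *
    (1 - t * (β⁻¹ * γ⁻¹)) = D at *
  exact ramified_ratio n2 n1 h1 h2

end LFactors

/-! ### The integral of matrix coefficients -/

section Integral

variable {F E : Type*} [Field F] [ValuativeRel F] [TopologicalSpace F]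
  [IsNonarchimedeanLocalField F] [Field E] [ValuativeRel E] [TopologicalSpace E]
  [IsNonarchimedeanLocalField E] [Algebra F E] [ValuativeExtension F E]
  {c : E ≃ₐ[F] E} {δ : E} (hq : QuadFacts c δ)

include hq

theorem iota_mem {κ : U2 c δ} (hκ : κ ∈ integralPts (U2 c δ)) :
    iota c δ κ ∈ integralPts (U3 c δ) := by
  rw [mem_integralPts_iff hq.val_conj (det_form2 hq.delta_ne)] at hκ
  rw [mem_integralPts_iff hq.val_conj (det_form3 hq.delta_ne)]
  intro i j
  rw [entry_iota]
  fin_cases i <;> fin_cases j <;> simp [hκ]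

/-- The integral over the unitary group in two variables of a function that is constant on the
double cosets of a conjugate of the integral points. -/
theorem integral_of_shells [MeasurableSpace (U2 c δ)] [BorelSpace (U2 c δ)]
    {μ : Measure (U2 c δ)} [μ.IsMulLeftInvariant] (h₀ : U2 c δ)
    (hμ : μ (((integralPts (U2 c δ)).map (MulAut.conj h₀).toMonoidHom : Subgroup (U2 c δ)) :
      Set (U2 c δ)) = 1) {g : U2 c δ → ℂ} {a : ℕ → ℂ}
    (hg : ∀ n, ∀ x ∈ shell c δ n, g (h₀ * x * h₀⁻¹) = a n) {vol : ℕ → ℝ} (hv0 : vol 0 = 1)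
    (hv : ∀ n, vol (n + 1) = ((resCard E : ℝ) + halfIndex F δ) * (resCard E : ℝ) ^ n)
    (hs : Summable fun n => (vol n : ℂ) * a n) :
    Integrable g μ ∧ ∫ x, g x ∂μ = ∑' n, (vol n : ℂ) * a n := by
  let e : U2 c δ ≃ᵐ U2 c δ := (MeasurableEquiv.mulLeft h₀⁻¹).trans (MeasurableEquiv.mulRight h₀)
  have he : ∀ x, e x = h₀⁻¹ * x * h₀ := fun x => rfl
  have hinv : (μ.map e).IsMulLeftInvariant := by
    have h1 : ⇑e = (MulAut.conj h₀⁻¹).toMonoidHom.toMulHom := by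
      ext1 x
      change h₀⁻¹ * x * h₀ = h₀⁻¹ * x * h₀⁻¹⁻¹
      rw [inv_inv]
    have h2 := isMulLeftInvariant_map (μ := μ) (MulAut.conj h₀⁻¹).toMonoidHom.toMulHom
      (h1 ▸ e.measurable) (MulAut.conj h₀⁻¹).surjective
    rwa [← h1] at h2
  have hK : μ.map e (integralPts (U2 c δ) : Set (U2 c δ)) = 1 := by
    rw [e.map_apply, ← hμ]
    congr 1
    ext x
    simp only [Set.mem_preimage, SetLike.mem_coe, Subgroup.mem_map, he]
    constructor
    · intro hx
      refine ⟨_, hx, ?_⟩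
      change h₀ * (h₀⁻¹ * x * h₀) * h₀⁻¹ = x
      group
    · rintro ⟨y, hy, rfl⟩
      change h₀⁻¹ * (h₀ * y * h₀⁻¹) * h₀ ∈ _
      rwa [show h₀⁻¹ * (h₀ * y * h₀⁻¹) * h₀ = y by group]
  have hvol : ∀ n, (μ.map e).real (shell c δ n) = vol n ∧ μ.map e (shell c δ n) ≠ ⊤ := by
    intro n
    rw [measureReal_def]
    cases n with
    | zero => rw [shell_zero hq, hK, hv0]; simp
    | succ n =>
      rw [measure_shell hq hK n, hv]
      refine ⟨by simp [ENNReal.toReal_add], ?_⟩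
      exact ENNReal.mul_ne_top (by simp) (by simp)
  obtain ⟨h1, h2⟩ := integral_of_partition (ν := μ.map e) (S := shell c δ)
    (g := fun y => g (h₀ * y * h₀⁻¹)) (a := a) (measurableSet_shell hq)
    (fun i j hij => Set.disjoint_left.mpr fun x hx hx' => hij (shell_unique hq hx hx'))
    (Set.eq_univ_of_forall fun x => Set.mem_iUnion.mpr (exists_mem_shell hq x))
    (fun n => (hvol n).2) hg (by simpa only [(hvol _).1] using hs)
  have hcomp : ∀ x, g (h₀ * e x * h₀⁻¹) = g x := by
    intro x; rw [he]; congr 1; group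
  rw [integral_map_equiv] at h2
  rw [integrable_map_equiv] at h1
  simp only [hcomp, (hvol _).1] at h2
  refine ⟨?_, h2⟩
  simpa only [Function.comp_def, hcomp] using h1

end Integral

end LocalU3U2

end

open LocalU3U2 in
theorem mainTheorem11
    {F E : Type*} [Field F] [ValuativeRel F] [TopologicalSpace F] [IsNonarchimedeanLocalField F]
    [Field E] [ValuativeRel E] [TopologicalSpace E] [IsNonarchimedeanLocalField E]
    [Algebra F E] [ValuativeExtension F E] (hquad : Module.finrank F E = 2)
    (c : E ≃ₐ[F] E) (hc : c ≠ AlgEquiv.refl)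
    (δ : E) (hδ : LocalU3U2.IsDifferentGen c δ)
    -- the special maximal compact subgroups and the Haar measure of `H`
    (K' : Subgroup (LocalU3U2.U2 c δ)) (K : Subgroup (LocalU3U2.U3 c δ))
    (hK : LocalU3U2.IsSpecialPair c δ K' K)
    [MeasurableSpace (LocalU3U2.U2 c δ)] [BorelSpace (LocalU3U2.U2 c δ)]
    (μ : Measure (LocalU3U2.U2 c δ)) [μ.IsHaarMeasure] (hμ : μ (K' : Set (LocalU3U2.U2 c δ)) = 1)
    -- the unramified characters, in the range of absolute convergence
    (χ ρ : Eˣ →* ℂˣ) (hχ : LocalU3U2.IsUnram fun x => (χ x : ℂ))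
    (hρ : LocalU3U2.IsUnram fun x => (ρ x : ℂ))
    (hconv : max ‖(χ (LocalU3U2.unif E) : ℂ)‖ ‖(χ (LocalU3U2.unif E) : ℂ)‖⁻¹ *
        max ‖(ρ (LocalU3U2.unif E) : ℂ)‖ ‖(ρ (LocalU3U2.unif E) : ℂ)‖⁻¹ <
      Real.sqrt (LocalU3U2.resCard E))
    -- the spherical vectors
    (f : LocalU3U2.PS3 c δ χ) (hf : ∀ k ∈ K, f.1 k = 1)
    (f₁ : LocalU3U2.PS3 c δ χ⁻¹) (hf₁ : ∀ k ∈ K, f₁.1 k = 1)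
    (f' : LocalU3U2.PS2 c δ ρ) (hf' : ∀ k ∈ K', f'.1 k = 1)
    (f₁' : LocalU3U2.PS2 c δ ρ⁻¹) (hf₁' : ∀ k ∈ K', f₁'.1 k = 1)
    -- the invariant pairings, normalized on the spherical vectors
    (B : LocalU3U2.PS3 c δ χ →ₗ[ℂ] LocalU3U2.PS3 c δ χ⁻¹ →ₗ[ℂ] ℂ)
    (hB : LocalU3U2.IsInvariantPairing B) (hB1 : B f f₁ = 1)
    (B' : LocalU3U2.PS2 c δ ρ →ₗ[ℂ] LocalU3U2.PS2 c δ ρ⁻¹ →ₗ[ℂ] ℂ)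
    (hB' : LocalU3U2.IsInvariantPairing B') (hB1' : B' f' f₁' = 1) :
    Integrable (fun h : LocalU3U2.U2 c δ =>
        LocalU3U2.matCoeff B f f₁ (LocalU3U2.iota c δ h) * LocalU3U2.matCoeff B' f' f₁' h) μ ∧
      ∫ h : LocalU3U2.U2 c δ,
        LocalU3U2.matCoeff B f f₁ (LocalU3U2.iota c δ h) * LocalU3U2.matCoeff B' f' f₁' h ∂μ
        = LocalU3U2.scrL F χ ρ := by
  have hq := quadFacts hquad hc hδ
  obtain ⟨h₀, rfl, rfl⟩ := hK
  have hmem : ∀ κ ∈ integralPts (U2 c δ), h₀ * κ * h₀⁻¹ ∈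
      (integralPts (U2 c δ)).map (MulAut.conj h₀).toMonoidHom := fun κ hκ => ⟨κ, hκ, rfl⟩
  have hmem3 : ∀ κ ∈ integralPts (U3 c δ), iota c δ h₀ * κ * (iota c δ h₀)⁻¹ ∈
      (integralPts (U3 c δ)).map (MulAut.conj (iota c δ h₀)).toMonoidHom :=
    fun κ hκ => ⟨κ, hκ, rfl⟩
  have hQ1 := resCard_gt_one E
  have hQ0 : 0 < resCard E := by omega
  have hQR : (0 : ℝ) < resCard E := Nat.cast_pos.mpr hQ0
  have hQC : (resCard E : ℂ) ≠ 0 := Nat.cast_ne_zero.mpr hQ0.ne'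
  have hχ0 : (χ (unif E) : ℂ) ≠ 0 := Units.ne_zero _
  have hρ0 : (ρ (unif E) : ℂ) ≠ 0 := Units.ne_zero _
  obtain ⟨t, htdef⟩ : ∃ t : ℝ, t = (Real.sqrt (resCard E))⁻¹ := ⟨_, rfl⟩
  have hsq : 0 < Real.sqrt (resCard E) := Real.sqrt_pos.mpr hQR
  have ht0 : 0 < t := htdef ▸ inv_pos.mpr hsq
  have htQ : t ^ 2 * resCard E = 1 := by
    rw [htdef, inv_pow, Real.sq_sqrt hQR.le, inv_mul_cancel₀ hQR.ne']
  have htQC : (t : ℂ) ^ 2 * resCard E = 1 := by exact_mod_cast htQ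
  have htC : (t : ℂ) ≠ 0 := Complex.ofReal_ne_zero.mpr ht0.ne'
  have hlt : t * (max ‖(χ (unif E) : ℂ)‖ ‖(χ (unif E) : ℂ)‖⁻¹ *
      max ‖(ρ (unif E) : ℂ)‖ ‖(ρ (unif E) : ℂ)‖⁻¹) < 1 := by
    rw [htdef, inv_mul_lt_iff₀ hsq, mul_one]; exact hconv
  -- the spherical functions: the inducing characters take the values `χ(ϖ) / q_E` and
  -- `ρ(ϖ) / √q_E` at `diag(ϖ, …)`, since `|ϖ| = 1 / q_E`
  obtain ⟨T, T₁, hT, hT₁, M⟩ := rowModel3 hq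
  obtain ⟨φ, hφ0, hφ1, hφ2, hφ⟩ := (M χ).exists_spherical (M χ⁻¹) hq (div_ne_zero hχ0 hQC)
    (fun g => borelRel3_of_bottom hq hχ g) (fun g => borelRel3_of_bottom hq (isUnram_inv hχ) g)
    (fun κ hκ => hf _ (hmem3 κ hκ)) (fun κ hκ => hf₁ _ (hmem3 κ hκ)) hB hB1
    (by rw [hT]; push_cast; exact pow_ne_zero 2 hQC)
  obtain ⟨T', T₁', hT', hT₁', M'⟩ := rowModel2 hq
  have hb' : (ρ (unif E) : ℂ) / (Real.sqrt (resCard E) : ℝ) = t * ρ (unif E) := by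
    rw [htdef, Complex.ofReal_inv, div_eq_mul_inv, mul_comm]
  obtain ⟨φ', hφ0', hφ1', hφ2', hφ'⟩ := (M' ρ).exists_spherical (M' ρ⁻¹) hq
    (b := t * ρ (unif E)) (mul_ne_zero htC hρ0)
    (fun g h0 _ => hb' ▸ borelRel2_of_bottom hq hρ g h0)
    (fun g h0 _ => borelRel2_of_bottom hq (isUnram_inv hρ) g h0)
    (fun κ hκ => hf' _ (hmem κ hκ)) (fun κ hκ => hf₁' _ (hmem κ hκ)) hB' hB1'
    (by rw [hT']; exact hQC)
  rw [hT, hT₁] at hφ1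
  rw [hT] at hφ2
  rw [hT', hT₁'] at hφ1'
  rw [hT'] at hφ2'
  push_cast at hφ1 hφ2
  -- the volumes of the double cosets
  let vol : ℕ → ℝ
    | 0 => 1
    | n + 1 => ((resCard E : ℝ) + halfIndex F δ) * (resCard E : ℝ) ^ n
  obtain ⟨hsum, x, y, S, hx, hy, hD, hval⟩ := tsum_shells (J := halfIndex F δ) (vol := vol)
    hQ0 hχ0 hρ0 ht0 htQC hlt hφ0 hφ0' hφ1 hφ1' hφ2 hφ2' rfl fun _ => rfl
  have hcoef : ∀ n, ∀ h ∈ shell c δ n,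
      matCoeff B f f₁ (iota c δ (h₀ * h * h₀⁻¹)) * matCoeff B' f' f₁' (h₀ * h * h₀⁻¹)
        = φ n * φ' n := by
    intro n h hh
    obtain ⟨κ₁, hκ₁, κ₂, hκ₂, rfl⟩ := exists_cartan hq hh
    rw [hφ' n κ₁ hκ₁ κ₂ hκ₂, ← hφ n _ (iota_mem hq hκ₁) _ (iota_mem hq hκ₂)]
    simp only [map_mul, map_inv]
  obtain ⟨hint, hJ⟩ := integral_of_shells hq h₀ hμ (g := fun h =>
    matCoeff B f f₁ (iota c δ h) * matCoeff B' f' f₁' h) hcoef (vol := vol) rfl (fun _ => rfl) hsum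
  refine ⟨hint, ?_⟩
  rw [hJ, hval]
  obtain ⟨⟨d1, d2, d3, d4⟩, hγ1, hγ2, ht1⟩ := factors_ne_zero hχ0 hρ0 ht0.le hlt
  have hD0 := mul_ne_zero (mul_ne_zero (mul_ne_zero d1 d2) d3) d4
  rcases hq.val_delta_le_one.lt_or_eq with h | h
  · have hJ1 : halfIndex F δ = 1 := if_neg h.ne
    have htF : t ^ 2 * resCard F = 1 := by rw [← hq.resCard_of_lt h]; exact htQ
    have htFC : (t : ℂ) ^ 2 * resCard F = 1 := by exact_mod_cast htF
    rw [hJ1, Nat.cast_one] at hy ⊢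
    rw [mul_one] at hy ⊢
    have n2 : 1 + (t : ℂ) ^ 2 ≠ 0 := by exact_mod_cast (by positivity : (1 + t ^ 2 : ℝ) ≠ 0)
    rw [scrL_of_lt hq h hχ hρ rfl rfl ht0 ht1 htF hγ1 hγ2, eq_div_iff (mul_ne_zero hD0 n2),
      ← mul_assoc]
    refine value_ramified hχ0 hρ0 ht0 ?_ (by rw [hy, one_mul]) hD
    linear_combination hx + ((t : ℂ) ^ 2 * (χ (unif E) - x) + (1 - t ^ 2 * χ (unif E))) * htFC
  · have hJ1 : halfIndex F δ = resCard F := if_pos h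
    have htF : t * resCard F = 1 := by
      have h1 : (t * resCard F) ^ 2 = 1 := by
        rw [mul_pow, ← htQ, hq.resCard_of_unit h]; push_cast; ring
      exact (pow_eq_one_iff_of_nonneg (by positivity) two_ne_zero).mp h1
    have htFC : (t : ℂ) * resCard F = 1 := by exact_mod_cast htF
    have htJ : (t : ℂ) ^ 2 * resCard F = t := by rw [pow_two, mul_assoc, htFC, mul_one]
    rw [hJ1, htJ] at hy ⊢
    have n3 : 1 + (t : ℂ) ^ 3 ≠ 0 := by exact_mod_cast (by positivity : (1 + t ^ 3 : ℝ) ≠ 0)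
    rw [scrL_of_unit hq h hχ hρ rfl rfl ht0 ht1 htF hγ1 hγ2, eq_div_iff (mul_ne_zero hD0 n3),
      ← mul_assoc]
    refine value_unramified hχ0 hρ0 ht0 ?_ ?_ hD
    · linear_combination hx + ((t : ℂ) ^ 3 * (χ (unif E) - x) + t * (1 - t ^ 2 * χ (unif E))) * htFC
    · linear_combination hy + (1 - t * ρ (unif E)) * htFC
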